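/- **Equations for the spacetime dynamics of fluids.** *Spacetime.* Let $m\ge 0$, let $W$ be a compact $m$-manifold and $\bar M$ a $4$-manifold. Let $M$ be a $(5+m)$-manifold with a multi-fiber bundle structure of fibers $(S^1,W)$, that is, a smooth fiber bundle $\pi:M\to\bar M$ with fiber $S^1\times W$ and a smooth map $\Phi=(h,f):M\to S^1\times W$ that restricts to a diffeomorphism from each fiber of $\pi$ onto $S^1\times W$. The fibers through $x\in M$ are $S^1_x=\{y:\pi(y)=\pi(x),\,f(y)=f(x)\}$ and $W_x=\{y:\pi(y)=\pi(x),\,h(y)=h(x)\}$. Let $g=\langle\cdot,\cdot\rangle$ be a smooth semi-Riemannian metric on $M$ of signature $(-)$ on the circles $S^1_x$, $(+,\dots,+)$ on the fibers $W_x$, and $(-,+,+,+)$ on the horizontal spaces $H_x=(T_x\pi^{-1}(\pi(x)))^{\perp}$. Let $Y$ be a smooth vector field tangent to the circles $S^1_x$ with $g(Y,Y)=-1$, and suppose that $Y$ is a Killing field. All objects are smooth. *Conventions.* $\nabla$ is the Levi-Civita connection, $\mathrm{Ric}$ the Ricci tensor and $S$ the scalar curvature; $G=2\,\mathrm{Ric}-S\,g$.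 For a $2$-tensor $T$, ${}^eT$ is the endomorphism with $g(u,{}^eT(v))=T(u,v)$, and $\nabla\cdot T$ is the vector associated to the $1$-form $\nabla^iT_{ij}$. For vectors $U,V$, the tensor $U\otimes V$ is identified with $U^\flat\otimes V^\flat$. Put $F=\mathbf d(Y^\flat)$ and $|F|_g=F_{ij}F^{ij}$. *Fluid.* Let $D\subset M$ be a fluid domain: $D$ is open and, at each $x\in D$, the endomorphism $pr_H\circ{}^eG|_H$ of $H_x$ has a timelike $1$-dimensional eigenspace of eigenvalue $-\mu(x)<0$. Let $X_0$ be a smooth vector field on $D$ spanning these eigenspaces, with $g(X_0,X_0)=-1$ (the sign being fixed by a choice of time orientation). Put $$e=G(X_0,Y),\qquad X=X_0+\tfrac e\mu Y,\qquad \beta=G(Y,Y)-\tfrac{e^2}{\mu},\qquad G=\mu X\otimes X+\beta Y\otimes Y+P ,$$ the last equality defining the pressure $P$. Let $\mathrm T=\langle X_0,Y\rangle$ be the time-plane. *Conclusion.* The pressure $P$ vanishes on $\mathrm T\times\mathrm T$, and on $D$ the following hold. 1. Energy conservation: $\nabla\cdot(\mu X)=\nabla\cdot(\mu X_0)=\langle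 X_0,\nabla\cdot P\rangle$. 2. Charge conservation: $\nabla\cdot(eX)=\nabla\cdot(eX_0)=\nabla\cdot({}^eP(Y))=\langle Y,\nabla\cdot P\rangle$. 3. $\mu^2X\!\left(\tfrac e\mu\right)=\mu\langle Y,\nabla\cdot P\rangle-e\langle X_0,\nabla\cdot P\rangle$. 4. Motion of the fluid: $\mu\nabla_XX=-\nabla\cdot P-\langle X_0,\nabla\cdot P\rangle X$. 5. Motion of the apparent fluid: $\mu\nabla_{X_0}X_0=e\,{}^eF(X_0)-pr_{\mathrm T^\perp}(\nabla\cdot P)$. 6. Maxwell equations: $\mathbf dF=0$ and $\nabla\cdot F=eX_0+\tfrac12|F|_g\,Y-{}^eP(Y)$. -/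

import Mathlib

open scoped Manifold ContDiff
open Bundle

namespace KaluzaKlein

noncomputable section

section SemiRiemannian

variable {E : Type*} [NormedAddCommGroup E] [NormedSpace ℝ E] [FiniteDimensional ℝ E]
  {M : Type*} [TopologicalSpace M] [ChartedSpace E M] [IsManifold 𝓘(ℝ, E) ∞ M]

/-- A smooth semi-Riemannian metric (of arbitrary signature) on a manifold `M` modelled on `E`. -/
structure SemiRiemannianMetric (E : Type*) [NormedAddCommGroup E] [NormedSpace ℝ E]
    (M : Type*) [TopologicalSpace M] [ChartedSpace E M] [IsManifold 𝓘(ℝ, E) ∞ M] where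
  /-- the scalar product on each tangent space -/
  val (x : M) : TangentSpace 𝓘(ℝ, E) x →L[ℝ] TangentSpace 𝓘(ℝ, E) x →L[ℝ] ℝ
  symm (x : M) (v w : TangentSpace 𝓘(ℝ, E) x) : val x v w = val x w v
  nondegenerate (x : M) (v : TangentSpace 𝓘(ℝ, E) x) (hv : ∀ w, val x v w = 0) : v = 0
  contMDiff : ContMDiff 𝓘(ℝ, E) (𝓘(ℝ, E).prod 𝓘(ℝ, E →L[ℝ] E →L[ℝ] ℝ)) ∞
    (fun x ↦ TotalSpace.mk' (E →L[ℝ] E →L[ℝ] ℝ)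
      (E := fun x : M ↦ TangentSpace 𝓘(ℝ, E) x →L[ℝ] TangentSpace 𝓘(ℝ, E) x →L[ℝ] ℝ)
      x (val x))

/-- A field of `2`-tensors, given by its values on pairs of tangent vectors. -/
abbrev TwoTensor (E : Type*) [NormedAddCommGroup E] [NormedSpace ℝ E]
    (M : Type*) [TopologicalSpace M] [ChartedSpace E M] :=
  ∀ x : M, TangentSpace 𝓘(ℝ, E) x → TangentSpace 𝓘(ℝ, E) x → ℝ

/-- `V` is a smooth vector field on the set `D`. -/
def SmoothFieldOn (V : ∀ x : M, TangentSpace 𝓘(ℝ, E) x) (D : Set M) : Prop :=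
  ContMDiffOn 𝓘(ℝ, E) 𝓘(ℝ, E).tangent ∞ (fun x ↦ (⟨x, V x⟩ : TangentBundle 𝓘(ℝ, E) M)) D

/-- The derivative `v(f)` of a real function `f` along a tangent vector `v` at `x`. -/
def dirDeriv (f : M → ℝ) (x : M) (v : TangentSpace 𝓘(ℝ, E) x) : ℝ :=
  mvfderiv 𝓘(ℝ, E) f x v

/-- A vector field extending the tangent vector `v` at `x`, smooth near `x`. -/
def ext {x : M} (v : TangentSpace 𝓘(ℝ, E) x) (y : M) : TangentSpace 𝓘(ℝ, E) y :=
  FiberBundle.extend E v y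

/-! ### Algebra of the metric at a point -/

/-- A basis `b_i` of the tangent space at `x`. -/
def basisAt (x : M) :
    Module.Basis (Fin (Module.finrank ℝ E)) ℝ (TangentSpace 𝓘(ℝ, E) x) :=
  Module.finBasis ℝ E

/-- The reciprocal basis `b^i`, characterised by `g(b^i, b_j) = δ_{ij}`.
For an orthonormal frame `E_i` with `g(E_i, E_i) = ε_i` it would be `ε_i E_i`. -/
def recip (g : SemiRiemannianMetric E M) (x : M) (i : Fin (Module.finrank ℝ E)) :
    TangentSpace 𝓘(ℝ, E) x :=
  let gx : E →L[ℝ] E →L[ℝ] ℝ := g.val x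
  gx.inverse (LinearMap.toContinuousLinearMap ((Module.finBasis ℝ E).coord i))

/-- The vector `α^♯` associated to a linear form `α` on the tangent space at `x`. -/
def sharp (g : SemiRiemannianMetric E M) (x : M) (α : TangentSpace 𝓘(ℝ, E) x → ℝ) :
    TangentSpace 𝓘(ℝ, E) x :=
  ∑ i, α (basisAt x i) • recip g x i

/-- The metric trace `g^{ij} T_{ij}` of a bilinear form `T` on the tangent space at `x`. -/
def metricTrace (g : SemiRiemannianMetric E M) (x : M)
    (T : TangentSpace 𝓘(ℝ, E) x → TangentSpace 𝓘(ℝ, E) x → ℝ) : ℝ :=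
  ∑ i, T (basisAt x i) (recip g x i)

/-- The full contraction `T_{ij} T^{ij}` of a bilinear form `T` on the tangent space at `x`. -/
def contraction (g : SemiRiemannianMetric E M) (x : M)
    (T : TangentSpace 𝓘(ℝ, E) x → TangentSpace 𝓘(ℝ, E) x → ℝ) : ℝ :=
  ∑ i, ∑ j, T (basisAt x i) (basisAt x j) * T (recip g x i) (recip g x j)

/-- The endomorphism `ᵉT` associated to a `2`-tensor: `g(u, ᵉT(v)) = T(u, v)`. -/
def endo (g : SemiRiemannianMetric E M) (T : TwoTensor E M) (x : M)
    (v : TangentSpace 𝓘(ℝ, E) x) : TangentSpace 𝓘(ℝ, E) x :=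
  sharp g x (fun u ↦ T x u v)

/-- The `g`-orthogonal of a subspace of the tangent space at `x`. -/
def perp (g : SemiRiemannianMetric E M) (x : M) (K : Submodule ℝ (TangentSpace 𝓘(ℝ, E) x)) :
    Submodule ℝ (TangentSpace 𝓘(ℝ, E) x) where
  carrier := {v | ∀ w ∈ K, g.val x v w = 0}
  add_mem' := by
    intro a b ha hb w hw
    simp [ha w hw, hb w hw]
  zero_mem' := by
    intro w _
    simp
  smul_mem' := by
    intro c a ha w hw
    simp [ha w hw]

/-- `p` is the `g`-orthogonal projection of `v` on the subspace `K`. -/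
def IsOrthProj (g : SemiRiemannianMetric E M) (x : M)
    (K : Submodule ℝ (TangentSpace 𝓘(ℝ, E) x)) (v p : TangentSpace 𝓘(ℝ, E) x) : Prop :=
  p ∈ K ∧ v - p ∈ perp g x K

/-! ### Levi-Civita connection and curvature -/

/-- The matrix `g_{ij}` of the metric in the chart at `x`, at the point of coordinates `z`. -/
def chartMetric (g : SemiRiemannianMetric E M) (x : M) (z : E) : E →L[ℝ] E →L[ℝ] ℝ :=
  let gz : E →L[ℝ] E →L[ℝ] ℝ := g.val ((extChartAt 𝓘(ℝ, E) x).symm z)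
  let A : E →L[ℝ] E := mfderiv 𝓘(ℝ, E) 𝓘(ℝ, E) (extChartAt 𝓘(ℝ, E) x).symm z
  gz.bilinearComp A A

/-- The components of the vector field `V` in the chart at `x`, at the point of coordinates `z`. -/
def chartField (V : ∀ x : M, TangentSpace 𝓘(ℝ, E) x) (x : M) (z : E) : E :=
  VectorField.mpullback 𝓘(ℝ, E) 𝓘(ℝ, E) (extChartAt 𝓘(ℝ, E) x).symm V z

/-- The Christoffel symbols at `x` in the chart at `x`, as the map `u ↦ Γ(u, v)`:
`g(Γ(u, v), w) = ½ (∂_u g(v, w) + ∂_v g(u, w) - ∂_w g(u, v))`. -/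
def christoffel (g : SemiRiemannianMetric E M) (x : M) (v : E) : E →L[ℝ] E :=
  let z := extChartAt 𝓘(ℝ, E) x x
  let dg : E →L[ℝ] E →L[ℝ] E →L[ℝ] ℝ := fderiv ℝ (F := E →L[ℝ] E →L[ℝ] ℝ) (chartMetric g x) z
  let a : E →L[ℝ] E →L[ℝ] ℝ := dg.flip v
  let c : E →L[ℝ] E →L[ℝ] ℝ := dg v
  let k : E →L[ℝ] E →L[ℝ] ℝ := (1 / 2 : ℝ) • (a + c - a.flip)
  (chartMetric g x z).inverse ∘L k

/-- The Levi-Civita covariant derivative: `nabla g V x u` is `(∇_u V)(x)`, that is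
`∂_u V + Γ(u, V)` in the chart at `x`. -/
def nabla (g : SemiRiemannianMetric E M) (V : ∀ x : M, TangentSpace 𝓘(ℝ, E) x) (x : M) :
    TangentSpace 𝓘(ℝ, E) x →L[ℝ] TangentSpace 𝓘(ℝ, E) x :=
  let z := extChartAt 𝓘(ℝ, E) x x
  let A : TangentSpace 𝓘(ℝ, E) x →L[ℝ] E := mfderiv 𝓘(ℝ, E) 𝓘(ℝ, E) (extChartAt 𝓘(ℝ, E) x) x
  A.inverse ∘L (fderiv ℝ (chartField V x) z + christoffel g x (chartField V x z)) ∘L A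

/-- The curvature `R(U, V)W = ∇_U ∇_V W - ∇_V ∇_U W - ∇_{[U, V]} W` on vector fields. -/
def curvature (g : SemiRiemannianMetric E M) (U V W : ∀ x : M, TangentSpace 𝓘(ℝ, E) x) (x : M) :
    TangentSpace 𝓘(ℝ, E) x :=
  nabla g (fun y ↦ nabla g W y (V y)) x (U x) - nabla g (fun y ↦ nabla g W y (U y)) x (V x)
    - nabla g W x (VectorField.mlieBracket 𝓘(ℝ, E) U V x)

/-- The Ricci tensor: `Ric(v, w)` is the trace of `u ↦ R(u, v)w`. -/
def ricci (g : SemiRiemannianMetric E M) : TwoTensor E M := fun x v w ↦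
  ∑ i, (basisAt x).coord i (curvature g (ext (basisAt x i)) (ext v) (ext w) x)

/-- The scalar curvature. -/
def scalarCurvature (g : SemiRiemannianMetric E M) (x : M) : ℝ :=
  metricTrace g x (ricci g x)

/-- Twice the Einstein curvature: `G = 2 Ric - S g`. -/
def einstein (g : SemiRiemannianMetric E M) : TwoTensor E M := fun x v w ↦
  2 * ricci g x v w - scalarCurvature g x * g.val x v w

/-! ### Divergences, exterior derivatives, Killing fields -/

/-- The divergence of a vector field, the trace of `u ↦ ∇_u V`. -/
def divField (g : SemiRiemannianMetric E M) (V : ∀ x : M, TangentSpace 𝓘(ℝ, E) x) (x : M) : ℝ :=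
  LinearMap.trace ℝ (TangentSpace 𝓘(ℝ, E) x) (nabla g V x)

/-- The covariant derivative `(∇_u T)(v, w)` of a `2`-tensor. -/
def nablaTensor (g : SemiRiemannianMetric E M) (T : TwoTensor E M) (x : M)
    (u v w : TangentSpace 𝓘(ℝ, E) x) : ℝ :=
  dirDeriv (fun y ↦ T y (ext v y) (ext w y)) x u
    - T x (nabla g (ext v) x u) w - T x v (nabla g (ext w) x u)

/-- The divergence `(∇·T)_j = ∇^i T_{ij}` of a `2`-tensor, as a linear form. -/
def divForm (g : SemiRiemannianMetric E M) (T : TwoTensor E M) (x : M)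
    (w : TangentSpace 𝓘(ℝ, E) x) : ℝ :=
  metricTrace g x (fun u v ↦ nablaTensor g T x u v w)

/-- The divergence of a `2`-tensor, as a vector. -/
def divTensor (g : SemiRiemannianMetric E M) (T : TwoTensor E M) (x : M) :
    TangentSpace 𝓘(ℝ, E) x :=
  sharp g x (divForm g T x)

/-- The exterior derivative of a `1`-form:
`dα(U, V) = U(α(V)) - V(α(U)) - α([U, V])`. -/
def extDerivOne (α : ∀ x : M, TangentSpace 𝓘(ℝ, E) x → ℝ) : TwoTensor E M := fun x u v ↦
  dirDeriv (fun y ↦ α y (ext v y)) x u - dirDeriv (fun y ↦ α y (ext u y)) x v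
    - α x (VectorField.mlieBracket 𝓘(ℝ, E) (ext u) (ext v) x)

/-- The exterior derivative of a `2`-form: `dθ(U, V, W) = U(θ(V, W)) - V(θ(U, W)) + W(θ(U, V))
- θ([U, V], W) + θ([U, W], V) - θ([V, W], U)`. -/
def extDerivTwo (θ : TwoTensor E M) (x : M) (u v w : TangentSpace 𝓘(ℝ, E) x) : ℝ :=
  dirDeriv (fun y ↦ θ y (ext v y) (ext w y)) x u - dirDeriv (fun y ↦ θ y (ext u y) (ext w y)) x v
    + dirDeriv (fun y ↦ θ y (ext u y) (ext v y)) x w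
    - θ x (VectorField.mlieBracket 𝓘(ℝ, E) (ext u) (ext v) x) w
    + θ x (VectorField.mlieBracket 𝓘(ℝ, E) (ext u) (ext w) x) v
    - θ x (VectorField.mlieBracket 𝓘(ℝ, E) (ext v) (ext w) x) u

/-- The Killing equation `∇_i Y_j + ∇_j Y_i = 0`. -/
def IsKilling (g : SemiRiemannianMetric E M) (Y : ∀ x : M, TangentSpace 𝓘(ℝ, E) x) : Prop :=
  ∀ (x : M) (u v : TangentSpace 𝓘(ℝ, E) x),
    g.val x (nabla g Y x u) v + g.val x u (nabla g Y x v) = 0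

end SemiRiemannian

/-! ### Multi-fiber bundles with fibers `(S¹, W)` -/

section MultiFiber

/-- The structure of multi-fiber bundle with fibers `(S¹, W)` on `M`: a smooth fiber bundle
`π : M → B` with fiber `S¹ × W`, and a smooth map `Φ = (h, f) : M → S¹ × W` that restricts to a
diffeomorphism from each fiber of `π` onto `S¹ × W`. -/
structure MultiFiberBundle (m : ℕ)
    (M : Type*) [TopologicalSpace M] [ChartedSpace (EuclideanSpace ℝ (Fin (5 + m))) M]
    (B : Type*) [TopologicalSpace B] [ChartedSpace (EuclideanSpace ℝ (Fin 4)) B]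
    (W : Type*) [TopologicalSpace W] [ChartedSpace (EuclideanSpace ℝ (Fin m)) W] where
  /-- the projection `π` -/
  proj : M → B
  /-- the map `Φ = (h, f)` -/
  fib : M → Circle × W
  contMDiff_proj : ContMDiff (𝓡 (5 + m)) (𝓡 4) ∞ proj
  contMDiff_fib : ContMDiff (𝓡 (5 + m)) ((𝓡 1).prod (𝓡 m)) ∞ fib
  locally_trivial : ∀ b : B, ∃ (U : Set B) (τ : OpenPartialHomeomorph M (B × (Circle × W))),
    IsOpen U ∧ b ∈ U ∧ τ.source = proj ⁻¹' U ∧ τ.target = U ×ˢ Set.univ ∧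
    (∀ p ∈ τ.source, (τ p).1 = proj p) ∧
    ContMDiffOn (𝓡 (5 + m)) ((𝓡 4).prod ((𝓡 1).prod (𝓡 m))) ∞ τ τ.source ∧
    ContMDiffOn ((𝓡 4).prod ((𝓡 1).prod (𝓡 m))) (𝓡 (5 + m)) ∞ τ.symm τ.target
  /-- on each fiber, `Φ` has a smooth inverse `σ` -/
  fiber_diffeo : ∀ b : B, ∃ σ : Circle × W → M,
    ContMDiff ((𝓡 1).prod (𝓡 m)) (𝓡 (5 + m)) ∞ σ ∧ (∀ q, proj (σ q) = b) ∧ (∀ q, fib (σ q) = q) ∧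
    ∀ p, proj p = b → σ (fib p) = p

namespace MultiFiberBundle

variable {m : ℕ}
  {M : Type*} [TopologicalSpace M] [ChartedSpace (EuclideanSpace ℝ (Fin (5 + m))) M]
  [IsManifold (𝓡 (5 + m)) ∞ M]
  {B : Type*} [TopologicalSpace B] [ChartedSpace (EuclideanSpace ℝ (Fin 4)) B]
  {W : Type*} [TopologicalSpace W] [ChartedSpace (EuclideanSpace ℝ (Fin m)) W]

/-- The tangent space at `x` to the `π`-fiber through `x`. -/
def tangentF (b : MultiFiberBundle m M B W) (x : M) : Submodule ℝ (TangentSpace (𝓡 (5 + m)) x) :=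
  LinearMap.ker (mfderiv (𝓡 (5 + m)) (𝓡 4) b.proj x).toLinearMap

/-- The tangent space at `x` to the circle `S¹_x = {y | π y = π x, f y = f x}`. -/
def tangentS (b : MultiFiberBundle m M B W) (x : M) : Submodule ℝ (TangentSpace (𝓡 (5 + m)) x) :=
  b.tangentF x ⊓ LinearMap.ker (mfderiv (𝓡 (5 + m)) (𝓡 m) (fun y ↦ (b.fib y).2) x).toLinearMap

/-- The tangent space at `x` to the fiber `W_x = {y | π y = π x, h y = h x}`. -/
def tangentW (b : MultiFiberBundle m M B W) (x : M) : Submodule ℝ (TangentSpace (𝓡 (5 + m)) x) :=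
  b.tangentF x ⊓ LinearMap.ker (mfderiv (𝓡 (5 + m)) (𝓡 1) (fun y ↦ (b.fib y).1) x).toLinearMap

/-- The horizontal space `H_x`, orthogonal to the `π`-fiber through `x`. -/
def horizontal (b : MultiFiberBundle m M B W)
    (g : SemiRiemannianMetric (EuclideanSpace ℝ (Fin (5 + m))) M) (x : M) :
    Submodule ℝ (TangentSpace (𝓡 (5 + m)) x) :=
  perp g x (b.tangentF x)

/-- The signature of `g` is `(-)` on the circles `S¹_x`, `(+, …, +)` on the fibers `W_x` and
`(-, +, +, +)` on the horizontal spaces. -/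
structure IsCompatible (b : MultiFiberBundle m M B W)
    (g : SemiRiemannianMetric (EuclideanSpace ℝ (Fin (5 + m))) M) : Prop where
  neg_S : ∀ x, ∀ v ∈ b.tangentS x, v ≠ 0 → g.val x v v < 0
  pos_W : ∀ x, ∀ v ∈ b.tangentW x, v ≠ 0 → 0 < g.val x v v
  lorentz_H : ∀ x, ∃ t ∈ b.horizontal g x, g.val x t t < 0 ∧
    ∀ v ∈ b.horizontal g x, g.val x t v = 0 → v ≠ 0 → 0 < g.val x v v

/-- `Y` is a smooth vector field tangent to the circles `S¹_x`, with `g(Y, Y) = -1`, and it is a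
Killing field. -/
structure IsPotential (b : MultiFiberBundle m M B W)
    (g : SemiRiemannianMetric (EuclideanSpace ℝ (Fin (5 + m))) M)
    (Y : ∀ x : M, TangentSpace (𝓡 (5 + m)) x) : Prop where
  smooth : SmoothFieldOn Y Set.univ
  tangent : ∀ x, Y x ∈ b.tangentS x
  unit : ∀ x, g.val x (Y x) (Y x) = -1
  killing : IsKilling g Y

/-- The eigenspace, for the eigenvalue `c`, of the endomorphism `v ↦ pr_H (ᵉG v)` of the
horizontal space `H_x`. -/
def horizontalEigenspace (b : MultiFiberBundle m M B W)
    (g : SemiRiemannianMetric (EuclideanSpace ℝ (Fin (5 + m))) M) (x : M) (c : ℝ) :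
    Set (TangentSpace (𝓡 (5 + m)) x) :=
  {v | v ∈ b.horizontal g x ∧ IsOrthProj g x (b.horizontal g x) (endo g (einstein g) x v) (c • v)}

/-- `D` is a fluid domain, with energy density `μ` and apparent field `X₀`: on the open set `D`,
`X₀` is a smooth field of unit timelike vectors spanning the eigenspace of `pr_H ∘ ᵉG` for the
eigenvalue `-μ < 0`. -/
structure IsFluidDomain (b : MultiFiberBundle m M B W)
    (g : SemiRiemannianMetric (EuclideanSpace ℝ (Fin (5 + m))) M) (D : Set M) (μ : M → ℝ)
    (X₀ : ∀ x : M, TangentSpace (𝓡 (5 + m)) x) : Prop where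
  isOpen : IsOpen D
  smooth : SmoothFieldOn X₀ D
  unit : ∀ x ∈ D, g.val x (X₀ x) (X₀ x) = -1
  pos : ∀ x ∈ D, 0 < μ x
  eigenspace : ∀ x ∈ D,
    b.horizontalEigenspace g x (-μ x) = (Submodule.span ℝ {X₀ x} : Set (TangentSpace (𝓡 (5 + m)) x))

end MultiFiberBundle

end MultiFiber

/-! ### Classical data of a fluid -/

section Fluid

variable {E : Type*} [NormedAddCommGroup E] [NormedSpace ℝ E] [FiniteDimensional ℝ E]
  {M : Type*} [TopologicalSpace M] [ChartedSpace E M] [IsManifold 𝓘(ℝ, E) ∞ M]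

/-- The charge density `e = G(X₀, Y)`. -/
def chargeDensity (g : SemiRiemannianMetric E M) (X₀ Y : ∀ x : M, TangentSpace 𝓘(ℝ, E) x)
    (x : M) : ℝ :=
  einstein g x (X₀ x) (Y x)

/-- The vector field `X = X₀ + (e / μ) Y` of the fluid. -/
def fluidField (g : SemiRiemannianMetric E M) (μ : M → ℝ)
    (X₀ Y : ∀ x : M, TangentSpace 𝓘(ℝ, E) x) (x : M) : TangentSpace 𝓘(ℝ, E) x :=
  X₀ x + (chargeDensity g X₀ Y x / μ x) • Y x

/-- The function `β`, determined by `β + e² / μ = G(Y, Y)`. -/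
def betaCoeff (g : SemiRiemannianMetric E M) (μ : M → ℝ)
    (X₀ Y : ∀ x : M, TangentSpace 𝓘(ℝ, E) x) (x : M) : ℝ :=
  einstein g x (Y x) (Y x) - chargeDensity g X₀ Y x ^ 2 / μ x

/-- The pressure `P`, determined by `G = μ X ⊗ X + β Y ⊗ Y + P`. -/
def pressure (g : SemiRiemannianMetric E M) (μ : M → ℝ)
    (X₀ Y : ∀ x : M, TangentSpace 𝓘(ℝ, E) x) : TwoTensor E M := fun x v w ↦
  einstein g x v w
    - (μ x * (g.val x (fluidField g μ X₀ Y x) v * g.val x (fluidField g μ X₀ Y x) w)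
      + betaCoeff g μ X₀ Y x * (g.val x (Y x) v * g.val x (Y x) w))

/-- The electromagnetic field `F = d(Y^♭)`. -/
def emField (g : SemiRiemannianMetric E M) (Y : ∀ x : M, TangentSpace 𝓘(ℝ, E) x) :
    TwoTensor E M :=
  extDerivOne (fun x v ↦ g.val x (Y x) v)

/-- The time-plane generated by `X₀` and `Y`. -/
def timePlane (X₀ Y : ∀ x : M, TangentSpace 𝓘(ℝ, E) x) (x : M) :
    Submodule ℝ (TangentSpace 𝓘(ℝ, E) x) :=
  Submodule.span ℝ {X₀ x, Y x}

end Fluid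

end

end KaluzaKlein

open KaluzaKlein

/-!
Every quantity in the theorem at a point `x` depends only on the fields near `x`, and can be
computed in the chart at `x`. The proof therefore splits into Levi-Civita calculus for a
semi-Riemannian metric `g : E → E →L[ℝ] E →L[ℝ] ℝ` on an open set of the model space (namespace
`Coord`), and a translation between the manifold and the chart.

In coordinates, the equations come from three facts.

* The tensor `G = 2 Ric - S g` is divergence free (`Coord.IsMetricOn.divT_ein`), by the contracted
  second Bianchi identity. Inserting `G = μ X ⊗ X + β Y ⊗ Y + P` and
  `∇·(c V ⊗ V) = (∇·(c V)) V + c ∇_V V` gives `(∇·(μX)) X + μ ∇_X X + ∇·P = 0`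
  (`Coord.IsFluidOn.divT_press`); the `Y` terms drop out because `∇_Y Y = 0` and `∇·(βY) = 0`.
* The flow of the Killing field `Y` preserves the metric, hence the Christoffel symbols, the
  curvature and `G` (`Coord.IsKillingOn.lie_ein`). It also preserves the horizontal spaces, as `Y`
  is vertical, hence the eigenspaces spanned by `X₀`; since `X₀` is a unit field it is itself
  invariant, `[Y, X₀] = 0` (`Coord.bracket_eq_of_eigenspace`). No flow is used: invariance is
  expressed by the vanishing of Lie derivatives, and horizontal vectors are extended to horizontal
  fields commuting with `Y`. It follows that `μ`, `e` and `β` are constant along `Y`, and that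
  `∇_X X = ∇_{X₀} X₀ + 2 (e/μ) ∇_{X₀} Y + X(e/μ) Y`. Pairing the first identity with `X₀`, with `Y`
  and with arbitrary vectors gives the conservation laws and the equations of motion.
* For a Killing field, `F = d(Y^♭) = 2 g(∇Y, ·)` and `∇²_{u,v} Y = R(u, Y)v`, so that
  `∇·F = -2 Ric(Y)` (`Coord.IsKillingOn.divT_field`); when moreover `g(Y, Y) = -1`, one has
  `Ric(Y, Y) = |∇Y|²`. With `G(Y) = 2 Ric(Y) - S Y` and the decomposition of `G` this is the
  inhomogeneous Maxwell equation `Coord.IsFluidOn.maxwell`.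

For the translation, the connection of the manifold is defined at each point by the chart centered
there. That it agrees, near `x`, with the coordinate connection of the single chart at `x`
(`nabla_chart`) is the naturality of the covariant derivative under changes of coordinates
(`Coord.cov_naturality`). Curvature, Ricci tensor and `G` at nearby points follow
(`curvature_chart`, `einstein_chart`), and `MultiFiberBundle.IsFluidDomain.isChartFluid` shows that
a fluid domain has the coordinates of a fluid in the sense of `Coord.IsFluidOn`.
-/

namespace KaluzaKlein

open scoped Topology

-- spaces of multilinear maps, nested as `E →L[ℝ] E →L[ℝ] E →L[ℝ] E`, need a deeper instance search
set_option maxSynthPendingDepth 3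
set_option synthInstance.maxHeartbeats 200000
set_option linter.unusedSectionVars false

noncomputable section

/-! ### Derivatives of tensors applied to vector fields -/

section Calculus

variable {E F G H : Type*} [NormedAddCommGroup E] [NormedSpace ℝ E]
  [NormedAddCommGroup F] [NormedSpace ℝ F] [NormedAddCommGroup G] [NormedSpace ℝ G]
  [NormedAddCommGroup H] [NormedSpace ℝ H]

lemma fderiv_apply_field {T : E → F →L[ℝ] G} {V : E → F} {z : E} (hT : DifferentiableAt ℝ T z)
    (hV : DifferentiableAt ℝ V z) (u : E) :
    fderiv ℝ (fun z ↦ T z (V z)) z u = fderiv ℝ T z u (V z) + T z (fderiv ℝ V z u) := by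
  rw [fderiv_clm_apply hT hV]
  simp [add_comm]

lemma fderiv_apply_const {T : E → F →L[ℝ] G} {z : E} (hT : DifferentiableAt ℝ T z)
    (v : F) (u : E) : fderiv ℝ (fun z ↦ T z v) z u = fderiv ℝ T z u v := by
  rw [fderiv_apply_field hT (differentiableAt_const v)]
  simp

lemma fderiv_apply_field₂ {T : E → F →L[ℝ] G →L[ℝ] H} {V : E → F} {W : E → G} {z : E}
    (hT : DifferentiableAt ℝ T z) (hV : DifferentiableAt ℝ V z) (hW : DifferentiableAt ℝ W z)
    (u : E) :
    fderiv ℝ (fun z ↦ T z (V z) (W z)) z u =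
      fderiv ℝ T z u (V z) (W z) + T z (fderiv ℝ V z u) (W z) + T z (V z) (fderiv ℝ W z u) := by
  rw [fderiv_apply_field (hT.clm_apply hV) hW, fderiv_apply_field hT hV]
  simp

lemma fderiv_apply_const₂ {T : E → F →L[ℝ] G →L[ℝ] H} {z : E} (hT : DifferentiableAt ℝ T z)
    (v : F) (w : G) (u : E) : fderiv ℝ (fun z ↦ T z v w) z u = fderiv ℝ T z u v w := by
  rw [fderiv_apply_field₂ hT (differentiableAt_const v) (differentiableAt_const w)]
  simp

lemma fderiv_fderiv_symm {f : E → F} {z : E} (hf : ContDiffAt ℝ ∞ f z) (u v : E) :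
    fderiv ℝ (fderiv ℝ f) z u v = fderiv ℝ (fderiv ℝ f) z v u :=
  hf.isSymmSndFDerivAt (by simpa using ENat.LEInfty.out) u v

lemma contDiffAt_fderiv {f : E → F} {z : E} (hf : ContDiffAt ℝ ∞ f z) :
    ContDiffAt ℝ ∞ (fderiv ℝ f) z :=
  hf.fderiv_right (by simp)

lemma smooth_differentiableAt {f : E → F} {z : E} (hf : ContDiffAt ℝ ∞ f z) :
    DifferentiableAt ℝ f z :=
  hf.differentiableAt (by simp)

/-- Two functions that agree on an open set have the same derivative there. -/
lemma fderiv_congr_of_isOpen {f f' : E → F} {U : Set E} (hU : IsOpen U)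
    (h : ∀ z ∈ U, f z = f' z) {z : E} (hz : z ∈ U) : fderiv ℝ f z = fderiv ℝ f' z :=
  Filter.EventuallyEq.fderiv_eq (Filter.eventuallyEq_of_mem (hU.mem_nhds hz) h)

/-- In finite dimension, smoothness of a field of linear maps is tested on constant vectors. -/
lemma contDiffAt_of_apply [FiniteDimensional ℝ F] {f : E → F →L[ℝ] G} {U : Set E} (hU : IsOpen U)
    (h : ∀ y, ∀ z ∈ U, ContDiffAt ℝ ∞ (fun z ↦ f z y) z) {z : E} (hz : z ∈ U) :
    ContDiffAt ℝ ∞ f z :=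
  ((contDiffOn_clm_apply (s := U)).2
    (fun y z hz ↦ (h y z hz).contDiffWithinAt)).contDiffAt (hU.mem_nhds hz)

end Calculus

/-! ### Levi-Civita calculus on an open set of a vector space -/

namespace Coord

variable {E : Type*} [NormedAddCommGroup E] [NormedSpace ℝ E] [FiniteDimensional ℝ E]

/-- A smooth semi-Riemannian metric `g` on an open set `U` of a vector space. -/
structure IsMetricOn (g : E → E →L[ℝ] E →L[ℝ] ℝ) (U : Set E) : Prop where
  isOpen : IsOpen U
  smooth : ∀ z ∈ U, ContDiffAt ℝ ∞ g z
  symm : ∀ z ∈ U, ∀ u v, g z u v = g z v u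
  nondegenerate : ∀ z ∈ U, ∀ v, (∀ w, g z v w = 0) → v = 0

/-- The Christoffel symbols `Γ(v, u)` of `g`, as a field of bilinear maps:
`g(Γ(v, u), w) = ½ (∂_u g(v, w) + ∂_v g(u, w) - ∂_w g(v, u))`. -/
def chr (g : E → E →L[ℝ] E →L[ℝ] ℝ) (z : E) : E →L[ℝ] E →L[ℝ] E :=
  (ContinuousLinearMap.compL ℝ E (E →L[ℝ] ℝ) E (g z).inverse) ∘L
    ((1 / 2 : ℝ) • ((fderiv ℝ g z).flip + fderiv ℝ g z
      - (ContinuousLinearMap.flipₗᵢ ℝ E E ℝ : (E →L[ℝ] E →L[ℝ] ℝ) →L[ℝ] E →L[ℝ] E →L[ℝ] ℝ)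
          ∘L (fderiv ℝ g z).flip))

/-- The covariant derivative `∇_u V = ∂_u V + Γ(u, V)` in coordinates. -/
def cov (g : E → E →L[ℝ] E →L[ℝ] ℝ) (V : E → E) (z : E) : E →L[ℝ] E :=
  fderiv ℝ V z + chr g z (V z)

/-- The curvature in coordinates,
`R(v, w)a = ∂_vΓ(w, a) - ∂_wΓ(v, a) + Γ(v, Γ(w, a)) - Γ(w, Γ(v, a))`. -/
def curv (g : E → E →L[ℝ] E →L[ℝ] ℝ) (z : E) : E →L[ℝ] E →L[ℝ] E →L[ℝ] E :=
  fderiv ℝ (chr g) z - (fderiv ℝ (chr g) z).flip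
    + (ContinuousLinearMap.compL ℝ E E E).bilinearComp (chr g z) (chr g z)
    - ((ContinuousLinearMap.compL ℝ E E E).bilinearComp (chr g z) (chr g z)).flip

/-- The trace of endomorphisms, as a continuous linear form. -/
def traceL : (E →L[ℝ] E) →L[ℝ] ℝ :=
  LinearMap.toContinuousLinearMap
    ((LinearMap.trace ℝ E) ∘ₗ ContinuousLinearMap.coeLM ℝ)

/-- The contraction `(v, w) ↦ tr (u ↦ R(u, v)w)`. -/
def ricciContraction : (E →L[ℝ] E →L[ℝ] E →L[ℝ] E) →L[ℝ] E →L[ℝ] E →L[ℝ] ℝ :=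
  LinearMap.toContinuousLinearMap
    { toFun := fun R ↦ (ContinuousLinearMap.compL ℝ E (E →L[ℝ] E) ℝ traceL) ∘L
        ((ContinuousLinearMap.flipₗᵢ ℝ E E E : (E →L[ℝ] E →L[ℝ] E) →L[ℝ] E →L[ℝ] E →L[ℝ] E)
          ∘L R.flip)
      map_add' := fun R S ↦ by ext; simp
      map_smul' := fun c R ↦ by ext; simp }

/-- The Ricci tensor in coordinates. -/
def ric (g : E → E →L[ℝ] E →L[ℝ] ℝ) (z : E) : E →L[ℝ] E →L[ℝ] ℝ :=
  ricciContraction (curv g z)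

/-- The endomorphism `Q` with `g(Q v, w) = T(v, w)`. -/
def raise (g : E → E →L[ℝ] E →L[ℝ] ℝ) (T : E → E →L[ℝ] E →L[ℝ] ℝ) (z : E) : E →L[ℝ] E :=
  (g z).inverse ∘L T z

/-- The scalar curvature in coordinates. -/
def scal (g : E → E →L[ℝ] E →L[ℝ] ℝ) (z : E) : ℝ := traceL (raise g (ric g) z)

/-- Twice the Einstein tensor in coordinates. -/
def ein (g : E → E →L[ℝ] E →L[ℝ] ℝ) (z : E) : E →L[ℝ] E →L[ℝ] ℝ :=
  (2 : ℝ) • ric g z - scal g z • g z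

variable {g : E → E →L[ℝ] E →L[ℝ] ℝ} {U : Set E} {z : E}

lemma traceL_apply (A : E →L[ℝ] E) : traceL A = LinearMap.trace ℝ E A := rfl

lemma ricciContraction_apply (R : E →L[ℝ] E →L[ℝ] E →L[ℝ] E) (v w : E) :
    ricciContraction R v w = traceL ((R.flip v).flip w) := rfl

lemma curv_apply (z v w a : E) :
    curv g z v w a = fderiv ℝ (chr g) z v w a - fderiv ℝ (chr g) z w v a
      + chr g z v (chr g z w a) - chr g z w (chr g z v a) := rfl

/-- A nondegenerate bilinear form is invertible as a map to the dual space. -/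
lemma isInvertible_of_nondegenerate {T : E →L[ℝ] E →L[ℝ] ℝ}
    (h : ∀ v, (∀ w, T v w = 0) → v = 0) : T.IsInvertible := by
  have hinj : Function.Injective T := by
    rw [injective_iff_map_eq_zero]
    exact fun v hv ↦ h v (fun w ↦ by rw [hv]; rfl)
  have hdim : Module.finrank ℝ E = Module.finrank ℝ (E →L[ℝ] ℝ) := by
    rw [← (LinearMap.toContinuousLinearMap (𝕜 := ℝ) (E := E) (F' := ℝ)).finrank_eq]
    exact (Subspace.dual_finrank_eq).symm
  exact ⟨(LinearEquiv.ofInjectiveOfFinrankEq T.toLinearMap hinj hdim).toContinuousLinearEquiv,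
    by ext; rfl⟩

namespace IsMetricOn

lemma mono {V : Set E} (h : IsMetricOn g U) (hV : IsOpen V) (hVU : V ⊆ U) : IsMetricOn g V :=
  ⟨hV, fun z hz ↦ h.smooth z (hVU hz), fun z hz ↦ h.symm z (hVU hz),
    fun z hz ↦ h.nondegenerate z (hVU hz)⟩

lemma differentiableAt (h : IsMetricOn g U) (hz : z ∈ U) : DifferentiableAt ℝ g z :=
  smooth_differentiableAt (h.smooth z hz)

lemma isInvertible (h : IsMetricOn g U) (hz : z ∈ U) : (g z).IsInvertible :=
  isInvertible_of_nondegenerate (h.nondegenerate z hz)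

lemma apply_inverse (h : IsMetricOn g U) (hz : z ∈ U) (α : E →L[ℝ] ℝ) (w : E) :
    g z ((g z).inverse α) w = α w := by
  rw [(h.isInvertible hz).self_apply_inverse]

lemma ext_of_apply (h : IsMetricOn g U) (hz : z ∈ U) {v v' : E}
    (hv : ∀ w, g z v w = g z v' w) : v = v' :=
  sub_eq_zero.1 (h.nondegenerate z hz _ fun w ↦ by simp [hv w])

lemma raise_apply (h : IsMetricOn g U) (hz : z ∈ U) (T : E → E →L[ℝ] E →L[ℝ] ℝ) (v w : E) :
    g z (raise g T z v) w = T z v w :=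
  h.apply_inverse hz _ _

lemma contDiffAt_inverse (h : IsMetricOn g U) (hz : z ∈ U) :
    ContDiffAt ℝ ∞ (fun z ↦ (g z).inverse) z :=
  (h.isInvertible hz).contDiffAt_map_inverse.comp z (h.smooth z hz)

/-- The Koszul formula for coordinate fields. -/
lemma chr_apply (h : IsMetricOn g U) (hz : z ∈ U) (v u w : E) :
    g z (chr g z v u) w =
      1 / 2 * (fderiv ℝ g z u v w + fderiv ℝ g z v u w - fderiv ℝ g z w v u) := by
  change g z ((g z).inverse _) w = _
  rw [h.apply_inverse hz]
  rfl

lemma fderiv_symm (h : IsMetricOn g U) (hz : z ∈ U) (u v w : E) :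
    fderiv ℝ g z u v w = fderiv ℝ g z u w v := by
  rw [← fderiv_apply_const₂ (h.differentiableAt hz), ← fderiv_apply_const₂ (h.differentiableAt hz),
    fderiv_congr_of_isOpen h.isOpen (fun z hz ↦ h.symm z hz v w) hz]

lemma chr_symm (h : IsMetricOn g U) (hz : z ∈ U) (u v : E) : chr g z u v = chr g z v u := by
  refine h.ext_of_apply hz fun w ↦ ?_
  rw [h.chr_apply hz, h.chr_apply hz, h.fderiv_symm hz w u v]
  ring

/-- The metric is parallel. -/
lemma fderiv_eq (h : IsMetricOn g U) (hz : z ∈ U) (u v w : E) :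
    fderiv ℝ g z u v w = g z (chr g z u v) w + g z v (chr g z u w) := by
  rw [h.symm z hz v, h.chr_apply hz, h.chr_apply hz, h.fderiv_symm hz u w v,
    h.fderiv_symm hz w u v, h.fderiv_symm hz v u w]
  ring

lemma contDiffAt_chr (h : IsMetricOn g U) (hz : z ∈ U) : ContDiffAt ℝ ∞ (chr g) z := by
  have hd := contDiffAt_fderiv (h.smooth z hz)
  have hi := h.contDiffAt_inverse hz
  unfold chr
  refine ContDiffAt.clm_comp ?_ (ContDiffAt.const_smul _ ((ContDiffAt.add ?_ hd).sub ?_))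
  · exact (ContinuousLinearMap.contDiff _).contDiffAt.comp z hi
  · exact (ContinuousLinearMap.flipₗᵢ ℝ E E (E →L[ℝ] ℝ)).contDiff.contDiffAt.comp z hd
  · exact contDiffAt_const.clm_comp
      ((ContinuousLinearMap.flipₗᵢ ℝ E E (E →L[ℝ] ℝ)).contDiff.contDiffAt.comp z hd)

lemma differentiableAt_chr (h : IsMetricOn g U) (hz : z ∈ U) : DifferentiableAt ℝ (chr g) z :=
  smooth_differentiableAt (h.contDiffAt_chr hz)

lemma differentiableAt_fderiv_chr (h : IsMetricOn g U) (hz : z ∈ U) :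
    DifferentiableAt ℝ (fderiv ℝ (chr g)) z :=
  smooth_differentiableAt (contDiffAt_fderiv (h.contDiffAt_chr hz))

lemma differentiableAt_fderiv (h : IsMetricOn g U) (hz : z ∈ U) :
    DifferentiableAt ℝ (fderiv ℝ g) z :=
  smooth_differentiableAt (contDiffAt_fderiv (h.smooth z hz))

lemma fderiv_chr_symm (h : IsMetricOn g U) (hz : z ∈ U) (t u v : E) :
    fderiv ℝ (chr g) z t u v = fderiv ℝ (chr g) z t v u := by
  rw [← fderiv_apply_const₂ (h.differentiableAt_chr hz),
    ← fderiv_apply_const₂ (h.differentiableAt_chr hz),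
    fderiv_congr_of_isOpen h.isOpen (fun z hz ↦ h.chr_symm hz u v) hz]

lemma contDiffAt_curv (h : IsMetricOn g U) (hz : z ∈ U) : ContDiffAt ℝ ∞ (curv g) z := by
  have hc := h.contDiffAt_chr hz
  have hd := contDiffAt_fderiv hc
  have hq : ContDiffAt ℝ ∞
      (fun z ↦ (ContinuousLinearMap.compL ℝ E E E).bilinearComp (chr g z) (chr g z)) z := by
    refine contDiffAt_of_apply h.isOpen (fun v z hz ↦ ?_) hz
    refine contDiffAt_of_apply h.isOpen (fun w z hz ↦ ?_) hz
    have hc := h.contDiffAt_chr hz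
    exact (hc.clm_apply contDiffAt_const).clm_comp (hc.clm_apply contDiffAt_const)
  unfold curv
  refine ((hd.sub ?_).add hq).sub ?_
  · exact (ContinuousLinearMap.flipₗᵢ ℝ E E (E →L[ℝ] E)).contDiff.contDiffAt.comp z hd
  · exact (ContinuousLinearMap.flipₗᵢ ℝ E E (E →L[ℝ] E)).contDiff.contDiffAt.comp z hq

lemma contDiffAt_ric (h : IsMetricOn g U) (hz : z ∈ U) : ContDiffAt ℝ ∞ (ric g) z :=
  (ricciContraction (E := E)).contDiff.contDiffAt.comp z (h.contDiffAt_curv hz)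

lemma contDiffAt_raise (h : IsMetricOn g U) (hz : z ∈ U) {T : E → E →L[ℝ] E →L[ℝ] ℝ}
    (hT : ContDiffAt ℝ ∞ T z) : ContDiffAt ℝ ∞ (raise g T) z :=
  (h.contDiffAt_inverse hz).clm_comp hT

lemma contDiffAt_scal (h : IsMetricOn g U) (hz : z ∈ U) : ContDiffAt ℝ ∞ (scal g) z :=
  (traceL (E := E)).contDiff.contDiffAt.comp z (h.contDiffAt_raise hz (h.contDiffAt_ric hz))

lemma contDiffAt_ein (h : IsMetricOn g U) (hz : z ∈ U) : ContDiffAt ℝ ∞ (ein g) z :=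
  ((h.contDiffAt_ric hz).const_smul _).sub ((h.contDiffAt_scal hz).smul (h.smooth z hz))

/-! ### Symmetries of the curvature -/

lemma curv_bianchi (h : IsMetricOn g U) (hz : z ∈ U) (u v w : E) :
    curv g z u v w + curv g z v w u + curv g z w u v = 0 := by
  simp only [curv_apply]
  rw [h.fderiv_chr_symm hz u w v, h.fderiv_chr_symm hz v w u, h.fderiv_chr_symm hz u v w,
    h.chr_symm hz w v, h.chr_symm hz u w, h.chr_symm hz v u, h.fderiv_chr_symm hz w v u]
  abel

lemma curv_skew (z u v w : E) : curv g z u v w = -curv g z v u w := by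
  simp only [curv_apply]
  abel

/-- The second derivative of the metric in terms of the Christoffel symbols. -/
lemma fderiv_fderiv_eq (h : IsMetricOn g U) (hz : z ∈ U) (t u v w : E) :
    fderiv ℝ (fderiv ℝ g) z t u v w =
      fderiv ℝ g z t (chr g z u v) w + g z (fderiv ℝ (chr g) z t u v) w
        + (fderiv ℝ g z t v (chr g z u w) + g z v (fderiv ℝ (chr g) z t u w)) := by
  have hg := h.differentiableAt hz
  have hc (a b : E) : DifferentiableAt ℝ (fun z ↦ chr g z a b) z :=
    ((h.differentiableAt_chr hz).clm_apply (differentiableAt_const a)).clm_apply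
      (differentiableAt_const b)
  have h1 := DFunLike.congr_fun
    (fderiv_congr_of_isOpen h.isOpen (fun z hz ↦ h.fderiv_eq hz u v w) hz) t
  rw [fderiv_fun_add ((hg.clm_apply (hc u v)).clm_apply (differentiableAt_const w))
    ((hg.clm_apply (differentiableAt_const v)).clm_apply (hc u w)), add_apply,
    fderiv_apply_field₂ hg (hc u v) (differentiableAt_const w),
    fderiv_apply_field₂ hg (differentiableAt_const v) (hc u w),
    fderiv_apply_const₂ (h.differentiableAt_chr hz),
    fderiv_apply_const₂ (h.differentiableAt_chr hz),
    fderiv_apply_const₂ ((h.differentiableAt_fderiv hz).clm_apply (differentiableAt_const u)),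
    fderiv_apply_const (h.differentiableAt_fderiv hz)] at h1
  rw [h1]
  simp only [fderiv_fun_const, Pi.zero_apply, zero_apply, map_zero, add_zero]

/-- The curvature operators are skew-symmetric, since the metric is parallel. -/
lemma curv_antisymm (h : IsMetricOn g U) (hz : z ∈ U) (t u v w : E) :
    g z (curv g z t u v) w = -g z v (curv g z t u w) := by
  have h1 := h.fderiv_fderiv_eq hz t u v w
  have h2 := h.fderiv_fderiv_eq hz u t v w
  rw [fderiv_fderiv_symm (h.smooth z hz)] at h1
  simp only [h.fderiv_eq hz] at h1 h2
  simp only [curv_apply, map_add, map_sub, add_apply,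
    sub_apply]
  linear_combination h2 - h1

/-- The pair symmetry of the curvature, from the first Bianchi identity for the four cyclic triples
and the two skew-symmetries. -/
lemma curv_pair_symm (h : IsMetricOn g U) (hz : z ∈ U) (a b c d : E) :
    g z (curv g z a b c) d = g z (curv g z c d a) b := by
  have hb (u v w t : E) : g z (curv g z u v w) t + g z (curv g z v w u) t
      + g z (curv g z w u v) t = 0 := by
    have := congrArg (fun x ↦ g z x t) (h.curv_bianchi hz u v w)
    simpa using this
  have hs (u v w t : E) : g z (curv g z u v w) t = -g z (curv g z v u w) t := by
    rw [curv_skew]; simp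
  have ha (u v w t : E) : g z (curv g z u v w) t = -g z (curv g z u v t) w := by
    rw [h.curv_antisymm hz, h.symm z hz]
  linarith [hb a b c d, hb b c d a, hb c d a b, hb d a b c, hs a b c d, hs b c d a, hs c d a b,
    hs d a b c, ha a b c d, ha b c a d, ha c a b d, ha b c d a, ha c d b a, ha d b c a,
    ha c d a b, ha d a c b, ha a c d b, ha d a b c, ha a b d c, ha b d a c, hs a c d b, hs c a d b,
    hs b d a c, hs b d c a, hs a c b d, hs c a b d, hs d b c a, hs d b a c]

end IsMetricOn

end Coord

namespace Coord

variable {E : Type*} [NormedAddCommGroup E] [NormedSpace ℝ E] [FiniteDimensional ℝ E]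
  {g : E → E →L[ℝ] E →L[ℝ] ℝ} {U : Set E} {z : E}

/-! ### Traces in a basis and its reciprocal basis -/

/-- The reciprocal basis of `Module.finBasis ℝ E` for the bilinear form `T`. -/
def recipBasis (T : E →L[ℝ] E →L[ℝ] ℝ) (i : Fin (Module.finrank ℝ E)) : E :=
  T.inverse (LinearMap.toContinuousLinearMap ((Module.finBasis ℝ E).coord i))

/-- The covariant derivative `(∇_u T)(v, w)` of a `2`-tensor in coordinates. -/
def covTensor (g T : E → E →L[ℝ] E →L[ℝ] ℝ) (z u v w : E) : ℝ :=
  fderiv ℝ T z u v w - T z (chr g z v u) w - T z v (chr g z w u)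

/-- The divergence `∇^i T_{ij}` of a `2`-tensor in coordinates, as a linear form. -/
def divT (g T : E → E →L[ℝ] E →L[ℝ] ℝ) (z w : E) : ℝ :=
  ∑ i, covTensor g T z (Module.finBasis ℝ E i) (recipBasis (g z) i) w

/-- The covariant derivative `(∇_u R)(v, w)a` of the curvature in coordinates. -/
def covCurv (g : E → E →L[ℝ] E →L[ℝ] ℝ) (z u v w a : E) : E :=
  fderiv ℝ (curv g) z u v w a + chr g z u (curv g z v w a) - curv g z (chr g z u v) w a
    - curv g z v (chr g z u w) a - curv g z v w (chr g z u a)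

lemma traceL_eq_sum_coord (A : E →L[ℝ] E) :
    traceL A = ∑ i, (Module.finBasis ℝ E).coord i (A (Module.finBasis ℝ E i)) := by
  rw [traceL_apply, LinearMap.trace_eq_matrix_trace ℝ (Module.finBasis ℝ E)]
  simp [Matrix.trace, LinearMap.toMatrix_apply]

lemma traceL_comp_comm (A B : E →L[ℝ] E) : traceL (A ∘L B) = traceL (B ∘L A) :=
  LinearMap.trace_mul_comm ℝ (A : E →ₗ[ℝ] E) (B : E →ₗ[ℝ] E)

namespace IsMetricOn

lemma recipBasis_apply (h : IsMetricOn g U) (hz : z ∈ U) (i : Fin (Module.finrank ℝ E)) (w : E) :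
    g z (recipBasis (g z) i) w = (Module.finBasis ℝ E).coord i w := by
  rw [recipBasis, h.apply_inverse hz]
  rfl

lemma traceL_eq (h : IsMetricOn g U) (hz : z ∈ U) (A : E →L[ℝ] E) :
    traceL A = ∑ i, g z (recipBasis (g z) i) (A (Module.finBasis ℝ E i)) := by
  simp only [h.recipBasis_apply hz]
  exact traceL_eq_sum_coord A

lemma sum_recipBasis_smul (h : IsMetricOn g U) (hz : z ∈ U) (v : E) :
    ∑ i, g z (recipBasis (g z) i) v • Module.finBasis ℝ E i = v := by
  simp only [h.recipBasis_apply hz]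
  exact (Module.finBasis ℝ E).sum_repr v

lemma sum_smul_recipBasis (h : IsMetricOn g U) (hz : z ∈ U) (v : E) :
    ∑ i, g z (Module.finBasis ℝ E i) v • recipBasis (g z) i = v := by
  refine h.ext_of_apply hz fun w ↦ ?_
  conv_rhs => rw [← h.sum_recipBasis_smul hz w]
  simp only [map_sum, map_smul, sum_apply, smul_apply, smul_eq_mul]
  refine Finset.sum_congr rfl fun i _ ↦ ?_
  rw [h.symm z hz v, mul_comm]

/-- The metric trace does not depend on the order of the basis and its reciprocal basis. -/
lemma sum_recipBasis_swap (h : IsMetricOn g U) (hz : z ∈ U) (T : E →L[ℝ] E →L[ℝ] ℝ) :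
    ∑ i, T (recipBasis (g z) i) (Module.finBasis ℝ E i) =
      ∑ i, T (Module.finBasis ℝ E i) (recipBasis (g z) i) := by
  have hB (i : Fin (Module.finrank ℝ E)) : T (recipBasis (g z) i) (Module.finBasis ℝ E i) =
      ∑ j, g z (recipBasis (g z) i) (recipBasis (g z) j) *
        T (Module.finBasis ℝ E j) (Module.finBasis ℝ E i) := by
    conv_lhs => rw [← h.sum_recipBasis_smul hz (recipBasis (g z) i)]
    simp only [map_sum, map_smul, sum_apply, smul_apply, smul_eq_mul]
    exact Finset.sum_congr rfl fun j _ ↦ by rw [h.symm z hz]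
  have hC (j : Fin (Module.finrank ℝ E)) : T (Module.finBasis ℝ E j) (recipBasis (g z) j) =
      ∑ i, g z (recipBasis (g z) i) (recipBasis (g z) j) *
        T (Module.finBasis ℝ E j) (Module.finBasis ℝ E i) := by
    conv_lhs => rw [← h.sum_recipBasis_smul hz (recipBasis (g z) j)]
    simp only [map_sum, map_smul, smul_eq_mul]
  simp only [hB, hC]
  exact Finset.sum_comm

/-- The Ricci tensor is symmetric, by the pair symmetry of the curvature. -/
lemma ric_symm (h : IsMetricOn g U) (hz : z ∈ U) (v w : E) : ric g z v w = ric g z w v := by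
  have key (v w : E) : ric g z v w =
      ∑ i, g z (curv g z (Module.finBasis ℝ E i) v w) (recipBasis (g z) i) := by
    rw [ric, ricciContraction_apply, h.traceL_eq hz]
    exact Finset.sum_congr rfl fun i _ ↦ h.symm z hz _ _
  rw [key, key]
  have hA : ∑ i, g z (curv g z (Module.finBasis ℝ E i) v w) (recipBasis (g z) i)
      = ∑ i, g z (curv g z (recipBasis (g z) i) w v) (Module.finBasis ℝ E i) := by
    refine Finset.sum_congr rfl fun i _ ↦ ?_
    rw [h.curv_pair_symm hz, curv_skew, map_neg, neg_apply, h.curv_antisymm hz, neg_neg,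
      h.symm z hz]
  rw [hA]
  exact h.sum_recipBasis_swap hz (g z ∘L ((curv g z).flip w).flip v)

/-- The covariant derivative of the curvature inherits the skew-symmetry in the first pair. -/
lemma covCurv_skew (h : IsMetricOn g U) (hz : z ∈ U) (u v w a : E) :
    covCurv g z u v w a = -covCurv g z u w v a := by
  have hR : DifferentiableAt ℝ (curv g) z := smooth_differentiableAt (h.contDiffAt_curv hz)
  have e3 (v w : E) : fderiv ℝ (fun z ↦ curv g z v w a) z u = fderiv ℝ (curv g) z u v w a := by
    rw [fderiv_apply_const₂ (hR.clm_apply (differentiableAt_const v)), fderiv_apply_const hR]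
  have h1 (v w : E) : fderiv ℝ (curv g) z u v w a = -fderiv ℝ (curv g) z u w v a := by
    rw [← e3 v w, ← e3 w v, funext fun z ↦ curv_skew z v w a, fderiv_fun_neg, neg_apply]
  rw [covCurv, covCurv, h1, curv_skew z v w, curv_skew z (chr g z u v) w,
    curv_skew z v (chr g z u w), curv_skew z v w]
  simp only [map_neg]
  abel

/-- The derivative of the coordinate formula for the curvature. -/
lemma fderiv_curv (h : IsMetricOn g U) (hz : z ∈ U) (u v w a : E) :
    fderiv ℝ (curv g) z u v w a =
      fderiv ℝ (fderiv ℝ (chr g)) z u v w a - fderiv ℝ (fderiv ℝ (chr g)) z u w v a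
      + (fderiv ℝ (chr g) z u v (chr g z w a) + chr g z v (fderiv ℝ (chr g) z u w a))
      - (fderiv ℝ (chr g) z u w (chr g z v a) + chr g z w (fderiv ℝ (chr g) z u v a)) := by
  have hR : DifferentiableAt ℝ (curv g) z := smooth_differentiableAt (h.contDiffAt_curv hz)
  have hc := h.differentiableAt_chr hz
  have hd := h.differentiableAt_fderiv_chr hz
  have hk (a : E) : DifferentiableAt ℝ (fun _ : E ↦ a) z := differentiableAt_const a
  have hca (a b : E) : DifferentiableAt ℝ (fun z ↦ chr g z a b) z :=
    (hc.clm_apply (hk a)).clm_apply (hk b)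
  have hda (t a b : E) : DifferentiableAt ℝ (fun z ↦ fderiv ℝ (chr g) z t a b) z :=
    ((hd.clm_apply (hk t)).clm_apply (hk a)).clm_apply (hk b)
  have hcc (a b c : E) : DifferentiableAt ℝ (fun z ↦ chr g z a (chr g z b c)) z :=
    (hc.clm_apply (hk a)).clm_apply (hca b c)
  have e1 (t a b : E) : fderiv ℝ (fun z ↦ fderiv ℝ (chr g) z t a b) z u
      = fderiv ℝ (fderiv ℝ (chr g)) z u t a b := by
    rw [fderiv_apply_const₂ (hd.clm_apply (hk t)), fderiv_apply_const hd]
  have e2 (a b c : E) : fderiv ℝ (fun z ↦ chr g z a (chr g z b c)) z u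
      = fderiv ℝ (chr g) z u a (chr g z b c) + chr g z a (fderiv ℝ (chr g) z u b c) := by
    rw [fderiv_apply_field₂ hc (hk a) (hca b c), fderiv_apply_const₂ hc]
    simp only [fderiv_fun_const, Pi.zero_apply, zero_apply, map_zero, add_zero]
  have e3 : fderiv ℝ (fun z ↦ curv g z v w a) z u = fderiv ℝ (curv g) z u v w a := by
    rw [fderiv_apply_const₂ (hR.clm_apply (hk v)), fderiv_apply_const hR]
  rw [← e3]
  simp only [curv_apply]
  rw [fderiv_fun_sub (((hda _ _ _).fun_sub (hda _ _ _)).fun_add (hcc _ _ _)) (hcc _ _ _),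
    fderiv_fun_add ((hda _ _ _).fun_sub (hda _ _ _)) (hcc _ _ _),
    fderiv_fun_sub (hda _ _ _) (hda _ _ _)]
  simp only [sub_apply, add_apply, e1, e2]

/-- The second Bianchi identity: the terms with second derivatives of the Christoffel symbols cancel
by their symmetry, the others by the symmetry of the Christoffel symbols. -/
lemma covCurv_bianchi (h : IsMetricOn g U) (hz : z ∈ U) (u v w a : E) :
    covCurv g z u v w a + covCurv g z v w u a + covCurv g z w u v a = 0 := by
  have hs := fderiv_fderiv_symm (h.contDiffAt_chr hz)
  simp only [covCurv]
  rw [h.chr_symm hz v u, h.chr_symm hz w u, h.chr_symm hz w v,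
    curv_skew z (chr g z u v) w, curv_skew z (chr g z v w) u, curv_skew z (chr g z u w) v]
  simp only [h.fderiv_curv hz, curv_apply z v w, curv_apply z w u, curv_apply z u v, map_add,
    map_sub]
  rw [hs v u, hs w u, hs w v]
  abel

/-- The covariant derivative of the curvature inherits the skew-symmetry in the second pair. -/
lemma covCurv_antisymm (h : IsMetricOn g U) (hz : z ∈ U) (t u v w a : E) :
    g z (covCurv g z t u v w) a = -g z w (covCurv g z t u v a) := by
  have hR : DifferentiableAt ℝ (curv g) z := smooth_differentiableAt (h.contDiffAt_curv hz)
  have hg := h.differentiableAt hz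
  have hk (a : E) : DifferentiableAt ℝ (fun _ : E ↦ a) z := differentiableAt_const a
  have hRa (a : E) : DifferentiableAt ℝ (fun z ↦ curv g z u v a) z :=
    ((hR.clm_apply (hk u)).clm_apply (hk v)).clm_apply (hk a)
  have e3 (a : E) : fderiv ℝ (fun z ↦ curv g z u v a) z t = fderiv ℝ (curv g) z t u v a := by
    rw [fderiv_apply_const₂ (hR.clm_apply (hk u)), fderiv_apply_const hR]
  have h1 := DFunLike.congr_fun (fderiv_congr_of_isOpen h.isOpen
    (fun z hz ↦ h.curv_antisymm hz u v w a) hz) t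
  rw [fderiv_apply_field₂ hg (hRa w) (hk a), fderiv_fun_neg, neg_apply,
    fderiv_apply_field₂ hg (hk w) (hRa a), e3, e3, h.fderiv_eq hz, h.fderiv_eq hz] at h1
  simp only [fderiv_fun_const, Pi.zero_apply, zero_apply, map_zero, add_zero] at h1
  have h2 := h.curv_antisymm hz u v (chr g z t w) a
  have h3 := h.curv_antisymm hz u v w (chr g z t a)
  have h4 := h.curv_antisymm hz (chr g z t u) v w a
  have h5 := h.curv_antisymm hz u (chr g z t v) w a
  simp only [covCurv, map_add, map_sub, add_apply, sub_apply]
  linear_combination h1 - h2 - h3 - h4 - h5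

/-- The covariant derivative commutes with the contraction defining the Ricci tensor. -/
lemma covTensor_ric (h : IsMetricOn g U) (hz : z ∈ U) (u v w : E) :
    covTensor g (ric g) z u v w =
      ∑ i, g z (recipBasis (g z) i) (covCurv g z u (Module.finBasis ℝ E i) v w) := by
  have hR : DifferentiableAt ℝ (curv g) z := smooth_differentiableAt (h.contDiffAt_curv hz)
  have hd : fderiv ℝ (ric g) z u v w = traceL (((fderiv ℝ (curv g) z u).flip v).flip w) := by
    have : fderiv ℝ (ric g) z = ricciContraction ∘L fderiv ℝ (curv g) z :=
      ((ricciContraction (E := E)).hasFDerivAt.comp z hR.hasFDerivAt).fderiv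
    rw [this]
    rfl
  -- the Christoffel terms acting on the two contracted slots cancel
  have hc : traceL (chr g z u ∘L ((curv g z).flip v).flip w)
      = traceL (((curv g z).flip v).flip w ∘L chr g z u) := traceL_comp_comm _ _
  simp only [covTensor, hd, ric, ricciContraction_apply]
  rw [h.traceL_eq hz] at hc ⊢
  rw [h.traceL_eq hz] at hc
  rw [h.traceL_eq hz, h.traceL_eq hz]
  simp only [ContinuousLinearMap.comp_apply, ContinuousLinearMap.flip_apply] at hc ⊢
  simp only [covCurv, map_add, map_sub, Finset.sum_add_distrib, Finset.sum_sub_distrib, hc,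
    h.chr_symm hz v u, h.chr_symm hz w u]
  ring

lemma covTensor_ric_symm (h : IsMetricOn g U) (hz : z ∈ U) (u v w : E) :
    covTensor g (ric g) z u v w = covTensor g (ric g) z u w v := by
  have hr : DifferentiableAt ℝ (ric g) z := smooth_differentiableAt (h.contDiffAt_ric hz)
  have h1 : fderiv ℝ (ric g) z u v w = fderiv ℝ (ric g) z u w v := by
    rw [← fderiv_apply_const₂ hr, ← fderiv_apply_const₂ hr,
      fderiv_congr_of_isOpen h.isOpen (fun z hz ↦ h.ric_symm hz v w) hz]
  rw [covTensor, covTensor, h1, h.ric_symm hz (chr g z v u), h.ric_symm hz v]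
  ring

/-- The derivative of the scalar curvature is the contraction of the covariant derivative of the
Ricci tensor. -/
lemma fderiv_scal (h : IsMetricOn g U) (hz : z ∈ U) (u : E) :
    fderiv ℝ (scal g) z u =
      ∑ j, covTensor g (ric g) z u (Module.finBasis ℝ E j) (recipBasis (g z) j) := by
  have hr : DifferentiableAt ℝ (ric g) z := smooth_differentiableAt (h.contDiffAt_ric hz)
  have hQ : DifferentiableAt ℝ (raise g (ric g)) z :=
    smooth_differentiableAt (h.contDiffAt_raise hz (h.contDiffAt_ric hz))
  have hg := h.differentiableAt hz
  have hk (a : E) : DifferentiableAt ℝ (fun _ : E ↦ a) z := differentiableAt_const a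
  set Q := raise g (ric g) with hQdef
  have hd : fderiv ℝ (scal g) z u = traceL (fderiv ℝ Q z u) := by
    have : fderiv ℝ (scal g) z = traceL ∘L fderiv ℝ Q z :=
      ((traceL (E := E)).hasFDerivAt.comp z hQ.hasFDerivAt).fderiv
    rw [this]
    rfl
  -- raising an index commutes with the covariant derivative
  have h1 (v w : E) : covTensor g (ric g) z u v w =
      g z w (fderiv ℝ Q z u v + chr g z u (Q z v) - Q z (chr g z u v)) := by
    rw [h.symm z hz w]
    have h2 := DFunLike.congr_fun (fderiv_congr_of_isOpen h.isOpen
      (fun z hz ↦ (h.raise_apply hz (ric g) v w)) hz) u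
    rw [fderiv_apply_const₂ hr, fderiv_apply_field₂ hg (hQ.clm_apply (hk v)) (hk w),
      fderiv_apply_const hQ, h.fderiv_eq hz] at h2
    simp only [fderiv_fun_const, Pi.zero_apply, zero_apply, map_zero, add_zero] at h2
    rw [covTensor, h.chr_symm hz v u, h.chr_symm hz w u, ← h.raise_apply hz (ric g),
      ← h.raise_apply hz (ric g), ← h2]
    simp only [map_add, map_sub, add_apply, sub_apply, hQdef]
    ring
  -- the commutator of an endomorphism with a Christoffel symbol has no trace
  have hc : traceL (chr g z u ∘L Q z) = traceL (Q z ∘L chr g z u) := traceL_comp_comm _ _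
  rw [h.traceL_eq hz, h.traceL_eq hz] at hc
  rw [hd, h.traceL_eq hz]
  simp only [h1, map_add, map_sub, Finset.sum_add_distrib,
    Finset.sum_sub_distrib]
  simp only [ContinuousLinearMap.comp_apply] at hc
  rw [hc]
  ring

/-- The contracted second Bianchi identity `dS = 2 ∇·Ric`. -/
lemma fderiv_scal_eq_two_mul_divT (h : IsMetricOn g U) (hz : z ∈ U) (u : E) :
    fderiv ℝ (scal g) z u = 2 * divT g (ric g) z u := by
  set b := Module.finBasis ℝ E
  set r := recipBasis (g z)
  -- the second Bianchi identity in the first three slots, before the double contraction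
  have h1 (i j) : g z (r i) (covCurv g z u (b i) (b j) (r j)) =
      g z (r j) (covCurv g z (b i) (b j) u (r i))
        + g z (r i) (covCurv g z (b j) (b i) u (r j)) := by
    have h2 := congrArg (g z (r i)) (h.covCurv_bianchi hz u (b i) (b j) (r j))
    simp only [map_add, map_zero] at h2
    rw [h.covCurv_skew hz (b j) u (b i), map_neg] at h2
    have h3 := h.covCurv_antisymm hz (b i) (b j) u (r j) (r i)
    rw [h.symm z hz] at h3
    linarith
  rw [h.fderiv_scal hz, divT]
  simp only [h.covTensor_ric_symm hz _ (recipBasis (g z) _) u]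
  simp only [h.covTensor_ric hz]
  change ∑ j, ∑ i, g z (r i) (covCurv g z u (b i) (b j) (r j)) =
    2 * ∑ j, ∑ i, g z (r i) (covCurv g z (b j) (b i) u (r j))
  simp only [h1, Finset.sum_add_distrib]
  rw [Finset.sum_comm, two_mul]

/-- The Einstein tensor is divergence free. -/
lemma divT_ein (h : IsMetricOn g U) (hz : z ∈ U) (w : E) : divT g (ein g) z w = 0 := by
  have hr : DifferentiableAt ℝ (ric g) z := smooth_differentiableAt (h.contDiffAt_ric hz)
  have hs : DifferentiableAt ℝ (scal g) z := smooth_differentiableAt (h.contDiffAt_scal hz)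
  have hg := h.differentiableAt hz
  have h1 (u v : E) : covTensor g (ein g) z u v w =
      2 * covTensor g (ric g) z u v w - fderiv ℝ (scal g) z u * g z v w := by
    have h2 : fderiv ℝ (ein g) z u v w = 2 * fderiv ℝ (ric g) z u v w
        - (scal g z * fderiv ℝ g z u v w + fderiv ℝ (scal g) z u * g z v w) := by
      have : fderiv ℝ (ein g) z = (2 : ℝ) • fderiv ℝ (ric g) z
          - (scal g z • fderiv ℝ g z + (fderiv ℝ (scal g) z).smulRight (g z)) :=
        ((hr.hasFDerivAt.const_smul (2 : ℝ)).sub (hs.hasFDerivAt.smul hg.hasFDerivAt)).fderiv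
      rw [this]
      rfl
    have h3 (v w : E) : ein g z v w = 2 * ric g z v w - scal g z * g z v w := rfl
    simp only [covTensor, h2, h3, h.fderiv_eq hz, h.chr_symm hz _ u]
    ring
  have h4 := h.fderiv_scal_eq_two_mul_divT hz w
  simp only [divT, h1, Finset.sum_sub_distrib, ← Finset.mul_sum]
  rw [divT] at h4
  rw [← h4]
  conv_lhs => enter [1]; rw [← h.sum_recipBasis_smul hz w]
  rw [map_sum]
  simp [mul_comm]

lemma ein_symm (h : IsMetricOn g U) (hz : z ∈ U) (v w : E) : ein g z v w = ein g z w v := by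
  change 2 * ric g z v w - scal g z * g z v w = 2 * ric g z w v - scal g z * g z w v
  rw [h.ric_symm hz, h.symm z hz]

end IsMetricOn

end Coord

namespace Coord

variable {E : Type*} [NormedAddCommGroup E] [NormedSpace ℝ E] [FiniteDimensional ℝ E]
  {g : E → E →L[ℝ] E →L[ℝ] ℝ} {U : Set E} {z : E} {Y : E → E}

/-! ### Killing fields -/

/-- `Y` is a smooth Killing field on `U`. -/
structure IsKillingOn (g : E → E →L[ℝ] E →L[ℝ] ℝ) (Y : E → E) (U : Set E) : Prop where
  smooth : ∀ z ∈ U, ContDiffAt ℝ ∞ Y z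
  killing : ∀ z ∈ U, ∀ u v, g z (cov g Y z u) v + g z u (cov g Y z v) = 0

lemma cov_apply (V : E → E) (z u : E) : cov g V z u = fderiv ℝ V z u + chr g z (V z) u := rfl

namespace IsKillingOn

lemma mono {V : Set E} (hY : IsKillingOn g Y U) (hVU : V ⊆ U) : IsKillingOn g Y V :=
  ⟨fun z hz ↦ hY.smooth z (hVU hz), fun z hz ↦ hY.killing z (hVU hz)⟩

lemma differentiableAt (hY : IsKillingOn g Y U) (hz : z ∈ U) : DifferentiableAt ℝ Y z :=
  smooth_differentiableAt (hY.smooth z hz)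

/-- The Lie derivative of the metric along a Killing field vanishes. -/
lemma lie_metric (hY : IsKillingOn g Y U) (h : IsMetricOn g U) (hz : z ∈ U) (u v : E) :
    fderiv ℝ g z (Y z) u v = -g z (fderiv ℝ Y z u) v - g z u (fderiv ℝ Y z v) := by
  have h1 := hY.killing z hz u v
  simp only [cov_apply, map_add, add_apply] at h1
  rw [h.fderiv_eq hz]
  linarith

/-- The derivative of the vanishing Lie derivative of the metric. -/
lemma fderiv_lie_metric (hY : IsKillingOn g Y U) (h : IsMetricOn g U) (hz : z ∈ U) (w u v : E) :
    fderiv ℝ (fderiv ℝ g) z w (Y z) u v + fderiv ℝ g z (fderiv ℝ Y z w) u v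
      + (fderiv ℝ g z w (fderiv ℝ Y z u) v + g z (fderiv ℝ (fderiv ℝ Y) z w u) v)
      + (fderiv ℝ g z w u (fderiv ℝ Y z v) + g z u (fderiv ℝ (fderiv ℝ Y) z w v)) = 0 := by
  have hg := h.differentiableAt hz
  have hd := h.differentiableAt_fderiv hz
  have hYd := hY.differentiableAt hz
  have hYd' : DifferentiableAt ℝ (fderiv ℝ Y) z :=
    smooth_differentiableAt (contDiffAt_fderiv (hY.smooth z hz))
  have hk (a : E) : DifferentiableAt ℝ (fun _ : E ↦ a) z := differentiableAt_const a
  have hYa (a : E) : DifferentiableAt ℝ (fun z ↦ fderiv ℝ Y z a) z := hYd'.clm_apply (hk a)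
  have h1 := DFunLike.congr_fun (fderiv_congr_of_isOpen h.isOpen
    (fun z hz ↦ hY.lie_metric h hz u v) hz) w
  rw [fderiv_apply_field₂ (hd.clm_apply hYd) (hk u) (hk v), fderiv_apply_field hd hYd,
    fderiv_fun_sub ((hg.clm_apply (hYa u)).clm_apply (hk v)).fun_neg
      ((hg.clm_apply (hk u)).clm_apply (hYa v)), sub_apply, fderiv_fun_neg, neg_apply,
    fderiv_apply_field₂ hg (hYa u) (hk v), fderiv_apply_field₂ hg (hk u) (hYa v),
    fderiv_apply_const hYd', fderiv_apply_const hYd'] at h1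
  simp only [fderiv_fun_const, Pi.zero_apply, zero_apply, map_zero, add_zero, add_apply] at h1
  linarith

/-- The Lie derivative of the Christoffel symbols along a Killing field vanishes: the Koszul formula
is differentiated along `Y`. The symbols are not a tensor, hence the second derivative of `Y`. -/
lemma lie_chr (hY : IsKillingOn g Y U) (h : IsMetricOn g U) (hz : z ∈ U) (u v : E) :
    fderiv ℝ (fderiv ℝ Y) z u v = fderiv ℝ Y z (chr g z u v) - fderiv ℝ (chr g) z (Y z) u v
      - chr g z (fderiv ℝ Y z u) v - chr g z u (fderiv ℝ Y z v) := by
  refine h.ext_of_apply hz fun w ↦ ?_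
  have hg := h.differentiableAt hz
  have hd := h.differentiableAt_fderiv hz
  have hc := h.differentiableAt_chr hz
  have hk (a : E) : DifferentiableAt ℝ (fun _ : E ↦ a) z := differentiableAt_const a
  have hca : DifferentiableAt ℝ (fun z ↦ chr g z u v) z :=
    (hc.clm_apply (hk u)).clm_apply (hk v)
  have hda (t a b : E) : DifferentiableAt ℝ (fun z ↦ fderiv ℝ g z t a b) z :=
    ((hd.clm_apply (hk t)).clm_apply (hk a)).clm_apply (hk b)
  have e1 (t a b s : E) : fderiv ℝ (fun z ↦ fderiv ℝ g z t a b) z s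
      = fderiv ℝ (fderiv ℝ g) z s t a b := by
    rw [fderiv_apply_const₂ (hd.clm_apply (hk t)), fderiv_apply_const hd]
  have h1 := DFunLike.congr_fun (fderiv_congr_of_isOpen h.isOpen
    (fun z hz ↦ h.chr_apply hz u v w) hz) (Y z)
  rw [fderiv_apply_field₂ hg hca (hk w), fderiv_const_mul
      (((hda _ _ _).fun_add (hda _ _ _)).fun_sub (hda _ _ _)), smul_apply,
    fderiv_fun_sub ((hda _ _ _).fun_add (hda _ _ _)) (hda _ _ _),
    fderiv_fun_add (hda _ _ _) (hda _ _ _), fderiv_apply_const₂ hc] at h1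
  simp only [fderiv_fun_const, Pi.zero_apply, zero_apply, map_zero, add_zero, add_apply,
    sub_apply, e1, smul_eq_mul, hY.lie_metric h hz] at h1
  have s1 := fderiv_fderiv_symm (hY.smooth z hz)
  have s2 := fderiv_fderiv_symm (h.smooth z hz)
  have h2 := hY.fderiv_lie_metric h hz u v w
  have h3 := hY.fderiv_lie_metric h hz v u w
  have h4 := hY.fderiv_lie_metric h hz w u v
  have h5 := h.chr_apply hz (fderiv ℝ Y z u) v w
  have h6 := h.chr_apply hz u (fderiv ℝ Y z v) w
  have h7 := h.chr_apply hz u v (fderiv ℝ Y z w)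
  rw [s2 _ (Y z)] at h2 h3 h4
  rw [s1 v u] at h3
  rw [s1 w u, s1 w v] at h4
  have p1 := h.symm z hz v (fderiv ℝ (fderiv ℝ Y) z u w)
  simp only [map_sub, sub_apply]
  linarith

/-- The derivative of `lie_chr`. -/
lemma fderiv_lie_chr (hY : IsKillingOn g Y U) (h : IsMetricOn g U) (hz : z ∈ U) (w u v : E) :
    fderiv ℝ (fderiv ℝ (fderiv ℝ Y)) z w u v =
      fderiv ℝ (fderiv ℝ Y) z w (chr g z u v) + fderiv ℝ Y z (fderiv ℝ (chr g) z w u v)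
      - (fderiv ℝ (fderiv ℝ (chr g)) z w (Y z) u v + fderiv ℝ (chr g) z (fderiv ℝ Y z w) u v)
      - (fderiv ℝ (chr g) z w (fderiv ℝ Y z u) v + chr g z (fderiv ℝ (fderiv ℝ Y) z w u) v)
      - (fderiv ℝ (chr g) z w u (fderiv ℝ Y z v)
        + chr g z u (fderiv ℝ (fderiv ℝ Y) z w v)) := by
  have hc := h.differentiableAt_chr hz
  have hdc := h.differentiableAt_fderiv_chr hz
  have hYd := hY.differentiableAt hz
  have hY1 := contDiffAt_fderiv (hY.smooth z hz)
  have hYd' : DifferentiableAt ℝ (fderiv ℝ Y) z := smooth_differentiableAt hY1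
  have hYd'' : DifferentiableAt ℝ (fderiv ℝ (fderiv ℝ Y)) z :=
    smooth_differentiableAt (contDiffAt_fderiv hY1)
  have hk (a : E) : DifferentiableAt ℝ (fun _ : E ↦ a) z := differentiableAt_const a
  have hYa (a : E) : DifferentiableAt ℝ (fun z ↦ fderiv ℝ Y z a) z := hYd'.clm_apply (hk a)
  have hca (a b : E) : DifferentiableAt ℝ (fun z ↦ chr g z a b) z :=
    (hc.clm_apply (hk a)).clm_apply (hk b)
  have d1 : DifferentiableAt ℝ (fun z ↦ fderiv ℝ Y z (chr g z u v)) z := hYd'.clm_apply (hca u v)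
  have d2' : DifferentiableAt ℝ (fun z ↦ fderiv ℝ (chr g) z (Y z)) z := hdc.clm_apply hYd
  have d2 : DifferentiableAt ℝ (fun z ↦ fderiv ℝ (chr g) z (Y z) u v) z :=
    (d2'.clm_apply (hk u)).clm_apply (hk v)
  have d3 : DifferentiableAt ℝ (fun z ↦ chr g z (fderiv ℝ Y z u) v) z :=
    (hc.clm_apply (hYa u)).clm_apply (hk v)
  have d4 : DifferentiableAt ℝ (fun z ↦ chr g z u (fderiv ℝ Y z v)) z :=
    (hc.clm_apply (hk u)).clm_apply (hYa v)
  have h1 := DFunLike.congr_fun (fderiv_congr_of_isOpen h.isOpen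
    (fun z hz ↦ hY.lie_chr h hz u v) hz) w
  rw [fderiv_apply_const₂ hYd'', fderiv_fun_sub ((d1.fun_sub d2).fun_sub d3) d4,
    fderiv_fun_sub (d1.fun_sub d2) d3, fderiv_fun_sub d1 d2, sub_apply, sub_apply, sub_apply,
    fderiv_apply_field hYd' (hca u v), fderiv_apply_const₂ hc,
    fderiv_apply_field₂ d2' (hk u) (hk v), fderiv_apply_field hdc hYd,
    fderiv_apply_field₂ hc (hYa u) (hk v), fderiv_apply_field₂ hc (hk u) (hYa v),
    fderiv_apply_const hYd', fderiv_apply_const hYd'] at h1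
  simp only [fderiv_fun_const, Pi.zero_apply, zero_apply, map_zero, add_zero, add_apply] at h1
  exact h1

/-- The Lie derivative of the curvature along a Killing field vanishes. -/
lemma lie_curv (hY : IsKillingOn g Y U) (h : IsMetricOn g U) (hz : z ∈ U) (w u v : E) :
    fderiv ℝ (curv g) z (Y z) w u v + curv g z (fderiv ℝ Y z w) u v
      + curv g z w (fderiv ℝ Y z u) v + curv g z w u (fderiv ℝ Y z v)
      - fderiv ℝ Y z (curv g z w u v) = 0 := by
  have s1 := fderiv_fderiv_symm (hY.smooth z hz)
  have s2 := fderiv_fderiv_symm (contDiffAt_fderiv (hY.smooth z hz))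
  have s3 := fderiv_fderiv_symm (h.contDiffAt_chr hz)
  have h1 := hY.fderiv_lie_chr h hz w u v
  have h2 := hY.fderiv_lie_chr h hz u w v
  rw [s2, h2, s3 u (Y z), s3 w (Y z), s1 w u, hY.lie_chr h hz w, hY.lie_chr h hz w,
    hY.lie_chr h hz u (chr g z w v), hY.lie_chr h hz u v] at h1
  rw [h.fderiv_curv hz]
  simp only [curv_apply, map_add, map_sub] at h1 ⊢
  rw [← sub_eq_zero] at h1
  rw [← h1]
  abel

/-- The Lie derivative of the Ricci tensor along a Killing field vanishes. -/
lemma lie_ric (hY : IsKillingOn g Y U) (h : IsMetricOn g U) (hz : z ∈ U) (u v : E) :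
    fderiv ℝ (ric g) z (Y z) u v + ric g z (fderiv ℝ Y z u) v
      + ric g z u (fderiv ℝ Y z v) = 0 := by
  have hR : DifferentiableAt ℝ (curv g) z := smooth_differentiableAt (h.contDiffAt_curv hz)
  have hd : fderiv ℝ (ric g) z (Y z) u v
      = traceL (((fderiv ℝ (curv g) z (Y z)).flip u).flip v) := by
    have : fderiv ℝ (ric g) z = ricciContraction ∘L fderiv ℝ (curv g) z :=
      ((ricciContraction (E := E)).hasFDerivAt.comp z hR.hasFDerivAt).fderiv
    rw [this]
    rfl
  have hc := traceL_comp_comm (((curv g z).flip u).flip v) (fderiv ℝ Y z)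
  have h1 : ((fderiv ℝ (curv g) z (Y z)).flip u).flip v
      + (((curv g z).flip u).flip v) ∘L fderiv ℝ Y z
      + ((curv g z).flip (fderiv ℝ Y z u)).flip v + ((curv g z).flip u).flip (fderiv ℝ Y z v)
      - fderiv ℝ Y z ∘L (((curv g z).flip u).flip v) = 0 := by
    ext w
    exact hY.lie_curv h hz w u v
  have h2 := congrArg traceL h1
  simp only [map_add, map_sub, map_zero, hc] at h2
  simp only [hd, ric, ricciContraction_apply]
  linarith

/-- The scalar curvature is constant along a Killing field. -/
lemma lie_scal (hY : IsKillingOn g Y U) (h : IsMetricOn g U) (hz : z ∈ U) :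
    fderiv ℝ (scal g) z (Y z) = 0 := by
  have hr : DifferentiableAt ℝ (ric g) z := smooth_differentiableAt (h.contDiffAt_ric hz)
  have hQ : DifferentiableAt ℝ (raise g (ric g)) z :=
    smooth_differentiableAt (h.contDiffAt_raise hz (h.contDiffAt_ric hz))
  have hg := h.differentiableAt hz
  have hk (a : E) : DifferentiableAt ℝ (fun _ : E ↦ a) z := differentiableAt_const a
  set Q := raise g (ric g) with hQdef
  have hd : fderiv ℝ (scal g) z = traceL ∘L fderiv ℝ Q z :=
    ((traceL (E := E)).hasFDerivAt.comp z hQ.hasFDerivAt).fderiv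
  have h1 : fderiv ℝ Q z (Y z) = fderiv ℝ Y z ∘L Q z - Q z ∘L fderiv ℝ Y z := by
    ext v
    refine h.ext_of_apply hz fun w ↦ ?_
    have h2 := DFunLike.congr_fun (fderiv_congr_of_isOpen h.isOpen
      (fun z hz ↦ (h.raise_apply hz (ric g) v w)) hz) (Y z)
    rw [fderiv_apply_const₂ hr, fderiv_apply_field₂ hg (hQ.clm_apply (hk v)) (hk w),
      fderiv_apply_const hQ, hY.lie_metric h hz] at h2
    simp only [fderiv_fun_const, Pi.zero_apply, zero_apply, map_zero, add_zero] at h2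
    have h3 := hY.lie_ric h hz v w
    have h4 := h.raise_apply hz (ric g) (fderiv ℝ Y z v) w
    have h5 := h.raise_apply hz (ric g) v (fderiv ℝ Y z w)
    simp only [sub_apply, map_sub, ContinuousLinearMap.comp_apply]
    simp only [← hQdef] at h4 h5 h2
    linarith
  rw [hd, ContinuousLinearMap.comp_apply, h1, map_sub, traceL_comp_comm, sub_self]

/-- The Lie derivative of the Einstein tensor along a Killing field vanishes. -/
lemma lie_ein (hY : IsKillingOn g Y U) (h : IsMetricOn g U) (hz : z ∈ U) (u v : E) :
    fderiv ℝ (ein g) z (Y z) u v + ein g z (fderiv ℝ Y z u) v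
      + ein g z u (fderiv ℝ Y z v) = 0 := by
  have hr : DifferentiableAt ℝ (ric g) z := smooth_differentiableAt (h.contDiffAt_ric hz)
  have hs : DifferentiableAt ℝ (scal g) z := smooth_differentiableAt (h.contDiffAt_scal hz)
  have h2 : fderiv ℝ (ein g) z (Y z) u v = 2 * fderiv ℝ (ric g) z (Y z) u v
      - (scal g z * fderiv ℝ g z (Y z) u v + fderiv ℝ (scal g) z (Y z) * g z u v) := by
    have : fderiv ℝ (ein g) z = (2 : ℝ) • fderiv ℝ (ric g) z
        - (scal g z • fderiv ℝ g z + (fderiv ℝ (scal g) z).smulRight (g z)) :=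
      ((hr.hasFDerivAt.const_smul (2 : ℝ)).sub
        (hs.hasFDerivAt.smul (h.differentiableAt hz).hasFDerivAt)).fderiv
    rw [this]
    rfl
  have h3 (v w : E) : ein g z v w = 2 * ric g z v w - scal g z * g z v w := rfl
  rw [h2, h3, h3, hY.lie_scal h hz, hY.lie_metric h hz]
  linear_combination 2 * hY.lie_ric h hz u v

/-- The second covariant derivative of a Killing field, `∇²_{u,v} Y = R(u, Y)v`, which is the
covariant form of `lie_chr`. -/
lemma fderiv_cov (hY : IsKillingOn g Y U) (h : IsMetricOn g U) (hz : z ∈ U) (u v : E) :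
    fderiv ℝ (cov g Y) z u v + chr g z u (cov g Y z v) - cov g Y z (chr g z u v) =
      curv g z u (Y z) v := by
  have hc := h.differentiableAt_chr hz
  have hYd := hY.differentiableAt hz
  have hYd' : DifferentiableAt ℝ (fderiv ℝ Y) z :=
    smooth_differentiableAt (contDiffAt_fderiv (hY.smooth z hz))
  have h1 : fderiv ℝ (cov g Y) z u v = fderiv ℝ (fderiv ℝ Y) z u v
      + (fderiv ℝ (chr g) z u (Y z) v + chr g z (fderiv ℝ Y z u) v) := by
    have : fderiv ℝ (cov g Y) z u = fderiv ℝ (fderiv ℝ Y) z u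
        + (fderiv ℝ (chr g) z u (Y z) + chr g z (fderiv ℝ Y z u)) := by
      rw [← fderiv_apply_field hc hYd, ← add_apply, ← fderiv_add hYd' (hc.clm_apply hYd)]
      rfl
    rw [this]
    rfl
  rw [h1, hY.lie_chr h hz, curv_apply]
  simp only [cov_apply, map_add]
  abel

end IsKillingOn

end Coord

namespace Coord

variable {E : Type*} [NormedAddCommGroup E] [NormedSpace ℝ E] [FiniteDimensional ℝ E]
  {g : E → E →L[ℝ] E →L[ℝ] ℝ} {U : Set E} {z : E} {Y X₀ : E → E}

/-! ### The covariant derivative and divergences -/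

lemma fderiv_tensor {T : E → E →L[ℝ] E →L[ℝ] ℝ}
    (hT : DifferentiableAt ℝ T z) {V W : E → E} (hV : DifferentiableAt ℝ V z)
    (hW : DifferentiableAt ℝ W z) (u : E) :
    fderiv ℝ (fun z ↦ T z (V z) (W z)) z u =
      covTensor g T z u (V z) (W z) + T z (cov g V z u) (W z) + T z (V z) (cov g W z u) := by
  rw [fderiv_apply_field₂ hT hV hW]
  simp only [cov_apply, covTensor, map_add, add_apply]
  ring

lemma cov_smul {c : E → ℝ} {V : E → E} (hc : DifferentiableAt ℝ c z)
    (hV : DifferentiableAt ℝ V z) (u : E) :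
    cov g (fun z ↦ c z • V z) z u = fderiv ℝ c z u • V z + c z • cov g V z u := by
  rw [cov_apply, fderiv_fun_smul hc hV]
  simp only [add_apply, smul_apply, ContinuousLinearMap.smulRight_apply, map_smul, cov_apply,
    smul_add]
  abel

lemma cov_add {V W : E → E} (hV : DifferentiableAt ℝ V z)
    (hW : DifferentiableAt ℝ W z) (u : E) :
    cov g (fun z ↦ V z + W z) z u = cov g V z u + cov g W z u := by
  simp only [cov_apply, fderiv_fun_add hV hW, add_apply, map_add]
  abel

lemma traceL_cov_smul {c : E → ℝ} {V : E → E} (hc : DifferentiableAt ℝ c z)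
    (hV : DifferentiableAt ℝ V z) :
    traceL (cov g (fun z ↦ c z • V z) z) = fderiv ℝ c z (V z) + c z * traceL (cov g V z) := by
  have h1 : cov g (fun z ↦ c z • V z) z = (fderiv ℝ c z).smulRight (V z) + c z • cov g V z := by
    ext u
    exact cov_smul hc hV u
  rw [h1, map_add, map_smul, smul_eq_mul, traceL_apply]
  congr 1
  exact LinearMap.trace_smulRight _ _

lemma traceL_cov_add {V W : E → E} (hV : DifferentiableAt ℝ V z)
    (hW : DifferentiableAt ℝ W z) :
    traceL (cov g (fun z ↦ V z + W z) z) = traceL (cov g V z) + traceL (cov g W z) := by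
  rw [← map_add]
  congr 1
  ext u
  exact cov_add hV hW u

lemma covTensor_sub {S T : E → E →L[ℝ] E →L[ℝ] ℝ} (hS : DifferentiableAt ℝ S z)
    (hT : DifferentiableAt ℝ T z) (u v w : E) :
    covTensor g (fun z ↦ S z - T z) z u v w = covTensor g S z u v w - covTensor g T z u v w := by
  simp only [covTensor, fderiv_fun_sub hS hT, sub_apply]
  ring

lemma divT_sub {S T : E → E →L[ℝ] E →L[ℝ] ℝ} (hS : DifferentiableAt ℝ S z)
    (hT : DifferentiableAt ℝ T z) (w : E) :
    divT g (fun z ↦ S z - T z) z w = divT g S z w - divT g T z w := by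
  simp only [divT, covTensor_sub hS hT, Finset.sum_sub_distrib]

/-- The tensor `c V ⊗ V`, that is `c V^♭ ⊗ V^♭`. -/
def outer (g : E → E →L[ℝ] E →L[ℝ] ℝ) (c : E → ℝ) (V : E → E) (z : E) : E →L[ℝ] E →L[ℝ] ℝ :=
  c z • (g z (V z)).smulRight (g z (V z))

lemma outer_apply (c : E → ℝ) (V : E → E) (z v w : E) :
    outer g c V z v w = c z * (g z (V z) v * g z (V z) w) := rfl

namespace IsMetricOn

/-- The covariant derivative is compatible with the metric. -/
lemma fderiv_metric (h : IsMetricOn g U) (hz : z ∈ U) {V W : E → E} (hV : DifferentiableAt ℝ V z)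
    (hW : DifferentiableAt ℝ W z) (u : E) :
    fderiv ℝ (fun z ↦ g z (V z) (W z)) z u =
      g z (cov g V z u) (W z) + g z (V z) (cov g W z u) := by
  rw [fderiv_apply_field₂ (h.differentiableAt hz) hV hW, h.fderiv_eq hz]
  simp only [cov_apply, map_add, add_apply, h.chr_symm hz u]
  ring

lemma contDiffAt_outer (h : IsMetricOn g U) (hz : z ∈ U) {c : E → ℝ} {V : E → E}
    (hc : ContDiffAt ℝ ∞ c z) (hV : ContDiffAt ℝ ∞ V z) : ContDiffAt ℝ ∞ (outer g c V) z := by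
  have h1 := (h.smooth z hz).clm_apply hV
  exact hc.smul (h1.smulRight h1)

lemma covTensor_outer (h : IsMetricOn g U) (hz : z ∈ U) {c : E → ℝ} {V : E → E}
    (hc : ContDiffAt ℝ ∞ c z) (hV : ContDiffAt ℝ ∞ V z) (u v w : E) :
    covTensor g (outer g c V) z u v w =
      fderiv ℝ c z u * (g z (V z) v * g z (V z) w)
        + c z * (g z (cov g V z u) v * g z (V z) w + g z (V z) v * g z (cov g V z u) w) := by
  have hVd := smooth_differentiableAt hV
  have hcd := smooth_differentiableAt hc
  have hg := h.differentiableAt hz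
  have hk (a : E) : DifferentiableAt ℝ (fun _ : E ↦ a) z := differentiableAt_const a
  have hgv (a : E) : DifferentiableAt ℝ (fun z ↦ g z (V z) a) z :=
    (hg.clm_apply hVd).clm_apply (hk a)
  have h2 (a : E) := h.fderiv_metric hz hVd (hk a) u
  rw [covTensor, ← fderiv_apply_const₂ (smooth_differentiableAt (h.contDiffAt_outer hz hc hV))]
  simp only [outer_apply]
  rw [fderiv_fun_mul hcd ((hgv v).fun_mul (hgv w)), fderiv_fun_mul (hgv v) (hgv w)]
  simp only [add_apply, smul_apply, smul_eq_mul, h2, cov_apply, fderiv_fun_const, Pi.zero_apply,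
    zero_apply, zero_add]
  ring

lemma sum_mul_recipBasis (h : IsMetricOn g U) (hz : z ∈ U) (v w : E) :
    ∑ i, g z v (Module.finBasis ℝ E i) * g z w (recipBasis (g z) i) = g z w v := by
  conv_rhs => rw [← h.sum_smul_recipBasis hz v]
  simp only [map_sum, map_smul, smul_eq_mul, h.symm z hz v]

/-- Contraction of a linear form with a vector. -/
lemma sum_form_mul_recipBasis (h : IsMetricOn g U) (hz : z ∈ U) (α : E →L[ℝ] ℝ) (v : E) :
    ∑ i, α (Module.finBasis ℝ E i) * g z v (recipBasis (g z) i) = α v := by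
  conv_rhs => rw [← h.sum_recipBasis_smul hz v]
  simp only [map_sum, map_smul, smul_eq_mul, h.symm z hz v, mul_comm]

/-- `∇·(c V ⊗ V) = (∇·(c V)) V + c ∇_V V`. -/
lemma divT_outer (h : IsMetricOn g U) (hz : z ∈ U) {c : E → ℝ} {V : E → E}
    (hc : ContDiffAt ℝ ∞ c z) (hV : ContDiffAt ℝ ∞ V z) (w : E) :
    divT g (outer g c V) z w =
      traceL (cov g (fun z ↦ c z • V z) z) * g z (V z) w + c z * g z (cov g V z (V z)) w := by
  have h1 := h.sum_form_mul_recipBasis hz (fderiv ℝ c z) (V z)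
  have h2 := h.sum_form_mul_recipBasis hz ((g z).flip w ∘L cov g V z) (V z)
  have h3 := h.traceL_eq hz (cov g V z)
  simp only [ContinuousLinearMap.comp_apply, ContinuousLinearMap.flip_apply] at h2
  simp only [fun i ↦ h.symm z hz (recipBasis (g z) i)] at h3
  rw [traceL_cov_smul (smooth_differentiableAt hc) (smooth_differentiableAt hV), ← h1, ← h2, h3,
    divT]
  simp only [h.covTensor_outer hz hc hV, Finset.sum_add_distrib, Finset.mul_sum, add_mul, mul_add,
    Finset.sum_mul]
  rw [add_assoc]
  congr 1
  · exact Finset.sum_congr rfl fun i _ ↦ by ring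
  · congr 1
    · exact Finset.sum_congr rfl fun i _ ↦ by ring
    · exact Finset.sum_congr rfl fun i _ ↦ by ring

end IsMetricOn

/-! ### Unit Killing fields and the Maxwell equations -/

namespace IsKillingOn

lemma contDiffAt_cov (hY : IsKillingOn g Y U) (h : IsMetricOn g U) (hz : z ∈ U) :
    ContDiffAt ℝ ∞ (cov g Y) z :=
  (contDiffAt_fderiv (hY.smooth z hz)).add ((h.contDiffAt_chr hz).clm_apply (hY.smooth z hz))

/-- The contraction of a symmetric tensor with the covariant derivative of a Killing field
vanishes, since `∇Y` is skew-symmetric. -/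
lemma sum_symm_cov (hY : IsKillingOn g Y U) (h : IsMetricOn g U) (hz : z ∈ U)
    {T : E →L[ℝ] E →L[ℝ] ℝ} (hT : ∀ v w, T v w = T w v) :
    ∑ i, T (recipBasis (g z) i) (cov g Y z (Module.finBasis ℝ E i)) = 0 := by
  have h1 (i : Fin (Module.finrank ℝ E)) :
      T (recipBasis (g z) i) (cov g Y z (Module.finBasis ℝ E i)) =
      ∑ j, g z (cov g Y z (Module.finBasis ℝ E i)) (Module.finBasis ℝ E j)
        * T (recipBasis (g z) i) (recipBasis (g z) j) := by
    conv_lhs => rw [← h.sum_smul_recipBasis hz (cov g Y z (Module.finBasis ℝ E i))]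
    simp only [map_sum, map_smul, smul_eq_mul,
      h.symm z hz (cov g Y z (Module.finBasis ℝ E i))]
  have h2 : ∑ i, T (recipBasis (g z) i) (cov g Y z (Module.finBasis ℝ E i)) =
      -∑ i, T (recipBasis (g z) i) (cov g Y z (Module.finBasis ℝ E i)) := by
    simp only [h1, ← Finset.sum_neg_distrib]
    rw [Finset.sum_comm]
    refine Finset.sum_congr rfl fun i _ ↦ Finset.sum_congr rfl fun j _ ↦ ?_
    have h3 := hY.killing z hz (Module.finBasis ℝ E i) (Module.finBasis ℝ E j)
    rw [h.symm z hz] at h3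
    rw [hT, ← neg_mul, h.symm z hz]
    congr 1
    rw [h.symm z hz] at h3 ⊢
    linarith [h.symm z hz (Module.finBasis ℝ E i) (cov g Y z (Module.finBasis ℝ E j))]
  linarith

/-- Killing fields are divergence free. -/
lemma traceL_cov (hY : IsKillingOn g Y U) (h : IsMetricOn g U) (hz : z ∈ U) :
    traceL (cov g Y z) = 0 := by
  rw [h.traceL_eq hz]
  exact hY.sum_symm_cov h hz (h.symm z hz)

variable (hY : IsKillingOn g Y U) (h : IsMetricOn g U) (hu : ∀ z ∈ U, g z (Y z) (Y z) = -1)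
include hY h hu

lemma metric_cov_self (hz : z ∈ U) (u : E) : g z (cov g Y z u) (Y z) = 0 := by
  have h1 := DFunLike.congr_fun (fderiv_congr_of_isOpen h.isOpen hu hz) u
  rw [h.fderiv_metric hz (hY.differentiableAt hz) (hY.differentiableAt hz), h.symm z hz (Y z)] at h1
  simp only [fderiv_fun_const, Pi.zero_apply, zero_apply] at h1
  linarith

/-- The integral curves of a unit Killing field are geodesics. -/
lemma cov_self (hz : z ∈ U) : cov g Y z (Y z) = 0 := by
  refine h.nondegenerate z hz _ fun w ↦ ?_
  have h1 := hY.killing z hz (Y z) w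
  rw [h.symm z hz (Y z), hY.metric_cov_self h hu hz] at h1
  linarith

/-- `g(R(u, Y)v, Y) = -g(∇_v Y, ∇_u Y)` for a unit Killing field, obtained by differentiating
`g(∇_v Y, Y) = 0`. -/
lemma metric_curv_self (hz : z ∈ U) (u v : E) :
    g z (curv g z u (Y z) v) (Y z) = -g z (cov g Y z v) (cov g Y z u) := by
  have hc := smooth_differentiableAt (hY.contDiffAt_cov h hz)
  have h1 := DFunLike.congr_fun (fderiv_congr_of_isOpen h.isOpen
    (fun z hz ↦ hY.metric_cov_self h hu hz v) hz) u
  rw [h.fderiv_metric hz (hc.clm_apply (differentiableAt_const v)) (hY.differentiableAt hz),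
    cov_apply, fderiv_apply_const hc] at h1
  simp only [fderiv_fun_const, Pi.zero_apply, zero_apply] at h1
  rw [← hY.fderiv_cov h hz, map_sub, sub_apply, hY.metric_cov_self h hu hz,
    h.chr_symm hz u]
  linarith

omit hu in
lemma ric_eq_sum (hz : z ∈ U) (w : E) :
    ric g z (Y z) w =
      -∑ i, g z (curv g z (Module.finBasis ℝ E i) (Y z) (recipBasis (g z) i)) w := by
  rw [ric, ricciContraction_apply, h.traceL_eq hz, ← Finset.sum_neg_distrib]
  refine Finset.sum_congr rfl fun i _ ↦ ?_
  rw [h.curv_antisymm hz]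
  simp

/-- `Ric(Y, Y) = |∇Y|²` for a unit Killing field. -/
lemma ric_self (hz : z ∈ U) :
    ric g z (Y z) (Y z) = ∑ i, g z (cov g Y z (recipBasis (g z) i))
      (cov g Y z (Module.finBasis ℝ E i)) := by
  rw [hY.ric_eq_sum h hz, ← Finset.sum_neg_distrib]
  exact Finset.sum_congr rfl fun i _ ↦ by rw [hY.metric_curv_self h hu hz, neg_neg]

omit hu in
/-- `∇·F = -2 Ric(Y)` for the field `F = 2 g(∇Y, ·)` of a Killing field `Y`. -/
lemma divT_field (hz : z ∈ U) (w : E) :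
    divT g (fun z ↦ (2 : ℝ) • (g z ∘L cov g Y z)) z w = -2 * ric g z (Y z) w := by
  have hc := smooth_differentiableAt (hY.contDiffAt_cov h hz)
  have hg := h.differentiableAt hz
  have hk (a : E) : DifferentiableAt ℝ (fun _ : E ↦ a) z := differentiableAt_const a
  have hF : DifferentiableAt ℝ (fun z ↦ (2 : ℝ) • (g z ∘L cov g Y z)) z :=
    (hg.clm_comp hc).fun_const_smul 2
  have h1 (u v : E) : covTensor g (fun z ↦ (2 : ℝ) • (g z ∘L cov g Y z)) z u v w =
      2 * g z (curv g z u (Y z) v) w := by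
    rw [covTensor, ← fderiv_apply_const₂ hF]
    have h2 : fderiv ℝ (fun z ↦ ((2 : ℝ) • (g z ∘L cov g Y z)) v w) z u =
        2 * fderiv ℝ (fun z ↦ g z (cov g Y z v) w) z u := by
      have : (fun z ↦ ((2 : ℝ) • (g z ∘L cov g Y z)) v w)
        = fun z ↦ 2 * g z (cov g Y z v) w := rfl
      rw [this, fderiv_const_mul ((hg.clm_apply (hc.clm_apply (hk v))).clm_apply (hk w))]
      rfl
    rw [h2, h.fderiv_metric hz (hc.clm_apply (hk v)) (hk w), ← hY.fderiv_cov h hz,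
      cov_apply, fderiv_apply_const hc, cov_apply (fun _ ↦ w)]
    simp only [fderiv_fun_const, Pi.zero_apply, zero_apply, zero_add, map_add, map_sub, add_apply,
      sub_apply, smul_apply, ContinuousLinearMap.comp_apply, smul_eq_mul, h.chr_symm hz u]
    ring
  simp only [divT, h1, ← Finset.mul_sum]
  rw [hY.ric_eq_sum h hz]
  ring

end IsKillingOn

end Coord

namespace Coord

variable {E : Type*} [NormedAddCommGroup E] [NormedSpace ℝ E] [FiniteDimensional ℝ E]
  {g : E → E →L[ℝ] E →L[ℝ] ℝ} {U : Set E} {z : E} {Y X₀ : E → E}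

/-! ### The equations of a fluid in coordinates -/

/-- The energy density `μ = G(X₀, X₀)`. -/
def energy (g : E → E →L[ℝ] E →L[ℝ] ℝ) (X₀ : E → E) (z : E) : ℝ := ein g z (X₀ z) (X₀ z)

/-- The charge density `e = G(X₀, Y)`. -/
def charge (g : E → E →L[ℝ] E →L[ℝ] ℝ) (X₀ Y : E → E) (z : E) : ℝ := ein g z (X₀ z) (Y z)

/-- The ratio `e / μ`. -/
def ratio (g : E → E →L[ℝ] E →L[ℝ] ℝ) (X₀ Y : E → E) (z : E) : ℝ :=
  charge g X₀ Y z / energy g X₀ z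

/-- The field `X = X₀ + (e / μ) Y` of the fluid. -/
def fluid (g : E → E →L[ℝ] E →L[ℝ] ℝ) (X₀ Y : E → E) (z : E) : E :=
  X₀ z + ratio g X₀ Y z • Y z

/-- The coefficient `β = G(Y, Y) - e² / μ`. -/
def beta (g : E → E →L[ℝ] E →L[ℝ] ℝ) (X₀ Y : E → E) (z : E) : ℝ :=
  ein g z (Y z) (Y z) - charge g X₀ Y z ^ 2 / energy g X₀ z

/-- The pressure `P = G - μ X ⊗ X - β Y ⊗ Y`. -/
def press (g : E → E →L[ℝ] E →L[ℝ] ℝ) (X₀ Y : E → E) (z : E) : E →L[ℝ] E →L[ℝ] ℝ :=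
  ein g z - outer g (energy g X₀) (fluid g X₀ Y) z - outer g (beta g X₀ Y) Y z

/-- A unit field `X₀` orthogonal to a unit Killing field `Y` and invariant under its flow, with
nonvanishing energy density. -/
structure IsFluidOn (g : E → E →L[ℝ] E →L[ℝ] ℝ) (X₀ Y : E → E) (U : Set E) : Prop where
  metric : IsMetricOn g U
  killing : IsKillingOn g Y U
  unit_Y : ∀ z ∈ U, g z (Y z) (Y z) = -1
  smooth : ∀ z ∈ U, ContDiffAt ℝ ∞ X₀ z
  unit : ∀ z ∈ U, g z (X₀ z) (X₀ z) = -1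
  orth : ∀ z ∈ U, g z (X₀ z) (Y z) = 0
  ne_zero : ∀ z ∈ U, energy g X₀ z ≠ 0
  bracket : ∀ z ∈ U, fderiv ℝ X₀ z (Y z) = fderiv ℝ Y z (X₀ z)

namespace IsFluidOn

variable (hF : IsFluidOn g X₀ Y U) (hz : z ∈ U)
include hF hz

/-! #### Smoothness and invariance under the Killing field -/

lemma contDiffAt_energy : ContDiffAt ℝ ∞ (energy g X₀) z :=
  ((hF.metric.contDiffAt_ein hz).clm_apply (hF.smooth z hz)).clm_apply (hF.smooth z hz)

lemma contDiffAt_charge : ContDiffAt ℝ ∞ (charge g X₀ Y) z :=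
  ((hF.metric.contDiffAt_ein hz).clm_apply (hF.smooth z hz)).clm_apply (hF.killing.smooth z hz)

lemma contDiffAt_ratio : ContDiffAt ℝ ∞ (ratio g X₀ Y) z :=
  (hF.contDiffAt_charge hz).div (hF.contDiffAt_energy hz) (hF.ne_zero z hz)

lemma contDiffAt_fluid : ContDiffAt ℝ ∞ (fluid g X₀ Y) z :=
  (hF.smooth z hz).add ((hF.contDiffAt_ratio hz).smul (hF.killing.smooth z hz))

lemma contDiffAt_beta : ContDiffAt ℝ ∞ (beta g X₀ Y) z :=
  (((hF.metric.contDiffAt_ein hz).clm_apply (hF.killing.smooth z hz)).clm_apply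
    (hF.killing.smooth z hz)).sub
      (((hF.contDiffAt_charge hz).pow 2).div (hF.contDiffAt_energy hz) (hF.ne_zero z hz))

lemma contDiffAt_press : ContDiffAt ℝ ∞ (press g X₀ Y) z :=
  ((hF.metric.contDiffAt_ein hz).sub (hF.metric.contDiffAt_outer hz (hF.contDiffAt_energy hz)
    (hF.contDiffAt_fluid hz))).sub
      (hF.metric.contDiffAt_outer hz (hF.contDiffAt_beta hz) (hF.killing.smooth z hz))

lemma press_symm (v w : E) : press g X₀ Y z v w = press g X₀ Y z w v := by
  simp only [press, sub_apply, outer_apply, hF.metric.ein_symm hz v w]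
  ring

lemma fderiv_energy : fderiv ℝ (energy g X₀) z (Y z) = 0 := by
  have hx := smooth_differentiableAt (hF.smooth z hz)
  have h1 := fderiv_apply_field₂ (smooth_differentiableAt (hF.metric.contDiffAt_ein hz)) hx hx (Y z)
  rw [hF.bracket z hz, hF.killing.lie_ein hF.metric hz] at h1
  exact h1

lemma fderiv_charge : fderiv ℝ (charge g X₀ Y) z (Y z) = 0 := by
  have hx := smooth_differentiableAt (hF.smooth z hz)
  have h1 := fderiv_apply_field₂ (smooth_differentiableAt (hF.metric.contDiffAt_ein hz)) hx
    (hF.killing.differentiableAt hz) (Y z)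
  rw [hF.bracket z hz, hF.killing.lie_ein hF.metric hz] at h1
  exact h1

lemma energy_mul_ratio : energy g X₀ z * ratio g X₀ Y z = charge g X₀ Y z :=
  mul_div_cancel₀ _ (hF.ne_zero z hz)

lemma fderiv_ratio : fderiv ℝ (ratio g X₀ Y) z (Y z) = 0 := by
  have h1 := DFunLike.congr_fun (fderiv_congr_of_isOpen hF.metric.isOpen
    (fun z hz ↦ hF.energy_mul_ratio hz) hz) (Y z)
  rw [fderiv_fun_mul (smooth_differentiableAt (hF.contDiffAt_energy hz))
    (smooth_differentiableAt (hF.contDiffAt_ratio hz))] at h1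
  simpa [hF.fderiv_energy hz, hF.fderiv_charge hz, hF.ne_zero z hz] using h1

lemma beta_eq : beta g X₀ Y z = ein g z (Y z) (Y z) - charge g X₀ Y z * ratio g X₀ Y z := by
  rw [beta, ratio]
  ring

lemma fderiv_beta : fderiv ℝ (beta g X₀ Y) z (Y z) = 0 := by
  have hy := hF.killing.differentiableAt hz
  have he := smooth_differentiableAt (hF.contDiffAt_charge hz)
  have hr := smooth_differentiableAt (hF.contDiffAt_ratio hz)
  have hG := smooth_differentiableAt (hF.metric.contDiffAt_ein hz)
  have h1 := fderiv_apply_field₂ hG hy hy (Y z)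
  rw [hF.killing.lie_ein hF.metric hz] at h1
  rw [fderiv_congr_of_isOpen hF.metric.isOpen (fun z hz ↦ hF.beta_eq hz) hz,
    fderiv_fun_sub ((hG.clm_apply hy).clm_apply hy) (he.fun_mul hr), sub_apply, h1,
    fderiv_fun_mul he hr]
  simp [hF.fderiv_ratio hz, hF.fderiv_charge hz]

/-- The divergence of `c Y` vanishes if `c` is invariant under the flow of `Y`. -/
lemma traceL_cov_smul_killing {c : E → ℝ} (hc : DifferentiableAt ℝ c z)
    (hc' : fderiv ℝ c z (Y z) = 0) : traceL (cov g (fun z ↦ c z • Y z) z) = 0 := by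
  rw [traceL_cov_smul hc (hF.killing.differentiableAt hz), hc', hF.killing.traceL_cov hF.metric hz]
  ring

/-! #### The equations -/

lemma metric_fluid_X₀ : g z (fluid g X₀ Y z) (X₀ z) = -1 := by
  simp [fluid, hF.unit z hz, hF.metric.symm z hz (Y z), hF.orth z hz]

lemma metric_fluid_Y : g z (fluid g X₀ Y z) (Y z) = -ratio g X₀ Y z := by
  simp [fluid, hF.unit_Y z hz, hF.orth z hz]

lemma cov_fluid (u : E) : cov g (fluid g X₀ Y) z u =
    cov g X₀ z u + (fderiv ℝ (ratio g X₀ Y) z u • Y z + ratio g X₀ Y z • cov g Y z u) := by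
  have hr := smooth_differentiableAt (hF.contDiffAt_ratio hz)
  have hy := hF.killing.differentiableAt hz
  rw [← cov_smul hr hy, ← cov_add (smooth_differentiableAt (hF.smooth z hz)) (hr.fun_smul hy)]
  rfl

lemma metric_cov_X₀ (u : E) : g z (cov g X₀ z u) (X₀ z) = 0 := by
  have hx := smooth_differentiableAt (hF.smooth z hz)
  have h1 := DFunLike.congr_fun (fderiv_congr_of_isOpen hF.metric.isOpen hF.unit hz) u
  rw [hF.metric.fderiv_metric hz hx hx, hF.metric.symm z hz (X₀ z)] at h1
  simp only [fderiv_fun_const, Pi.zero_apply, zero_apply] at h1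
  linarith

/-- The field `Y` is invariant under `X₀`, in covariant form. -/
lemma cov_bracket : cov g X₀ z (Y z) = cov g Y z (X₀ z) := by
  rw [cov_apply, cov_apply, hF.bracket z hz, hF.metric.chr_symm hz (X₀ z)]

lemma cov_self : cov g Y z (Y z) = 0 := hF.killing.cov_self hF.metric hF.unit_Y hz

/-- `∇_X X = ∇_{X₀} X₀ + 2 (e / μ) ∇_{X₀} Y + X(e / μ) Y`. -/
lemma cov_fluid_fluid : cov g (fluid g X₀ Y) z (fluid g X₀ Y z) =
    cov g X₀ z (X₀ z) + (2 * ratio g X₀ Y z) • cov g Y z (X₀ z)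
      + fderiv ℝ (ratio g X₀ Y) z (fluid g X₀ Y z) • Y z := by
  have h1 : cov g X₀ z (fluid g X₀ Y z) =
      cov g X₀ z (X₀ z) + ratio g X₀ Y z • cov g Y z (X₀ z) := by
    rw [fluid, map_add, map_smul, hF.cov_bracket hz]
  have h2 : cov g Y z (fluid g X₀ Y z) = cov g Y z (X₀ z) := by
    rw [fluid, map_add, map_smul, hF.cov_self hz, smul_zero, add_zero]
  rw [hF.cov_fluid hz, h1, h2]
  module

/-- The conservation law `∇·G = 0`, split along the decomposition of `G`. -/
lemma divT_press (w : E) : divT g (press g X₀ Y) z w =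
    -(traceL (cov g (fun z ↦ energy g X₀ z • fluid g X₀ Y z) z) * g z (fluid g X₀ Y z) w
      + energy g X₀ z * g z (cov g (fluid g X₀ Y) z (fluid g X₀ Y z)) w) := by
  have hG := smooth_differentiableAt (hF.metric.contDiffAt_ein hz)
  have h1 := hF.metric.contDiffAt_outer hz (hF.contDiffAt_energy hz) (hF.contDiffAt_fluid hz)
  have h2 := hF.metric.contDiffAt_outer hz (hF.contDiffAt_beta hz) (hF.killing.smooth z hz)
  have h3 := hF.traceL_cov_smul_killing hz (smooth_differentiableAt (hF.contDiffAt_beta hz))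
    (hF.fderiv_beta hz)
  change divT g (fun z ↦ (ein g z - outer g (energy g X₀) (fluid g X₀ Y) z)
    - outer g (beta g X₀ Y) Y z) z w = _
  rw [divT_sub (hG.fun_sub (smooth_differentiableAt h1)) (smooth_differentiableAt h2),
    divT_sub hG (smooth_differentiableAt h1), hF.metric.divT_ein hz,
    hF.metric.divT_outer hz (hF.contDiffAt_energy hz) (hF.contDiffAt_fluid hz),
    hF.metric.divT_outer hz (hF.contDiffAt_beta hz) (hF.killing.smooth z hz), h3, hF.cov_self hz]
  simp

/-- Energy conservation: the component of `∇·G = 0` along `X₀`, to which `∇_X X` does not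
contribute. -/
lemma div_energy_fluid : traceL (cov g (fun z ↦ energy g X₀ z • fluid g X₀ Y z) z) =
    divT g (press g X₀ Y) z (X₀ z) := by
  have h1 := hF.killing.metric_cov_self hF.metric hF.unit_Y hz
  have h2 : g z (cov g Y z (X₀ z)) (X₀ z) = 0 := by
    have := hF.killing.killing z hz (X₀ z) (X₀ z)
    rw [hF.metric.symm z hz (X₀ z)] at this
    linarith
  have h3 : g z (cov g (fluid g X₀ Y) z (fluid g X₀ Y z)) (X₀ z) = 0 := by
    rw [hF.cov_fluid_fluid hz]
    simp [hF.metric_cov_X₀ hz, h2, hF.metric.symm z hz (Y z), hF.orth z hz]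
  rw [hF.divT_press hz, h3, hF.metric_fluid_X₀ hz]
  ring

/-- The fields `μX` and `μX₀` differ by a multiple of `Y` that is divergence free. -/
lemma div_energy_X₀ : traceL (cov g (fun z ↦ energy g X₀ z • X₀ z) z) =
    divT g (press g X₀ Y) z (X₀ z) := by
  have hx := smooth_differentiableAt (hF.smooth z hz)
  have hy := hF.killing.differentiableAt hz
  have hμ := smooth_differentiableAt (hF.contDiffAt_energy hz)
  have hr := smooth_differentiableAt (hF.contDiffAt_ratio hz)
  have h1 : (fun z ↦ energy g X₀ z • fluid g X₀ Y z) =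
      fun z ↦ energy g X₀ z • X₀ z + (energy g X₀ z * ratio g X₀ Y z) • Y z := by
    ext z
    rw [fluid, smul_add, mul_smul]
  rw [← hF.div_energy_fluid hz, h1, traceL_cov_add (hμ.fun_smul hx) ((hμ.fun_mul hr).fun_smul hy),
    hF.traceL_cov_smul_killing hz (hμ.fun_mul hr), add_zero]
  rw [fderiv_fun_mul hμ hr]
  simp [hF.fderiv_energy hz, hF.fderiv_ratio hz]

/-- The component along `Y` of the equation of motion, in terms of `e / μ`. -/
lemma energy_mul_fderiv_ratio :
    energy g X₀ z * fderiv ℝ (ratio g X₀ Y) z (fluid g X₀ Y z) =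
      divT g (press g X₀ Y) z (Y z) - ratio g X₀ Y z * divT g (press g X₀ Y) z (X₀ z) := by
  have hx := smooth_differentiableAt (hF.smooth z hz)
  have hy := hF.killing.differentiableAt hz
  have h1 : g z (cov g X₀ z (X₀ z)) (Y z) = 0 := by
    have h2 := DFunLike.congr_fun (fderiv_congr_of_isOpen hF.metric.isOpen hF.orth hz) (X₀ z)
    have h3 := hF.killing.killing z hz (X₀ z) (X₀ z)
    rw [hF.metric.fderiv_metric hz hx hy] at h2
    simp only [fderiv_fun_const, Pi.zero_apply, zero_apply] at h2
    rw [hF.metric.symm z hz (X₀ z)] at h2 h3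
    linarith
  have h2 : g z (cov g (fluid g X₀ Y) z (fluid g X₀ Y z)) (Y z)
      = -fderiv ℝ (ratio g X₀ Y) z (fluid g X₀ Y z) := by
    rw [hF.cov_fluid_fluid hz]
    simp [h1, hF.killing.metric_cov_self hF.metric hF.unit_Y hz, hF.unit_Y z hz]
  have h3 := hF.divT_press hz (Y z)
  rw [h2, hF.metric_fluid_Y hz, hF.div_energy_fluid hz] at h3
  linarith

/-- The variation of `e / μ` along the fluid. -/
lemma energy_sq_mul_fderiv_ratio :
    energy g X₀ z ^ 2 * fderiv ℝ (ratio g X₀ Y) z (fluid g X₀ Y z) =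
      energy g X₀ z * divT g (press g X₀ Y) z (Y z)
        - charge g X₀ Y z * divT g (press g X₀ Y) z (X₀ z) := by
  rw [← hF.energy_mul_ratio hz]
  linear_combination energy g X₀ z * hF.energy_mul_fderiv_ratio hz

/-- Charge conservation, from the conservation of energy and the variation of `e / μ` along the
fluid. -/
lemma div_charge_fluid : traceL (cov g (fun z ↦ charge g X₀ Y z • fluid g X₀ Y z) z) =
    divT g (press g X₀ Y) z (Y z) := by
  have hx := smooth_differentiableAt (hF.contDiffAt_fluid hz)
  have he := smooth_differentiableAt (hF.contDiffAt_charge hz)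
  have hμ := smooth_differentiableAt (hF.contDiffAt_energy hz)
  have hr := smooth_differentiableAt (hF.contDiffAt_ratio hz)
  have h1 : fderiv ℝ (charge g X₀ Y) z
      = fderiv ℝ (fun z ↦ energy g X₀ z * ratio g X₀ Y z) z :=
    fderiv_congr_of_isOpen hF.metric.isOpen (fun z hz ↦ (hF.energy_mul_ratio hz).symm) hz
  have h2 := hF.div_energy_fluid hz
  rw [traceL_cov_smul hμ hx] at h2
  rw [traceL_cov_smul he hx, h1, fderiv_fun_mul hμ hr, ← hF.energy_mul_ratio hz]
  simp only [add_apply, smul_apply, smul_eq_mul]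
  linear_combination hF.energy_mul_fderiv_ratio hz + ratio g X₀ Y z * h2

/-- The fields `eX` and `eX₀` differ by a multiple of `Y` that is divergence free. -/
lemma div_charge_X₀ : traceL (cov g (fun z ↦ charge g X₀ Y z • X₀ z) z) =
    divT g (press g X₀ Y) z (Y z) := by
  have hx := smooth_differentiableAt (hF.smooth z hz)
  have hy := hF.killing.differentiableAt hz
  have he := smooth_differentiableAt (hF.contDiffAt_charge hz)
  have hr := smooth_differentiableAt (hF.contDiffAt_ratio hz)
  have h1 : (fun z ↦ charge g X₀ Y z • fluid g X₀ Y z) =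
      fun z ↦ charge g X₀ Y z • X₀ z + (charge g X₀ Y z * ratio g X₀ Y z) • Y z := by
    ext z
    rw [fluid, smul_add, mul_smul]
  rw [← hF.div_charge_fluid hz, h1, traceL_cov_add (he.fun_smul hx) ((he.fun_mul hr).fun_smul hy),
    hF.traceL_cov_smul_killing hz (he.fun_mul hr), add_zero]
  rw [fderiv_fun_mul he hr]
  simp [hF.fderiv_charge hz, hF.fderiv_ratio hz]

/-- The divergence of the vector field `ᵉP(Y)`. The derivative of `Y` contributes the contraction of
the symmetric `P` with the skew-symmetric `∇Y`, which vanishes. -/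
lemma div_press_killing :
    traceL (cov g (fun z ↦ (g z).inverse (press g X₀ Y z (Y z))) z) =
      divT g (press g X₀ Y) z (Y z) := by
  have hy := hF.killing.differentiableAt hz
  have hP := smooth_differentiableAt (hF.contDiffAt_press hz)
  have hV : DifferentiableAt ℝ (fun z ↦ (g z).inverse (press g X₀ Y z (Y z))) z :=
    smooth_differentiableAt ((hF.metric.contDiffAt_inverse hz).clm_apply
      ((hF.contDiffAt_press hz).clm_apply (hF.killing.smooth z hz)))
  have h1 (u w : E) : g z (cov g (fun z ↦ (g z).inverse (press g X₀ Y z (Y z))) z u) w =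
      covTensor g (press g X₀ Y) z u w (Y z) + press g X₀ Y z w (cov g Y z u) := by
    have h2 := DFunLike.congr_fun (fderiv_congr_of_isOpen hF.metric.isOpen (fun z hz ↦
      (hF.metric.apply_inverse hz (press g X₀ Y z (Y z)) w).trans
        (hF.press_symm hz (Y z) w)) hz) u
    rw [hF.metric.fderiv_metric hz hV (differentiableAt_const w),
      fderiv_tensor hP (differentiableAt_const w) hy, hF.metric.apply_inverse hz,
      hF.press_symm hz (Y z)] at h2
    linarith
  rw [hF.metric.traceL_eq hz]
  simp only [hF.metric.symm z hz (recipBasis (g z) _), h1, Finset.sum_add_distrib]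
  rw [hF.killing.sum_symm_cov hF.metric hz (hF.press_symm hz), add_zero, divT]

/-- The motion of the fluid, paired with a vector. -/
lemma motion_fluid (w : E) :
    energy g X₀ z * g z (cov g (fluid g X₀ Y) z (fluid g X₀ Y z)) w =
      -divT g (press g X₀ Y) z w
        - divT g (press g X₀ Y) z (X₀ z) * g z (fluid g X₀ Y z) w := by
  have h1 := hF.divT_press hz w
  rw [hF.div_energy_fluid hz] at h1
  linarith

/-- The motion of the apparent fluid, paired with a vector. The derivative of `e / μ` in `∇_X X` is
eliminated by `energy_mul_fderiv_ratio`; the remaining term in `∇_{X₀} Y` is the Lorentz force. -/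
lemma motion_X₀ (w : E) :
    energy g X₀ z * g z (cov g X₀ z (X₀ z)) w =
      charge g X₀ Y z * (-2 * g z (cov g Y z (X₀ z)) w)
        - (divT g (press g X₀ Y) z w + divT g (press g X₀ Y) z (X₀ z) * g z (X₀ z) w
          + divT g (press g X₀ Y) z (Y z) * g z (Y z) w) := by
  have h1 := hF.motion_fluid hz w
  have h2 := hF.energy_mul_fderiv_ratio hz
  have h3 : g z (fluid g X₀ Y z) w = g z (X₀ z) w + ratio g X₀ Y z * g z (Y z) w := by
    simp [fluid]
  rw [hF.cov_fluid_fluid hz, h3] at h1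
  simp only [map_add, map_smul, add_apply, smul_apply, smul_eq_mul] at h1
  rw [← hF.energy_mul_ratio hz]
  linear_combination h1 - g z (Y z) w * h2

/-- The inhomogeneous Maxwell equation, paired with a vector: `2 Ric(Y)` is read off from `G(Y)`, and
the scalar curvature is eliminated through `G(Y, Y)` and `Ric(Y, Y) = |∇Y|²`. -/
lemma maxwell (w : E) :
    divT g (fun z ↦ (2 : ℝ) • (g z ∘L cov g Y z)) z w =
      charge g X₀ Y z * g z (X₀ z) w
        + 2 * (∑ i, g z (cov g Y z (recipBasis (g z) i)) (cov g Y z (Module.finBasis ℝ E i)))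
          * g z (Y z) w
        - press g X₀ Y z (Y z) w := by
  have h1 : ein g z (Y z) w = 2 * ric g z (Y z) w - scal g z * g z (Y z) w := rfl
  have h2 : ein g z (Y z) (Y z) = 2 * ric g z (Y z) (Y z) - scal g z * g z (Y z) (Y z) := rfl
  have h3 : g z (fluid g X₀ Y z) w = g z (X₀ z) w + ratio g X₀ Y z * g z (Y z) w := by
    simp [fluid]
  rw [hF.killing.divT_field hF.metric hz, ← hF.killing.ric_self hF.metric hF.unit_Y hz]
  simp only [press, sub_apply, outer_apply]
  rw [hF.metric_fluid_Y hz, h3, hF.beta_eq hz, h1, h2, hF.unit_Y z hz]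
  rw [← hF.energy_mul_ratio hz]
  ring

/-- The pressure vanishes on the time-plane. -/
lemma press_timePlane {v w : E} (hv : v ∈ Submodule.span ℝ {X₀ z, Y z})
    (hw : w ∈ Submodule.span ℝ {X₀ z, Y z}) : press g X₀ Y z v w = 0 := by
  have h1 : press g X₀ Y z (X₀ z) (X₀ z) = 0 := by
    simp only [press, sub_apply, outer_apply, hF.metric_fluid_X₀ hz, hF.metric.symm z hz (Y z),
      hF.orth z hz]
    rw [← energy]
    ring
  have h2 : press g X₀ Y z (X₀ z) (Y z) = 0 := by
    simp only [press, sub_apply, outer_apply, hF.metric_fluid_X₀ hz, hF.metric.symm z hz (Y z),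
      hF.orth z hz, hF.metric_fluid_Y hz]
    rw [← charge, ← hF.energy_mul_ratio hz]
    ring
  have h3 : press g X₀ Y z (Y z) (Y z) = 0 := by
    simp only [press, sub_apply, outer_apply, hF.metric_fluid_Y hz, hF.unit_Y z hz, hF.beta_eq hz,
      ← hF.energy_mul_ratio hz]
    ring
  obtain ⟨a, b, rfl⟩ := Submodule.mem_span_pair.1 hv
  obtain ⟨c, d, rfl⟩ := Submodule.mem_span_pair.1 hw
  simp [h1, h2, h3, hF.press_symm hz (Y z) (X₀ z)]

end IsFluidOn

end Coord

namespace Coord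

variable {E : Type*} [NormedAddCommGroup E] [NormedSpace ℝ E] [FiniteDimensional ℝ E]
  {g g' : E → E →L[ℝ] E →L[ℝ] ℝ} {U U' : Set E} {z : E} {Y X₀ : E → E}

/-! ### Naturality of the covariant derivative -/

section Naturality

variable {ψ : E → E} (h : IsMetricOn g U) (h' : IsMetricOn g' U') (hz : z ∈ U')
  (hψz : ψ z ∈ U) (hψ : ContDiffAt ℝ ∞ ψ z) (hψi : Function.Surjective (fderiv ℝ ψ z))
  (hg : ∀ᶠ y in 𝓝 z, ∀ u v, g' y u v = g (ψ y) (fderiv ℝ ψ y u) (fderiv ℝ ψ y v))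
include h h' hz hψz hψ hψi hg

/-- The transformation law of the Christoffel symbols under a change of coordinates. -/
lemma chr_naturality (v u : E) :
    fderiv ℝ ψ z (chr g' z v u) =
      fderiv ℝ (fderiv ℝ ψ) z u v + chr g (ψ z) (fderiv ℝ ψ z v) (fderiv ℝ ψ z u) := by
  have hψd := smooth_differentiableAt hψ
  have hψd' := smooth_differentiableAt (contDiffAt_fderiv hψ)
  have hgd := h.differentiableAt hψz
  have hgψ : DifferentiableAt ℝ (fun y ↦ g (ψ y)) z := hgd.comp z hψd
  have hk (a : E) : DifferentiableAt ℝ (fun y ↦ fderiv ℝ ψ y a) z :=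
    hψd'.clm_apply (differentiableAt_const a)
  -- the derivative of the pulled-back metric
  have e1 (u v w : E) : fderiv ℝ g' z u v w =
      fderiv ℝ g (ψ z) (fderiv ℝ ψ z u) (fderiv ℝ ψ z v) (fderiv ℝ ψ z w)
        + g (ψ z) (fderiv ℝ (fderiv ℝ ψ) z u v) (fderiv ℝ ψ z w)
        + g (ψ z) (fderiv ℝ ψ z v) (fderiv ℝ (fderiv ℝ ψ) z u w) := by
    have h1 : (fun y ↦ g' y v w) =ᶠ[𝓝 z]
        fun y ↦ g (ψ y) (fderiv ℝ ψ y v) (fderiv ℝ ψ y w) := hg.mono fun y hy ↦ hy v w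
    have h2 : fderiv ℝ (fun y ↦ g (ψ y)) z = fderiv ℝ g (ψ z) ∘L fderiv ℝ ψ z :=
      fderiv_comp z hgd hψd
    rw [← fderiv_apply_const₂ (h'.differentiableAt hz), h1.fderiv_eq,
      fderiv_apply_field₂ hgψ (hk v) (hk w), h2, fderiv_apply_const hψd',
      fderiv_apply_const hψd']
    rfl
  have s1 := fderiv_fderiv_symm hψ
  refine h.ext_of_apply hψz fun w' ↦ ?_
  obtain ⟨w, rfl⟩ := hψi w'
  rw [← hg.self_of_nhds, h'.chr_apply hz, e1, e1, e1, map_add, add_apply, h.chr_apply hψz,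
    s1 v u, s1 w u, s1 w v,
    h.symm _ hψz (fderiv ℝ ψ z v) (fderiv ℝ (fderiv ℝ ψ) z u w),
    h.symm _ hψz (fderiv ℝ ψ z u) (fderiv ℝ (fderiv ℝ ψ) z v w)]
  ring

/-- The covariant derivative is invariant under changes of coordinates. -/
lemma cov_naturality {V V' : E → E} (hV : DifferentiableAt ℝ V (ψ z))
    (hV' : DifferentiableAt ℝ V' z) (hVV' : ∀ᶠ y in 𝓝 z, fderiv ℝ ψ y (V' y) = V (ψ y)) (u : E) :
    fderiv ℝ ψ z (cov g' V' z u) = cov g V (ψ z) (fderiv ℝ ψ z u) := by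
  have hψd := smooth_differentiableAt hψ
  have hψd' := smooth_differentiableAt (contDiffAt_fderiv hψ)
  have h1 : fderiv ℝ (fun y ↦ fderiv ℝ ψ y (V' y)) z u = fderiv ℝ (fun y ↦ V (ψ y)) z u := by
    rw [Filter.EventuallyEq.fderiv_eq hVV']
  have h2 : fderiv ℝ (fun y ↦ V (ψ y)) z = fderiv ℝ V (ψ z) ∘L fderiv ℝ ψ z :=
    fderiv_comp z hV hψd
  rw [fderiv_apply_field hψd' hV', h2, ContinuousLinearMap.comp_apply] at h1
  rw [cov_apply, cov_apply, map_add, chr_naturality h h' hz hψz hψ hψi hg, ← h1,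
    hVV'.self_of_nhds]
  abel

end Naturality

/-! ### Invariance of the apparent field under the Killing field -/

section Bracket

variable {F : Type*} [NormedAddCommGroup F] [NormedSpace ℝ F] [FiniteDimensional ℝ F]
  {p : E → F} {s : F →L[ℝ] E}

/-- A vertical vector of a submersion extends to a differentiable vertical field. -/
lemma exists_vertical_extension (hp : ContDiffAt ℝ ∞ p z) (hs : ∀ q, fderiv ℝ p z (s q) = q)
    {v : E} (hv : fderiv ℝ p z v = 0) :
    ∃ V : E → E, V z = v ∧ DifferentiableAt ℝ V z ∧ ∀ᶠ y in 𝓝 z, fderiv ℝ p y (V y) = 0 := by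
  have hp' := contDiffAt_fderiv hp
  have h1 : fderiv ℝ p z ∘L s = ContinuousLinearMap.id ℝ F := by
    ext q
    exact hs q
  have hc : ContDiffAt ℝ ∞ (fun y ↦ fderiv ℝ p y ∘L s) z := hp'.clm_comp contDiffAt_const
  have hinv : (fderiv ℝ p z ∘L s).IsInvertible := by
    rw [h1]
    exact ⟨ContinuousLinearEquiv.refl ℝ F, rfl⟩
  have hev : ∀ᶠ y in 𝓝 z, (fderiv ℝ p y ∘L s).IsInvertible := by
    have h2 : {A : F →L[ℝ] F | A.IsInvertible} ∈ 𝓝 (fderiv ℝ p z ∘L s) := by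
      rw [h1]
      exact ContinuousLinearEquiv.nhds (ContinuousLinearEquiv.refl ℝ F)
    exact hc.continuousAt h2
  have hci : ContDiffAt ℝ ∞ (fun y ↦ (fderiv ℝ p y ∘L s).inverse) z :=
    ContDiffAt.comp (g := ContinuousLinearMap.inverse) z hinv.contDiffAt_map_inverse hc
  -- `dp_y ∘ s` is invertible near `z`, and corrects `v` to a vector in the kernel of `dp_y`
  refine ⟨fun y ↦ v - s ((fderiv ℝ p y ∘L s).inverse (fderiv ℝ p y v)), by simp [hv], ?_, ?_⟩
  · exact (differentiableAt_const v).sub (s.differentiableAt.comp z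
      ((smooth_differentiableAt hci).clm_apply
        ((smooth_differentiableAt hp').clm_apply (differentiableAt_const v))))
  · filter_upwards [hev] with y hy
    have := hy.self_apply_inverse (fderiv ℝ p y v)
    rw [ContinuousLinearMap.comp_apply] at this
    rw [map_sub, this, sub_self]

/-- The horizontal vectors of `p` at `z`, orthogonal to the kernel of the derivative. -/
def IsHorizontal (g : E → E →L[ℝ] E →L[ℝ] ℝ) (p : E → F) (z u : E) : Prop :=
  ∀ v, fderiv ℝ p z v = 0 → g z u v = 0

variable (h : IsMetricOn g U) (hY : IsKillingOn g Y U) (hz : z ∈ U)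
  (hp : ∀ z ∈ U, ContDiffAt ℝ ∞ p z) (hs : ∀ q, fderiv ℝ p z (s q) = q)
  (hpY : ∀ z ∈ U, fderiv ℝ p z (Y z) = 0)
include h hY hz hp hs hpY

omit s hs [FiniteDimensional ℝ F] hY in
/-- The derivative of `dp(V) = 0` for a vertical field `V`. -/
lemma fderiv_fderiv_vertical {V : E → E} (hVd : DifferentiableAt ℝ V z)
    (hV : ∀ᶠ y in 𝓝 z, fderiv ℝ p y (V y) = 0) (w : E) :
    fderiv ℝ (fderiv ℝ p) z w (V z) = -fderiv ℝ p z (fderiv ℝ V z w) := by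
  have h1 : fderiv ℝ (fun y ↦ fderiv ℝ p y (V y)) z w = fderiv ℝ (fun _ : E ↦ (0 : F)) z w := by
    rw [Filter.EventuallyEq.fderiv_eq hV]
  rw [fderiv_apply_field (smooth_differentiableAt (contDiffAt_fderiv (hp z hz))) hVd,
    fderiv_fun_const, Pi.zero_apply, zero_apply] at h1
  exact eq_neg_of_add_eq_zero_left h1

/-- The bracket of a vertical Killing field with a horizontal field is horizontal. -/
lemma isHorizontal_bracket (hX : DifferentiableAt ℝ X₀ z)
    (hXh : ∀ z ∈ U, IsHorizontal g p z (X₀ z)) :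
    IsHorizontal g p z (fderiv ℝ X₀ z (Y z) - fderiv ℝ Y z (X₀ z)) := by
  intro v hv
  obtain ⟨V, hVz, hVd, hVv⟩ := exists_vertical_extension (hp z hz) hs hv
  have hU : ∀ᶠ y in 𝓝 z, y ∈ U := h.isOpen.mem_nhds hz
  have h1 := fderiv_fderiv_vertical h hz hp hpY hVd hVv (Y z)
  have h2 := fderiv_fderiv_vertical h hz hp hpY (hY.differentiableAt hz) (hU.mono hpY) (V z)
  rw [fderiv_fderiv_symm (hp z hz), h2] at h1
  have h3 := hXh z hz (fderiv ℝ V z (Y z) - fderiv ℝ Y z (V z))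
    (by rw [map_sub, sub_eq_zero]; exact (neg_injective h1).symm)
  have h4 : fderiv ℝ (fun y ↦ g y (X₀ y) (V y)) z (Y z)
      = fderiv ℝ (fun _ : E ↦ (0 : ℝ)) z (Y z) := by
    rw [Filter.EventuallyEq.fderiv_eq ((hU.and hVv).mono fun y hy ↦ hXh y hy.1 _ hy.2)]
  rw [fderiv_apply_field₂ (h.differentiableAt hz) hX hVd, hY.lie_metric h hz, fderiv_fun_const,
    Pi.zero_apply, zero_apply] at h4
  rw [map_sub] at h3
  rw [map_sub, sub_apply, ← hVz]
  linarith

omit [FiniteDimensional ℝ F] in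
/-- A horizontal vector extends to a horizontal field that commutes with the vertical Killing
field `Y`. -/
lemma exists_horizontal_extension {u : E} (hu : IsHorizontal g p z u) :
    ∃ V : E → E, V z = u ∧ DifferentiableAt ℝ V z ∧ (∀ y ∈ U, IsHorizontal g p y (V y)) ∧
      fderiv ℝ V z (Y z) = fderiv ℝ Y z u := by
  have hg := h.differentiableAt hz
  have hp' := contDiffAt_fderiv (hp z hz)
  have hpd := smooth_differentiableAt hp'
  -- the form `g(u, ·)` vanishes on vertical vectors, hence factors as `l ∘ dp`
  set l : F →L[ℝ] ℝ := g z u ∘L s with hl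
  have h1 (w : E) : l (fderiv ℝ p z w) = g z u w := by
    have h2 := hu (w - s (fderiv ℝ p z w)) (by rw [map_sub, hs, sub_self])
    rw [map_sub] at h2
    simp only [hl, ContinuousLinearMap.comp_apply]
    linarith
  have hVz : (g z).inverse (l ∘L fderiv ℝ p z) = u :=
    h.ext_of_apply hz fun w ↦ by rw [h.apply_inverse hz]; exact h1 w
  have hVd : DifferentiableAt ℝ (fun y ↦ (g y).inverse (l ∘L fderiv ℝ p y)) z :=
    (smooth_differentiableAt (h.contDiffAt_inverse hz)).clm_apply
      ((differentiableAt_const l).clm_comp hpd)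
  refine ⟨fun y ↦ (g y).inverse (l ∘L fderiv ℝ p y), hVz, hVd, fun y hy v hv ↦ ?_, ?_⟩
  · rw [h.apply_inverse hy, ContinuousLinearMap.comp_apply, hv, map_zero]
  · refine h.ext_of_apply hz fun w ↦ ?_
    have hk (a : E) : DifferentiableAt ℝ (fun _ : E ↦ a) z := differentiableAt_const a
    have h3 := DFunLike.congr_fun (fderiv_congr_of_isOpen h.isOpen (fun y hy ↦
      h.apply_inverse hy (l ∘L fderiv ℝ p y) w) hz) (Y z)
    have h4 : fderiv ℝ (fun y ↦ (l ∘L fderiv ℝ p y) w) z (Y z)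
        = l (fderiv ℝ (fderiv ℝ p) z (Y z) w) := by
      have : fderiv ℝ (fun y ↦ l (fderiv ℝ p y w)) z = l ∘L fderiv ℝ (fun y ↦ fderiv ℝ p y w) z :=
        (l.hasFDerivAt.comp z (hpd.clm_apply (hk w)).hasFDerivAt).fderiv
      change fderiv ℝ (fun y ↦ l (fderiv ℝ p y w)) z (Y z) = _
      rw [this, ContinuousLinearMap.comp_apply, fderiv_apply_const hpd]
    have h5 := fderiv_fderiv_vertical h hz hp hpY (hY.differentiableAt hz)
      (Filter.Eventually.mono (h.isOpen.mem_nhds hz) hpY) w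
    rw [fderiv_apply_field₂ hg hVd (hk w), h4, hVz, hY.lie_metric h hz,
      fderiv_fderiv_symm (hp z hz),
      h5, map_neg, h1] at h3
    simp only [fderiv_fun_const, Pi.zero_apply, zero_apply, map_zero, add_zero] at h3
    linarith

/-- A unit horizontal field `X₀` that spans an eigenspace of the horizontal part of the Einstein
tensor commutes with the vertical Killing field `Y`, whose flow preserves all the data. -/
lemma bracket_eq_of_eigenspace (hX : DifferentiableAt ℝ X₀ z)
    (hXh : ∀ z ∈ U, IsHorizontal g p z (X₀ z)) (hu : ∀ z ∈ U, g z (X₀ z) (X₀ z) = -1)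
    (hG : ∀ z ∈ U, ∀ u, IsHorizontal g p z u →
      ein g z u (X₀ z) = -energy g X₀ z * g z u (X₀ z))
    (hdim : ∀ Z, IsHorizontal g p z Z → (∀ u, IsHorizontal g p z u →
      ein g z u Z = -energy g X₀ z * g z u Z) → ∃ c : ℝ, Z = c • X₀ z) :
    fderiv ℝ X₀ z (Y z) = fderiv ℝ Y z (X₀ z) := by
  have hg := h.differentiableAt hz
  have hGd := smooth_differentiableAt (h.contDiffAt_ein hz)
  have hμ : DifferentiableAt ℝ (energy g X₀) z := (hGd.clm_apply hX).clm_apply hX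
  have hZh := isHorizontal_bracket h hY hz hp hs hpY hX hXh
  set Z := fderiv ℝ X₀ z (Y z) - fderiv ℝ Y z (X₀ z) with hZ
  -- `X₀` has constant length, so that its Lie derivative is orthogonal to it
  have hZX : g z (X₀ z) Z = 0 := by
    have h1 := DFunLike.congr_fun (fderiv_congr_of_isOpen h.isOpen hu hz) (Y z)
    rw [fderiv_apply_field₂ hg hX hX, hY.lie_metric h hz, h.symm z hz _ (X₀ z),
      h.symm z hz _ (X₀ z), fderiv_fun_const, Pi.zero_apply, zero_apply] at h1
    rw [hZ, map_sub]
    linarith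
  -- the Lie derivative of the eigenvalue equation, tested on an invariant horizontal field
  have key (u : E) (huh : IsHorizontal g p z u) : ein g z u Z =
      -(fderiv ℝ (energy g X₀) z (Y z) * g z u (X₀ z)) - energy g X₀ z * g z u Z := by
    obtain ⟨V, rfl, hVd, hVh, hVb⟩ := exists_horizontal_extension h hY hz hp hs hpY huh
    have h1 := DFunLike.congr_fun (fderiv_congr_of_isOpen h.isOpen (fun y hy ↦
      hG y hy (V y) (hVh y hy)) hz) (Y z)
    rw [fderiv_apply_field₂ hGd hVd hX, fderiv_fun_mul hμ.fun_neg ((hg.clm_apply hVd).clm_apply hX),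
      add_apply, smul_apply, smul_apply, fderiv_apply_field₂ hg hVd hX, hVb, hY.lie_metric h hz,
      fderiv_fun_neg, neg_apply, smul_eq_mul, smul_eq_mul] at h1
    have h2 := hY.lie_ein h hz (V z) (X₀ z)
    simp only [hZ, map_sub]
    linear_combination h1 - h2
  -- tested on `X₀`, it shows that the eigenvalue is invariant; hence `[Y, X₀]` is an eigenvector
  have hμY : fderiv ℝ (energy g X₀) z (Y z) = 0 := by
    have h1 := key (X₀ z) (hXh z hz)
    rw [h.ein_symm hz, hG z hz Z hZh, h.symm z hz Z, hZX, hu z hz] at h1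
    linarith
  obtain ⟨c, hc⟩ := hdim Z hZh fun u huh ↦ by rw [key u huh, hμY]; ring
  have h2 : c = 0 := by
    rw [hc, map_smul, hu z hz] at hZX
    simpa using hZX
  rw [h2, zero_smul] at hc
  exact sub_eq_zero.1 hc

end Bracket

end Coord

section Chart

variable {E : Type*} [NormedAddCommGroup E] [NormedSpace ℝ E] [FiniteDimensional ℝ E]
  {M : Type*} [TopologicalSpace M] [ChartedSpace E M] [IsManifold 𝓘(ℝ, E) ∞ M]

/-! ### The coordinate frame of a chart -/

/-- The coordinate frame of the chart at `x`, at the point of coordinates `z`: the derivative of the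
inverse of the chart, where the tangent spaces are identified with `E`. -/
def frame (x : M) (z : E) : E →L[ℝ] E :=
  mfderiv 𝓘(ℝ, E) 𝓘(ℝ, E) (extChartAt 𝓘(ℝ, E) x).symm z

/-- The scalar product on the tangent space at `x`, as a bilinear form on `E`. -/
def metricAt (g : SemiRiemannianMetric E M) (x : M) : E →L[ℝ] E →L[ℝ] ℝ := g.val x

/-- The vector field `V` is smooth at `x`. -/
def SmoothFieldAt (V : ∀ x : M, TangentSpace 𝓘(ℝ, E) x) (x : M) : Prop :=
  ContMDiffAt 𝓘(ℝ, E) 𝓘(ℝ, E).tangent ∞ (fun x ↦ (⟨x, V x⟩ : TangentBundle 𝓘(ℝ, E) M)) x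

variable {x : M} {z : E} {g : SemiRiemannianMetric E M}

lemma mem_source_of_mem_target (hz : z ∈ (extChartAt 𝓘(ℝ, E) x).target) :
    (extChartAt 𝓘(ℝ, E) x).symm z ∈ (chartAt E x).source := by
  rw [← extChartAt_source 𝓘(ℝ, E)]
  exact (extChartAt 𝓘(ℝ, E) x).map_target hz

lemma contMDiffAt_extChartAt_symm (hz : z ∈ (extChartAt 𝓘(ℝ, E) x).target) :
    ContMDiffAt 𝓘(ℝ, E) 𝓘(ℝ, E) ∞ (extChartAt 𝓘(ℝ, E) x).symm z :=
  (contMDiffOn_extChartAt_symm x).contMDiffAt ((isOpen_extChartAt_target x).mem_nhds hz)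

lemma frame_isInvertible (hz : z ∈ (extChartAt 𝓘(ℝ, E) x).target) : (frame x z).IsInvertible := by
  have h := isInvertible_mfderivWithin_extChartAt_symm (I := 𝓘(ℝ, E)) hz
  rw [ModelWithCorners.range_eq_univ, mfderivWithin_univ] at h
  exact h

/-- The coordinate frame is the trivialization of the tangent bundle over the chart. -/
lemma frame_eq_symmL (hz : z ∈ (extChartAt 𝓘(ℝ, E) x).target) (v : E) :
    frame x z v = (trivializationAt E (TangentSpace 𝓘(ℝ, E)) x).symm
      ((extChartAt 𝓘(ℝ, E) x).symm z) v := by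
  have h := TangentBundle.symmL_trivializationAt (I := 𝓘(ℝ, E)) (mem_source_of_mem_target hz)
  rw [ModelWithCorners.range_eq_univ, mfderivWithin_univ, PartialEquiv.right_inv _ hz] at h
  refine (DFunLike.congr_fun h v).symm.trans ?_
  exact Bundle.Trivialization.symmL_apply _ (by simpa using mem_source_of_mem_target hz) v

lemma frame_self (x : M) : frame x (extChartAt 𝓘(ℝ, E) x x) = ContinuousLinearMap.id ℝ E := by
  have h := mfderivWithin_range_extChartAt_symm (I := 𝓘(ℝ, E)) (x := x)
  rw [ModelWithCorners.range_eq_univ, mfderivWithin_univ] at h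
  exact h

lemma chartMetric_apply (z u v : E) :
    chartMetric g x z u v =
      metricAt g ((extChartAt 𝓘(ℝ, E) x).symm z) (frame x z u) (frame x z v) :=
  rfl

lemma frame_chartField (hz : z ∈ (extChartAt 𝓘(ℝ, E) x).target)
    (V : ∀ x : M, TangentSpace 𝓘(ℝ, E) x) :
    frame x z (chartField V x z) = V ((extChartAt 𝓘(ℝ, E) x).symm z) :=
  (frame_isInvertible hz).self_apply_inverse _

lemma frame_injective (hz : z ∈ (extChartAt 𝓘(ℝ, E) x).target) :
    Function.Injective (frame x z) := by
  obtain ⟨A, hA⟩ := frame_isInvertible hz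
  rw [← hA]
  exact A.injective

lemma frame_surjective (hz : z ∈ (extChartAt 𝓘(ℝ, E) x).target) :
    Function.Surjective (frame x z) := by
  obtain ⟨A, hA⟩ := frame_isInvertible hz
  rw [← hA]
  exact A.surjective

lemma chartField_eq_of_frame (hz : z ∈ (extChartAt 𝓘(ℝ, E) x).target)
    {V : ∀ x : M, TangentSpace 𝓘(ℝ, E) x} {v : E}
    (h : frame x z v = V ((extChartAt 𝓘(ℝ, E) x).symm z)) : chartField V x z = v :=
  frame_injective hz ((frame_chartField hz V).trans h.symm)

lemma ext_self {x : M} (v : TangentSpace 𝓘(ℝ, E) x) : ext v x = v :=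
  FiberBundle.extend_apply_self E v

lemma trivializationAt_self (x : M) (v : TangentSpace 𝓘(ℝ, E) x) :
    ((trivializationAt E (TangentSpace 𝓘(ℝ, E)) x) ⟨x, v⟩).2 = v := by
  have h := TangentBundle.continuousLinearMapAt_trivializationAt (I := 𝓘(ℝ, E))
    (mem_chart_source E x)
  rw [mfderiv_extChartAt_self] at h
  refine Eq.trans ?_ (DFunLike.congr_fun h v)
  exact (Bundle.Trivialization.continuousLinearMapAt_apply_of_mem ℝ
    (trivializationAt E (TangentSpace 𝓘(ℝ, E)) x) (by simp) v).symm

/-- The coordinates of the extension of a vector are constant. -/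
lemma chartField_ext (hz : z ∈ (extChartAt 𝓘(ℝ, E) x).target) (v : E) :
    chartField (ext (E := E) (x := x) v) x z = v := by
  refine chartField_eq_of_frame hz ((frame_eq_symmL hz v).trans ?_)
  exact congrArg _ (trivializationAt_self x v).symm

/-- A vector field is smooth if and only if its coordinates are. -/
lemma smoothFieldAt_iff (hz : z ∈ (extChartAt 𝓘(ℝ, E) x).target)
    (V : ∀ x : M, TangentSpace 𝓘(ℝ, E) x) :
    SmoothFieldAt V ((extChartAt 𝓘(ℝ, E) x).symm z) ↔ ContDiffAt ℝ ∞ (chartField V x) z := by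
  set e := trivializationAt E (TangentSpace 𝓘(ℝ, E)) x
  have hb : (extChartAt 𝓘(ℝ, E) x).symm z ∈ e.baseSet := by
    simpa [e] using mem_source_of_mem_target hz
  rw [SmoothFieldAt, e.contMDiffAt_section_iff hb]
  have hcoord (z : E) (hz : z ∈ (extChartAt 𝓘(ℝ, E) x).target) :
      (e ⟨(extChartAt 𝓘(ℝ, E) x).symm z, V ((extChartAt 𝓘(ℝ, E) x).symm z)⟩).2
        = chartField V x z := by
    have hb : (extChartAt 𝓘(ℝ, E) x).symm z ∈ e.baseSet := by
      simpa [e] using mem_source_of_mem_target hz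
    have h1 := frame_chartField hz V
    rw [frame_eq_symmL hz] at h1
    rw [← h1]
    exact e.apply_mk_symm hb _ ▸ rfl
  constructor
  · intro h
    have h2 := (h.comp z (contMDiffAt_extChartAt_symm hz)).contDiffAt
    refine h2.congr_of_eventuallyEq ?_
    filter_upwards [(isOpen_extChartAt_target x).mem_nhds hz] with y hy
    exact (hcoord y hy).symm
  · intro h
    have hs := mem_source_of_mem_target hz
    have h2 : ContMDiffAt 𝓘(ℝ, E) 𝓘(ℝ, E) ∞ (chartField V x)
        (extChartAt 𝓘(ℝ, E) x ((extChartAt 𝓘(ℝ, E) x).symm z)) := by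
      rw [PartialEquiv.right_inv _ hz]
      exact h.contMDiffAt
    have h3 := h2.comp _ (contMDiffAt_extChartAt' hs)
    refine h3.congr_of_eventuallyEq ?_
    filter_upwards [(chartAt E x).open_source.mem_nhds hs] with y hy
    have hy' : y ∈ (extChartAt 𝓘(ℝ, E) x).source := by rwa [extChartAt_source]
    have h4 := hcoord _ ((extChartAt 𝓘(ℝ, E) x).map_source hy')
    rw [PartialEquiv.left_inv _ hy'] at h4
    exact h4

/-- The coordinate vector fields of the chart at `x` are smooth. -/
lemma smoothFieldAt_symm (hz : z ∈ (extChartAt 𝓘(ℝ, E) x).target) (u : E) :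
    SmoothFieldAt (M := M)
      (fun y ↦ (trivializationAt E (TangentSpace 𝓘(ℝ, E)) x).symm y u)
      ((extChartAt 𝓘(ℝ, E) x).symm z) := by
  rw [smoothFieldAt_iff hz]
  refine (contDiffAt_const (c := u)).congr_of_eventuallyEq ?_
  filter_upwards [(isOpen_extChartAt_target x).mem_nhds hz] with y hy
  exact chartField_eq_of_frame hy (frame_eq_symmL hy u)

lemma contMDiffAt_metric {V W : ∀ x : M, TangentSpace 𝓘(ℝ, E) x} {y : M}
    (hV : SmoothFieldAt V y) (hW : SmoothFieldAt W y) :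
    ContMDiffAt 𝓘(ℝ, E) 𝓘(ℝ, ℝ) ∞ (fun y ↦ g.val y (V y) (W y)) y := by
  have h1 : ContMDiffAt 𝓘(ℝ, E) (𝓘(ℝ, E).prod 𝓘(ℝ, ℝ)) ∞
      (fun y ↦ TotalSpace.mk' ℝ (E := Bundle.Trivial M ℝ) y (g.val y (V y) (W y))) y :=
    ContMDiffAt.clm_bundle_apply₂ (F₁ := E) (F₂ := E) g.contMDiff.contMDiffAt hV hW
  simp only [contMDiffAt_totalSpace] at h1
  exact h1.2

lemma contDiffAt_chartMetric (hz : z ∈ (extChartAt 𝓘(ℝ, E) x).target) :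
    ContDiffAt ℝ ∞ (chartMetric g x) z := by
  refine contDiffAt_of_apply (isOpen_extChartAt_target x) (fun u z hz ↦ ?_) hz
  refine contDiffAt_of_apply (isOpen_extChartAt_target x) (fun v z hz ↦ ?_) hz
  have h2 := (contMDiffAt_metric (g := g) (smoothFieldAt_symm hz u)
    (smoothFieldAt_symm hz v)).comp z (contMDiffAt_extChartAt_symm hz)
  refine h2.contDiffAt.congr_of_eventuallyEq ?_
  filter_upwards [(isOpen_extChartAt_target x).mem_nhds hz] with y hy
  rw [chartMetric_apply, frame_eq_symmL hy, frame_eq_symmL hy]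
  rfl

lemma metricAt_symm (g : SemiRiemannianMetric E M) (y : M) (u v : E) :
    metricAt g y u v = metricAt g y v u := g.symm y u v

lemma metricAt_nondegenerate (g : SemiRiemannianMetric E M) (y : M) (v : E)
    (hv : ∀ w, metricAt g y v w = 0) : v = 0 := g.nondegenerate y v hv

lemma chartMetric_nondegenerate (hz : z ∈ (extChartAt 𝓘(ℝ, E) x).target) (v : E)
    (hv : ∀ w, chartMetric g x z v w = 0) : v = 0 := by
  refine frame_injective hz (Eq.trans ?_ (map_zero _).symm)
  refine metricAt_nondegenerate g ((extChartAt 𝓘(ℝ, E) x).symm z) (frame x z v) fun w ↦ ?_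
  obtain ⟨w', rfl⟩ := frame_surjective hz w
  exact hv w'

/-- The coordinate expression of a metric is a metric on the target of the chart. -/
lemma isMetricOn_chartMetric (g : SemiRiemannianMetric E M) (x : M) :
    Coord.IsMetricOn (chartMetric g x) (extChartAt 𝓘(ℝ, E) x).target where
  isOpen := isOpen_extChartAt_target x
  smooth := fun _ hz ↦ contDiffAt_chartMetric hz
  symm := fun _ _ _ _ ↦ metricAt_symm g _ _ _
  nondegenerate := fun _ hz v hv ↦ chartMetric_nondegenerate hz v hv

/-! ### The Levi-Civita connection in a chart -/

/-- Since `TangentSpace 𝓘(ℝ, E) y` unfolds to `E` for every `y`, the scalar products at two equal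
points can be compared as bilinear forms on `E`. -/
lemma metricAt_congr {y y' : M} (h : y = y') : metricAt g y = metricAt g y' := by rw [h]

/-- The derivative of the chart at `x` at its center, with values in `E`. -/
def chartDeriv (x : M) : E →L[ℝ] E :=
  mfderiv 𝓘(ℝ, E) 𝓘(ℝ, E) (extChartAt 𝓘(ℝ, E) x) x

lemma chartDeriv_eq (x : M) : chartDeriv (E := E) x = ContinuousLinearMap.id ℝ E :=
  mfderiv_extChartAt_self

/-- The covariant derivative at the center of the chart. -/
lemma nabla_eq_cov (V : ∀ x : M, TangentSpace 𝓘(ℝ, E) x) (x : M) (u : E) :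
    nabla g V x u = Coord.cov (chartMetric g x) (chartField V x) (extChartAt 𝓘(ℝ, E) x x) u := by
  change ((chartDeriv x).inverse ∘L (Coord.cov (chartMetric g x) (chartField V x)
    (extChartAt 𝓘(ℝ, E) x x)) ∘L (chartDeriv x)) u = _
  rw [chartDeriv_eq, ContinuousLinearMap.inverse_id]
  rfl

end Chart

section ChartChange

variable {E : Type*} [NormedAddCommGroup E] [NormedSpace ℝ E] [FiniteDimensional ℝ E]
  {M : Type*} [TopologicalSpace M] [ChartedSpace E M] [IsManifold 𝓘(ℝ, E) ∞ M]
  {x y : M} {z : E} {g : SemiRiemannianMetric E M}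

/-! ### Changes of charts -/

/-- The change of coordinates from the chart at `y` to the chart at `x`. -/
def transition (y x : M) (z : E) : E := extChartAt 𝓘(ℝ, E) x ((extChartAt 𝓘(ℝ, E) y).symm z)

/-- The domain of the change of coordinates from the chart at `y` to the chart at `x`. -/
def overlap (E : Type*) [NormedAddCommGroup E] [NormedSpace ℝ E]
    {M : Type*} [TopologicalSpace M] [ChartedSpace E M] (y x : M) : Set E :=
  (extChartAt 𝓘(ℝ, E) y).target ∩ (extChartAt 𝓘(ℝ, E) y).symm ⁻¹' (chartAt E x).source

lemma isOpen_overlap (y x : M) : IsOpen (overlap E y x) :=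
  (continuousOn_extChartAt_symm y).isOpen_inter_preimage (isOpen_extChartAt_target y)
    (chartAt E x).open_source

lemma transition_mem (hz : z ∈ overlap E y x) :
    transition y x z ∈ (extChartAt 𝓘(ℝ, E) x).target :=
  (extChartAt 𝓘(ℝ, E) x).map_source (by rw [extChartAt_source]; exact hz.2)

lemma symm_transition (hz : z ∈ overlap E y x) :
    (extChartAt 𝓘(ℝ, E) x).symm (transition y x z) = (extChartAt 𝓘(ℝ, E) y).symm z :=
  (extChartAt 𝓘(ℝ, E) x).left_inv (by rw [extChartAt_source]; exact hz.2)

lemma contDiffAt_transition (hz : z ∈ overlap E y x) : ContDiffAt ℝ ∞ (transition y x) z := by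
  have h := (contMDiffAt_extChartAt' (I := 𝓘(ℝ, E)) (n := ∞) hz.2).comp z
    (contMDiffAt_extChartAt_symm hz.1)
  exact h.contDiffAt

lemma frame_transition (hz : z ∈ overlap E y x) (u : E) :
    frame x (transition y x z) (fderiv ℝ (transition y x) z u) = frame y z u := by
  have h1 : MDifferentiableAt 𝓘(ℝ, E) 𝓘(ℝ, E) (extChartAt 𝓘(ℝ, E) x).symm (transition y x z) :=
    (contMDiffAt_extChartAt_symm (transition_mem hz)).mdifferentiableAt (by simp)
  have h2 : MDifferentiableAt 𝓘(ℝ, E) 𝓘(ℝ, E) (transition y x) z :=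
    (contDiffAt_transition hz).contMDiffAt.mdifferentiableAt (by simp)
  let L : E →L[ℝ] E := frame x (transition y x z) ∘L fderiv ℝ (transition y x) z
  have h3 : HasMFDerivAt 𝓘(ℝ, E) 𝓘(ℝ, E) (fun z ↦ (extChartAt 𝓘(ℝ, E) x).symm (transition y x z))
      z L := by
    have h4 := h1.hasMFDerivAt.comp z h2.hasMFDerivAt
    rw [mfderiv_eq_fderiv] at h4
    exact h4
  have h5 := h3.congr_of_eventuallyEq (f₁ := (extChartAt 𝓘(ℝ, E) y).symm) (by
    filter_upwards [(isOpen_overlap y x).mem_nhds hz] with z hz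
    exact (symm_transition hz).symm)
  exact (DFunLike.congr_fun h5.mfderiv u).symm

lemma isMetricOn_overlap (g : SemiRiemannianMetric E M) (y x : M) :
    Coord.IsMetricOn (chartMetric g y) (overlap E y x) :=
  (isMetricOn_chartMetric g y).mono (isOpen_overlap y x) fun _ hz ↦ hz.1

/-- A change of coordinates is an isometry between the coordinate expressions of the metric. -/
lemma chartMetric_transition (hz : z ∈ overlap E y x) (u v : E) :
    chartMetric g y z u v = chartMetric g x (transition y x z) (fderiv ℝ (transition y x) z u)
      (fderiv ℝ (transition y x) z v) := by
  rw [chartMetric_apply, chartMetric_apply, frame_transition hz, frame_transition hz,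
    metricAt_congr (symm_transition hz)]

lemma field_congr (V : ∀ x : M, TangentSpace 𝓘(ℝ, E) x) {y y' : M} (h : y = y') :
    (V y : E) = V y' := by subst h; rfl

lemma chartField_transition (hz : z ∈ overlap E y x) (V : ∀ x : M, TangentSpace 𝓘(ℝ, E) x) :
    fderiv ℝ (transition y x) z (chartField V y z) = chartField V x (transition y x z) := by
  refine (chartField_eq_of_frame (transition_mem hz) ?_).symm
  exact (frame_transition hz _).trans ((frame_chartField hz.1 V).trans
    (field_congr V (symm_transition hz).symm))

lemma mem_overlap_self (hy : y ∈ (chartAt E x).source) :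
    extChartAt 𝓘(ℝ, E) y y ∈ overlap E y x :=
  ⟨mem_extChartAt_target y, by
    rw [Set.mem_preimage, extChartAt_to_inv]
    exact hy⟩

lemma transition_self (y x : M) :
    transition y x (extChartAt 𝓘(ℝ, E) y y) = extChartAt 𝓘(ℝ, E) x y := by
  rw [transition, extChartAt_to_inv]

/-- The covariant derivative at a point of the domain of a chart. At `y` it is defined by the chart
at `y`, whereas here it is computed in the chart at `x`. -/
lemma nabla_chart (hy : y ∈ (chartAt E x).source) {V : ∀ x : M, TangentSpace 𝓘(ℝ, E) x}
    (hV : SmoothFieldAt V y) (u : E) :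
    (nabla g V y (frame x (extChartAt 𝓘(ℝ, E) x y) u) : E) =
      frame x (extChartAt 𝓘(ℝ, E) x y)
        (Coord.cov (chartMetric g x) (chartField V x) (extChartAt 𝓘(ℝ, E) x y) u) := by
  have hz := mem_overlap_self hy
  have hψ := contDiffAt_transition hz
  have hk (u : E) : frame x (extChartAt 𝓘(ℝ, E) x y)
      (fderiv ℝ (transition y x) (extChartAt 𝓘(ℝ, E) y y) u) = u := by
    rw [← transition_self, frame_transition hz, frame_self, ContinuousLinearMap.id_apply]
  have hzx : extChartAt 𝓘(ℝ, E) x y ∈ (extChartAt 𝓘(ℝ, E) x).target := by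
    rw [← transition_self]; exact transition_mem hz
  have hu : fderiv ℝ (transition y x) (extChartAt 𝓘(ℝ, E) y y)
      (frame x (extChartAt 𝓘(ℝ, E) x y) u) = u := frame_injective hzx (hk _)
  have hψi : Function.Surjective (fderiv ℝ (transition y x) (extChartAt 𝓘(ℝ, E) y y)) :=
    fun w ↦ ⟨frame x (extChartAt 𝓘(ℝ, E) x y) w, frame_injective hzx (hk _)⟩
  have hVy : DifferentiableAt ℝ (chartField V y) (extChartAt 𝓘(ℝ, E) y y) := by
    refine smooth_differentiableAt ((smoothFieldAt_iff hz.1 V).1 ?_)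
    rwa [extChartAt_to_inv]
  have hVx : DifferentiableAt ℝ (chartField V x)
      (transition y x (extChartAt 𝓘(ℝ, E) y y)) := by
    refine smooth_differentiableAt ((smoothFieldAt_iff (transition_mem hz) V).1 ?_)
    rwa [symm_transition hz, extChartAt_to_inv]
  have key := Coord.cov_naturality (isMetricOn_chartMetric g x) (isMetricOn_overlap g y x) hz
    (transition_mem hz) hψ hψi
    (Filter.eventually_of_mem ((isOpen_overlap y x).mem_nhds hz)
      fun z hz u v ↦ chartMetric_transition hz u v)
    hVx hVy
    (Filter.eventually_of_mem ((isOpen_overlap y x).mem_nhds hz)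
      fun z hz ↦ chartField_transition hz V) (frame x (extChartAt 𝓘(ℝ, E) x y) u)
  rw [hu, transition_self] at key
  rw [← key]
  exact (nabla_eq_cov V y _).trans (hk _).symm

end ChartChange

namespace Coord

variable {E : Type*} [NormedAddCommGroup E] [NormedSpace ℝ E] [FiniteDimensional ℝ E]
  {g : E → E →L[ℝ] E →L[ℝ] ℝ} {s : Set E} {z : E} {U V W : E → E}

/-! ### The curvature as a commutator -/

lemma cov_congr (hVW : V =ᶠ[𝓝 z] W) : cov g V z = cov g W z := by
  rw [cov, cov, hVW.fderiv_eq, hVW.self_of_nhds]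

namespace IsMetricOn

lemma contDiffAt_cov (h : IsMetricOn g s) (hz : z ∈ s) (hW : ContDiffAt ℝ ∞ W z) :
    ContDiffAt ℝ ∞ (cov g W) z :=
  (contDiffAt_fderiv hW).add ((h.contDiffAt_chr hz).clm_apply hW)

/-- The covariant derivative of `∇_V W`, in terms of derivatives of the Christoffel symbols. -/
lemma cov_cov (h : IsMetricOn g s) (hz : z ∈ s) (hW : ContDiffAt ℝ ∞ W z)
    (hV : DifferentiableAt ℝ V z) (u : E) :
    cov g (fun z ↦ cov g W z (V z)) z u =
      fderiv ℝ (fderiv ℝ W) z u (V z) + fderiv ℝ (chr g) z u (W z) (V z)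
        + chr g z (fderiv ℝ W z u) (V z) + cov g W z (fderiv ℝ V z u)
        + chr g z (cov g W z (V z)) u := by
  have hW' := smooth_differentiableAt hW
  have h1 : fderiv ℝ (cov g W) z u = fderiv ℝ (fderiv ℝ W) z u
      + (fderiv ℝ (chr g) z u (W z) + chr g z (fderiv ℝ W z u)) := by
    rw [← fderiv_apply_field (h.differentiableAt_chr hz) hW']
    exact DFunLike.congr_fun (fderiv_fun_add (smooth_differentiableAt (contDiffAt_fderiv hW))
      ((h.differentiableAt_chr hz).clm_apply hW')) u
  rw [cov_apply, fderiv_apply_field (smooth_differentiableAt (h.contDiffAt_cov hz hW)) hV, h1]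
  simp only [add_apply]
  abel

/-- The curvature in coordinates is the curvature operator of the covariant derivative. -/
lemma cov_cov_sub (h : IsMetricOn g s) (hz : z ∈ s) (hW : ContDiffAt ℝ ∞ W z)
    (hU : DifferentiableAt ℝ U z) (hV : DifferentiableAt ℝ V z) :
    cov g (fun z ↦ cov g W z (V z)) z (U z) - cov g (fun z ↦ cov g W z (U z)) z (V z)
      - cov g W z (fderiv ℝ V z (U z) - fderiv ℝ U z (V z)) = curv g z (U z) (V z) (W z) := by
  rw [h.cov_cov hz hW hV, h.cov_cov hz hW hU, curv_apply, fderiv_fderiv_symm hW (V z) (U z),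
    h.fderiv_chr_symm hz (U z) (W z), h.fderiv_chr_symm hz (V z) (W z), map_sub,
    cov_apply W z (V z), cov_apply W z (U z), map_add, map_add, add_apply, add_apply,
    h.chr_symm hz (chr g z (W z) (V z)), h.chr_symm hz (chr g z (W z) (U z)),
    h.chr_symm hz (W z) (V z), h.chr_symm hz (W z) (U z)]
  abel

end IsMetricOn

end Coord

section ChartCurvature

variable {E : Type*} [NormedAddCommGroup E] [NormedSpace ℝ E] [FiniteDimensional ℝ E]
  {M : Type*} [TopologicalSpace M] [ChartedSpace E M] [IsManifold 𝓘(ℝ, E) ∞ M]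
  {x y : M} {z : E} {g : SemiRiemannianMetric E M} {U V W : ∀ x : M, TangentSpace 𝓘(ℝ, E) x}

/-! ### The curvature in a chart -/

lemma extChartAt_mem_target (hy : y ∈ (chartAt E x).source) :
    extChartAt 𝓘(ℝ, E) x y ∈ (extChartAt 𝓘(ℝ, E) x).target :=
  (extChartAt 𝓘(ℝ, E) x).map_source (by rwa [extChartAt_source])

lemma symm_extChartAt (hy : y ∈ (chartAt E x).source) :
    (extChartAt 𝓘(ℝ, E) x).symm (extChartAt 𝓘(ℝ, E) x y) = y :=
  (extChartAt 𝓘(ℝ, E) x).left_inv (by rwa [extChartAt_source])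

lemma contDiffAt_chartField (hy : y ∈ (chartAt E x).source) (hV : SmoothFieldAt V y) :
    ContDiffAt ℝ ∞ (chartField V x) (extChartAt 𝓘(ℝ, E) x y) := by
  refine (smoothFieldAt_iff (extChartAt_mem_target hy) V).1 ?_
  rwa [symm_extChartAt hy]

lemma frame_chartField_self (hy : y ∈ (chartAt E x).source)
    (V : ∀ x : M, TangentSpace 𝓘(ℝ, E) x) :
    frame x (extChartAt 𝓘(ℝ, E) x y) (chartField V x (extChartAt 𝓘(ℝ, E) x y)) = V y :=
  (frame_chartField (extChartAt_mem_target hy) V).trans (field_congr V (symm_extChartAt hy))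

lemma eventually_symm (hy : y ∈ (chartAt E x).source) {p : M → Prop} (hp : ∀ᶠ y in 𝓝 y, p y) :
    ∀ᶠ z in 𝓝 (extChartAt 𝓘(ℝ, E) x y), z ∈ (extChartAt 𝓘(ℝ, E) x).target ∧
      p ((extChartAt 𝓘(ℝ, E) x).symm z) := by
  have hz := extChartAt_mem_target hy
  refine (Filter.eventually_of_mem ((isOpen_extChartAt_target x).mem_nhds hz) fun _ h ↦ h).and ?_
  have hc := (contMDiffAt_extChartAt_symm hz).continuousAt
  rw [ContinuousAt, symm_extChartAt hy] at hc
  exact hc.eventually hp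

/-- The coordinates of `∇_V W`. -/
lemma chartField_nabla (hy : y ∈ (chartAt E x).source) (hW : ∀ᶠ y in 𝓝 y, SmoothFieldAt W y) :
    chartField (fun y ↦ nabla g W y (V y)) x =ᶠ[𝓝 (extChartAt 𝓘(ℝ, E) x y)]
      fun z ↦ Coord.cov (chartMetric g x) (chartField W x) z (chartField V x z) := by
  filter_upwards [eventually_symm hy hW] with z hz
  have hs := mem_source_of_mem_target hz.1
  have h1 := nabla_chart (g := g) hs hz.2 (chartField V x z)
  rw [PartialEquiv.right_inv _ hz.1] at h1
  refine chartField_eq_of_frame hz.1 (h1.symm.trans ?_)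
  exact congrArg (fun w : E ↦ (nabla g W ((extChartAt 𝓘(ℝ, E) x).symm z) w : E))
    (frame_chartField hz.1 V)

lemma smoothFieldAt_nabla (hW : ∀ᶠ y in 𝓝 y, SmoothFieldAt W y) (hV : SmoothFieldAt V y) :
    SmoothFieldAt (fun y ↦ nabla g W y (V y)) y := by
  have hy := mem_chart_source E y
  have h1 := (smoothFieldAt_iff (extChartAt_mem_target hy) (fun y ↦ nabla g W y (V y))).2 (by
    refine ContDiffAt.congr_of_eventuallyEq ?_ (chartField_nabla hy hW)
    exact ((isMetricOn_chartMetric g y).contDiffAt_cov (extChartAt_mem_target hy)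
      (contDiffAt_chartField hy hW.self_of_nhds)).clm_apply (contDiffAt_chartField hy hV))
  rwa [symm_extChartAt hy] at h1

lemma SmoothFieldAt.mdifferentiableAt (hV : SmoothFieldAt V y) :
    MDifferentiableAt 𝓘(ℝ, E) 𝓘(ℝ, E).tangent
      (fun y ↦ (⟨y, V y⟩ : TangentBundle 𝓘(ℝ, E) M)) y :=
  ContMDiffAt.mdifferentiableAt hV (by simp)

/-- The coordinates of the Lie bracket `[U, V]`. -/
lemma chartField_mlieBracket (hy : y ∈ (chartAt E x).source) (hU : SmoothFieldAt U y)
    (hV : SmoothFieldAt V y) :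
    chartField (VectorField.mlieBracket 𝓘(ℝ, E) U V) x (extChartAt 𝓘(ℝ, E) x y) =
      fderiv ℝ (chartField V x) (extChartAt 𝓘(ℝ, E) x y) (chartField U x (extChartAt 𝓘(ℝ, E) x y))
        - fderiv ℝ (chartField U x) (extChartAt 𝓘(ℝ, E) x y)
          (chartField V x (extChartAt 𝓘(ℝ, E) x y)) := by
  have hz := extChartAt_mem_target hy
  have : IsManifold 𝓘(ℝ, E) (minSmoothness ℝ 2) M := by
    rw [minSmoothness_of_isRCLikeNormedField]
    exact IsManifold.of_le (n := ∞) (by simpa using ENat.LEInfty.out)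
  have h1 := VectorField.mpullback_mlieBracket (I := 𝓘(ℝ, E)) (I' := 𝓘(ℝ, E)) (n := ∞)
    (f := (extChartAt 𝓘(ℝ, E) x).symm) (V := U) (W := V) (x₀ := extChartAt 𝓘(ℝ, E) x y)
    (by rw [symm_extChartAt hy]; exact hU.mdifferentiableAt)
    (by rw [symm_extChartAt hy]; exact hV.mdifferentiableAt)
    (contMDiffAt_extChartAt_symm hz)
    (by rw [minSmoothness_of_isRCLikeNormedField]; simpa using ENat.LEInfty.out)
  refine h1.trans ?_
  rw [← VectorField.mlieBracketWithin_univ, VectorField.mlieBracketWithin_eq_lieBracketWithin]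
  exact congrFun (VectorField.lieBracketWithin_univ (𝕜 := ℝ) (V := chartField U x)
    (W := chartField V x)) _

/-- The curvature at a point of the domain of a chart. Smoothness is required near the point since
the curvature of vector fields involves their covariant derivatives at neighbouring points. -/
lemma curvature_chart (hy : y ∈ (chartAt E x).source) (hU : ∀ᶠ y in 𝓝 y, SmoothFieldAt U y)
    (hV : ∀ᶠ y in 𝓝 y, SmoothFieldAt V y) (hW : ∀ᶠ y in 𝓝 y, SmoothFieldAt W y) :
    (curvature g U V W y : E) = frame x (extChartAt 𝓘(ℝ, E) x y)
      (Coord.curv (chartMetric g x) (extChartAt 𝓘(ℝ, E) x y)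
        (chartField U x (extChartAt 𝓘(ℝ, E) x y)) (chartField V x (extChartAt 𝓘(ℝ, E) x y))
        (chartField W x (extChartAt 𝓘(ℝ, E) x y))) := by
  have hz := extChartAt_mem_target hy
  have hU' := contDiffAt_chartField hy hU.self_of_nhds
  have hV' := contDiffAt_chartField hy hV.self_of_nhds
  have hW' := contDiffAt_chartField hy hW.self_of_nhds
  have key {U V : ∀ x : M, TangentSpace 𝓘(ℝ, E) x} (hV : SmoothFieldAt V y) :
      (nabla g V y (U y) : E) = frame x (extChartAt 𝓘(ℝ, E) x y)
        (Coord.cov (chartMetric g x) (chartField V x) (extChartAt 𝓘(ℝ, E) x y)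
          (chartField U x (extChartAt 𝓘(ℝ, E) x y))) :=
    (congrArg (fun w : E ↦ (nabla g V y w : E)) (frame_chartField_self hy U).symm).trans
      (nabla_chart hy hV _)
  rw [← (isMetricOn_chartMetric g x).cov_cov_sub hz hW' (smooth_differentiableAt hU')
    (smooth_differentiableAt hV'), map_sub, map_sub,
    ← chartField_mlieBracket hy hU.self_of_nhds hV.self_of_nhds,
    ← Coord.cov_congr (chartField_nabla hy hW), ← Coord.cov_congr (chartField_nabla hy hW),
    ← key (smoothFieldAt_nabla hW hV.self_of_nhds), ← key (smoothFieldAt_nabla hW hU.self_of_nhds),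
    ← key hW.self_of_nhds]
  rfl

lemma eventually_smoothFieldAt_ext (v : E) :
    ∀ᶠ y' in 𝓝 y, SmoothFieldAt (ext (E := E) (x := y) v) y' := by
  filter_upwards [(chartAt E y).open_source.mem_nhds (mem_chart_source E y)] with y' hy'
  have hz := extChartAt_mem_target hy'
  have h1 := (smoothFieldAt_iff hz (ext (E := E) (x := y) v)).2 (by
    refine (contDiffAt_const (c := v)).congr_of_eventuallyEq ?_
    filter_upwards [(isOpen_extChartAt_target y).mem_nhds hz] with z hz
    exact chartField_ext hz v)
  rwa [symm_extChartAt hy'] at h1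

lemma metricAt_isInvertible (g : SemiRiemannianMetric E M) (y : M) : (metricAt g y).IsInvertible :=
  Coord.isInvertible_of_nondegenerate (metricAt_nondegenerate g y)

lemma metricAt_recip (g : SemiRiemannianMetric E M) (y : M) (i : Fin (Module.finrank ℝ E)) (w : E) :
    metricAt g y (recip g y i) w = (Module.finBasis ℝ E).coord i w :=
  DFunLike.congr_fun ((metricAt_isInvertible g y).self_apply_inverse
    (LinearMap.toContinuousLinearMap ((Module.finBasis ℝ E).coord i))) w

/-- The Ricci tensor at a point of the domain of a chart. -/
lemma ricci_chart (hy : y ∈ (chartAt E x).source) (v w : E) :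
    ricci g y (frame x (extChartAt 𝓘(ℝ, E) x y) v) (frame x (extChartAt 𝓘(ℝ, E) x y) w) =
      Coord.ric (chartMetric g x) (extChartAt 𝓘(ℝ, E) x y) v w := by
  set z := extChartAt 𝓘(ℝ, E) x y with hzdef
  have hz : z ∈ _ := extChartAt_mem_target hy
  have hA := frame_isInvertible hz
  set A := frame x z with hAdef
  have hext (v : E) : chartField (ext (x := y) v) x z = A.inverse v :=
    frame_injective hz (((frame_chartField_self hy _).trans (ext_self (x := y) v)).trans
      (hA.self_apply_inverse v).symm)
  have hinv (v : E) : A.inverse (A v) = v := hA.inverse_apply_self v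
  have h1 (b : E) : (curvature g (ext (x := y) b) (ext (x := y) (A v)) (ext (x := y) (A w)) y : E) =
      A (((Coord.curv (chartMetric g x) z).flip v).flip w (A.inverse b)) := by
    refine (curvature_chart hy (eventually_smoothFieldAt_ext b)
      (eventually_smoothFieldAt_ext (A v)) (eventually_smoothFieldAt_ext (A w))).trans ?_
    rw [← hzdef, hext, hext, hext, hinv, hinv]
    rfl
  have h2 : ricci g y (A v) (A w) = ∑ i, (Module.finBasis ℝ E).coord i
      ((A ∘L (((Coord.curv (chartMetric g x) z).flip v).flip w ∘L A.inverse))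
        (Module.finBasis ℝ E i)) :=
    Finset.sum_congr rfl fun i _ ↦ congrArg ((Module.finBasis ℝ E).coord i) (h1 _)
  have h3 : A.inverse ∘L A = ContinuousLinearMap.id ℝ E := by
    ext v; exact hinv v
  rw [h2, ← Coord.traceL_eq_sum_coord, Coord.traceL_comp_comm, ContinuousLinearMap.comp_assoc, h3,
    ContinuousLinearMap.comp_id]
  rfl

/-- The scalar curvature at a point of the domain of a chart. -/
lemma scalarCurvature_chart (hy : y ∈ (chartAt E x).source) :
    scalarCurvature g y = Coord.scal (chartMetric g x) (extChartAt 𝓘(ℝ, E) x y) := by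
  set z := extChartAt 𝓘(ℝ, E) x y with hzdef
  have hz : z ∈ _ := extChartAt_mem_target hy
  have hA := frame_isInvertible hz
  have hg := isMetricOn_chartMetric g x
  set A := frame x z with hAdef
  set Q := Coord.raise (chartMetric g x) (Coord.ric (chartMetric g x)) z
  have hinv (v : E) : A.inverse (A v) = v := hA.inverse_apply_self v
  have h1 (v w : E) : ricci g y v w = metricAt g y (A (Q (A.inverse v))) w := by
    obtain ⟨v, rfl⟩ := frame_surjective hz v
    obtain ⟨w, rfl⟩ := frame_surjective hz w
    refine (ricci_chart hy v w).trans ?_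
    rw [← hAdef, hinv, ← metricAt_congr (symm_extChartAt hy)]
    exact (hg.raise_apply hz _ v w).symm
  have h2 : scalarCurvature g y = ∑ i, (Module.finBasis ℝ E).coord i
      ((A ∘L (Q ∘L A.inverse)) (Module.finBasis ℝ E i)) := by
    change ∑ i, ricci g y (Module.finBasis ℝ E i) (recip g y i) = _
    exact Finset.sum_congr rfl fun i _ ↦
      (h1 _ _).trans ((metricAt_symm g y _ _).trans (metricAt_recip g y i _))
  have h3 : A.inverse ∘L A = ContinuousLinearMap.id ℝ E := by
    ext v; exact hinv v
  rw [h2, ← Coord.traceL_eq_sum_coord, Coord.traceL_comp_comm, ContinuousLinearMap.comp_assoc, h3,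
    ContinuousLinearMap.comp_id]
  rfl

/-- The Einstein tensor at a point of the domain of a chart. -/
lemma einstein_chart (hy : y ∈ (chartAt E x).source) (v w : E) :
    einstein g y (frame x (extChartAt 𝓘(ℝ, E) x y) v) (frame x (extChartAt 𝓘(ℝ, E) x y) w) =
      Coord.ein (chartMetric g x) (extChartAt 𝓘(ℝ, E) x y) v w := by
  have h1 : chartMetric g x (extChartAt 𝓘(ℝ, E) x y) v w = metricAt g y
      (frame x (extChartAt 𝓘(ℝ, E) x y) v) (frame x (extChartAt 𝓘(ℝ, E) x y) w) := by
    rw [chartMetric_apply, metricAt_congr (symm_extChartAt hy)]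
  change 2 * ricci g y _ _ - scalarCurvature g y * metricAt g y _ _ = 2 * _ - _ * _
  rw [← h1, ricci_chart hy, scalarCurvature_chart hy]
  rfl

end ChartCurvature

section ChartOperators

variable {E : Type*} [NormedAddCommGroup E] [NormedSpace ℝ E] [FiniteDimensional ℝ E]
  {M : Type*} [TopologicalSpace M] [ChartedSpace E M] [IsManifold 𝓘(ℝ, E) ∞ M]
  {x y : M} {z : E} {g : SemiRiemannianMetric E M} {U V W : ∀ x : M, TangentSpace 𝓘(ℝ, E) x}

/-! ### Differential operators at the center of a chart -/

lemma chartMetric_self (g : SemiRiemannianMetric E M) (x : M) :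
    chartMetric g x (extChartAt 𝓘(ℝ, E) x x) = metricAt g x := by
  ext u v
  rw [chartMetric_apply, frame_self, metricAt_congr (extChartAt_to_inv x)]
  rfl

lemma chartField_self (V : ∀ x : M, TangentSpace 𝓘(ℝ, E) x) (x : M) :
    chartField V x (extChartAt 𝓘(ℝ, E) x x) = V x := by
  have h := frame_chartField_self (mem_chart_source E x) V
  rwa [frame_self] at h

lemma recip_eq (g : SemiRiemannianMetric E M) (x : M) (i : Fin (Module.finrank ℝ E)) :
    (recip g x i : E) = Coord.recipBasis (chartMetric g x (extChartAt 𝓘(ℝ, E) x x)) i := by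
  rw [chartMetric_self]
  rfl

/-- The vector `β^♯` represents the form `β`, provided that `β` is linear. -/
lemma metricAt_sharp (g : SemiRiemannianMetric E M) (y : M) {β : E → ℝ} (α : E →L[ℝ] ℝ)
    (h : ∀ w, β w = α w) (w : E) : metricAt g y (sharp g y β) w = β w := by
  let r (i : Fin (Module.finrank ℝ E)) : E := recip g y i
  have h2 : (sharp g y β : E) = ∑ i, α (Module.finBasis ℝ E i) • r i :=
    Finset.sum_congr rfl fun i _ ↦ congrArg (fun c : ℝ ↦ c • r i) (h _)
  have h1 : metricAt g y (∑ i, α (Module.finBasis ℝ E i) • r i) w =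
      ∑ i, α (Module.finBasis ℝ E i) * (Module.finBasis ℝ E).coord i w := by
    rw [map_sum, sum_apply]
    refine Finset.sum_congr rfl fun i _ ↦ ?_
    rw [map_smul, smul_apply, smul_eq_mul]
    exact congrArg _ (metricAt_recip g y i w)
  refine (congrArg (fun a : E ↦ metricAt g y a w) h2).trans (h1.trans ?_)
  rw [h]
  conv_rhs => rw [← (Module.finBasis ℝ E).sum_repr w, map_sum]
  refine Finset.sum_congr rfl fun i _ ↦ ?_
  rw [map_smul, smul_eq_mul, mul_comm]
  rfl

/-- The derivative of a function along a vector, from its coordinate expression `f'`. -/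
lemma dirDeriv_eq {f : M → ℝ} {f' : E → ℝ}
    (hf : ∀ᶠ z in 𝓝 (extChartAt 𝓘(ℝ, E) x x), f ((extChartAt 𝓘(ℝ, E) x).symm z) = f' z)
    (hf' : DifferentiableAt ℝ f' (extChartAt 𝓘(ℝ, E) x x)) (u : E) :
    dirDeriv f x u = fderiv ℝ f' (extChartAt 𝓘(ℝ, E) x x) u := by
  have h1 : HasMFDerivAt 𝓘(ℝ, E) 𝓘(ℝ, E) (extChartAt 𝓘(ℝ, E) x) x (chartDeriv (E := E) x) :=
    (contMDiffAt_extChartAt (n := ∞)).mdifferentiableAt (by simp) |>.hasMFDerivAt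
  have h2 : HasMFDerivAt 𝓘(ℝ, E) 𝓘(ℝ, ℝ) f' (extChartAt 𝓘(ℝ, E) x x)
      (fderiv ℝ f' (extChartAt 𝓘(ℝ, E) x x)) := hf'.hasFDerivAt.hasMFDerivAt
  have h3 := h2.comp x h1
  have h4 : f =ᶠ[𝓝 x] f' ∘ extChartAt 𝓘(ℝ, E) x := by
    filter_upwards [(continuousAt_extChartAt (I := 𝓘(ℝ, E)) x).eventually hf,
      (chartAt E x).open_source.mem_nhds (mem_chart_source E x)] with y hy hys
    rw [symm_extChartAt hys] at hy
    exact hy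
  refine (DFunLike.congr_fun (h3.congr_of_eventuallyEq h4).mfderiv u).trans ?_
  change fderiv ℝ f' _ (chartDeriv x u) = _
  rw [chartDeriv_eq]
  rfl

lemma divField_eq (V : ∀ x : M, TangentSpace 𝓘(ℝ, E) x) (x : M) :
    divField g V x =
      Coord.traceL (Coord.cov (chartMetric g x) (chartField V x) (extChartAt 𝓘(ℝ, E) x x)) := by
  have h : (nabla g V x : E →L[ℝ] E) =
      Coord.cov (chartMetric g x) (chartField V x) (extChartAt 𝓘(ℝ, E) x x) := by
    ext u
    exact nabla_eq_cov V x u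
  rw [← h]
  rfl

/-- The tensor field `T'` on `E` is the coordinate expression of `T` near the center of the chart
at `x`. -/
def IsChartTensor (T : TwoTensor E M) (x : M) (T' : E → E →L[ℝ] E →L[ℝ] ℝ) : Prop :=
  ∀ᶠ z in 𝓝 (extChartAt 𝓘(ℝ, E) x x), ∀ v w : E,
    T ((extChartAt 𝓘(ℝ, E) x).symm z) (frame x z v) (frame x z w) = T' z v w

variable {T : TwoTensor E M} {T' : E → E →L[ℝ] E →L[ℝ] ℝ}

lemma IsChartTensor.self (h : IsChartTensor T x T') (v w : E) :
    T x v w = T' (extChartAt 𝓘(ℝ, E) x x) v w := by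
  have h1 := h.self_of_nhds v w
  rw [frame_self] at h1
  have h2 {y : M} (hy : y = x) : (T y (v : E) (w : E) : ℝ) = T x v w := by subst hy; rfl
  exact (h2 (extChartAt_to_inv x)).symm.trans h1

lemma frame_eq_ext (hz : z ∈ (extChartAt 𝓘(ℝ, E) x).target) (v : E) :
    frame x z v = ext (E := E) (x := x) v ((extChartAt 𝓘(ℝ, E) x).symm z) :=
  (congrArg (frame x z) (chartField_ext hz v)).symm.trans (frame_chartField hz _)

lemma eventually_mem_target (x : M) :
    ∀ᶠ z in 𝓝 (extChartAt 𝓘(ℝ, E) x x), z ∈ (extChartAt 𝓘(ℝ, E) x).target :=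
  (isOpen_extChartAt_target x).mem_nhds (mem_extChartAt_target x)

lemma IsChartTensor.dirDeriv_ext (h : IsChartTensor T x T')
    (hT : DifferentiableAt ℝ T' (extChartAt 𝓘(ℝ, E) x x)) (u v w : E) :
    dirDeriv (fun y ↦ T y (ext (E := E) (x := x) v y) (ext (E := E) (x := x) w y)) x u =
      fderiv ℝ T' (extChartAt 𝓘(ℝ, E) x x) u v w := by
  rw [← fderiv_apply_const₂ hT]
  refine dirDeriv_eq ?_
    ((hT.clm_apply (differentiableAt_const v)).clm_apply (differentiableAt_const w)) u
  filter_upwards [h, eventually_mem_target x] with z hz hzt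
  refine Eq.trans ?_ (hz v w)
  rw [frame_eq_ext hzt, frame_eq_ext hzt]

/-- The covariant derivatives of the coordinate fields are the Christoffel symbols. -/
lemma nabla_ext (v u : E) : (nabla g (ext (E := E) (x := x) v) x u : E) =
    Coord.chr (chartMetric g x) (extChartAt 𝓘(ℝ, E) x x) v u := by
  refine (nabla_eq_cov _ x u).trans ?_
  have h : chartField (ext (E := E) (x := x) v) x =ᶠ[𝓝 (extChartAt 𝓘(ℝ, E) x x)] fun _ ↦ v := by
    filter_upwards [eventually_mem_target x] with z hz
    exact chartField_ext hz v
  rw [Coord.cov_apply, h.fderiv_eq, h.self_of_nhds, fderiv_fun_const]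
  exact zero_add _

lemma IsChartTensor.nablaTensor_eq (h : IsChartTensor T x T')
    (hT : DifferentiableAt ℝ T' (extChartAt 𝓘(ℝ, E) x x)) (u v w : E) :
    nablaTensor g T x u v w =
      Coord.covTensor (chartMetric g x) T' (extChartAt 𝓘(ℝ, E) x x) u v w := by
  have h1 := (congrArg (fun a : E ↦ T x a w) (nabla_ext (g := g) (x := x) v u)).trans (h.self _ _)
  have h2 := (congrArg (fun a : E ↦ T x v a) (nabla_ext (g := g) (x := x) w u)).trans (h.self _ _)
  exact congrArg₂ _ (congrArg₂ _ (h.dirDeriv_ext hT u v w) h1) h2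

lemma IsChartTensor.divForm_eq (h : IsChartTensor T x T')
    (hT : DifferentiableAt ℝ T' (extChartAt 𝓘(ℝ, E) x x)) (w : E) :
    divForm g T x w = Coord.divT (chartMetric g x) T' (extChartAt 𝓘(ℝ, E) x x) w := by
  change ∑ i, nablaTensor g T x (Module.finBasis ℝ E i) (recip g x i) w = _
  exact Finset.sum_congr rfl fun i _ ↦ (h.nablaTensor_eq hT _ _ _).trans
    (congrArg (fun a : E ↦ Coord.covTensor (chartMetric g x) T' (extChartAt 𝓘(ℝ, E) x x)
      (Module.finBasis ℝ E i) a w) (recip_eq g x i))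

/-- The divergence of a tensor is computed in the chart. -/
lemma IsChartTensor.metricAt_divTensor (h : IsChartTensor T x T')
    (hT : DifferentiableAt ℝ T' (extChartAt 𝓘(ℝ, E) x x)) (w : E) :
    metricAt g x (divTensor g T x) w =
      Coord.divT (chartMetric g x) T' (extChartAt 𝓘(ℝ, E) x x) w := by
  set z := extChartAt 𝓘(ℝ, E) x x with hz
  refine (metricAt_sharp g x (∑ i,
    (fderiv ℝ T' z (Module.finBasis ℝ E i) (Coord.recipBasis (chartMetric g x z) i)
      - T' z (Coord.chr (chartMetric g x) z (Coord.recipBasis (chartMetric g x z) i)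
        (Module.finBasis ℝ E i))
      - T' z (Coord.recipBasis (chartMetric g x z) i) ∘L
        (Coord.chr (chartMetric g x) z).flip (Module.finBasis ℝ E i))) (fun w ↦ ?_) w).trans
    (h.divForm_eq hT w)
  rw [sum_apply]
  exact h.divForm_eq hT w

/-- The coordinate vector fields commute. -/
lemma mlieBracket_ext (x : M) (u v : E) :
    (VectorField.mlieBracket 𝓘(ℝ, E) (ext (E := E) (x := x) u) (ext (E := E) (x := x) v) x : E)
      = 0 := by
  have h0 (v : E) : fderiv ℝ (chartField (ext (E := E) (x := x) v) x) (extChartAt 𝓘(ℝ, E) x x)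
      = 0 := by
    have h : chartField (ext (E := E) (x := x) v) x =ᶠ[𝓝 (extChartAt 𝓘(ℝ, E) x x)] fun _ ↦ v := by
      filter_upwards [eventually_mem_target x] with z hz
      exact chartField_ext hz v
    rw [h.fderiv_eq, fderiv_fun_const]
    rfl
  refine (chartField_self (E := E) _ x).symm.trans ((chartField_mlieBracket (mem_chart_source E x)
    (eventually_smoothFieldAt_ext u).self_of_nhds
    (eventually_smoothFieldAt_ext v).self_of_nhds).trans ?_)
  rw [h0, h0]
  exact sub_self _

end ChartOperators

section ChartField

variable {E : Type*} [NormedAddCommGroup E] [NormedSpace ℝ E] [FiniteDimensional ℝ E]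
  {M : Type*} [TopologicalSpace M] [ChartedSpace E M] [IsManifold 𝓘(ℝ, E) ∞ M]
  {x y : M} {z : E} {g : SemiRiemannianMetric E M} {V Y : ∀ x : M, TangentSpace 𝓘(ℝ, E) x}

/-! ### The electromagnetic field in a chart -/

lemma metricAt_nabla (hz : z ∈ (extChartAt 𝓘(ℝ, E) x).target)
    (hV : SmoothFieldAt V ((extChartAt 𝓘(ℝ, E) x).symm z)) (u v : E) :
    metricAt g ((extChartAt 𝓘(ℝ, E) x).symm z)
        (nabla g V ((extChartAt 𝓘(ℝ, E) x).symm z) (frame x z u)) (frame x z v) =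
      chartMetric g x z (Coord.cov (chartMetric g x) (chartField V x) z u) v := by
  have h := nabla_chart (g := g) (mem_source_of_mem_target hz) hV u
  rw [PartialEquiv.right_inv _ hz] at h
  exact congrArg (fun a : E ↦ metricAt g ((extChartAt 𝓘(ℝ, E) x).symm z) a (frame x z v)) h

lemma isKillingOn_chartField (hY : ∀ y, SmoothFieldAt Y y) (hK : IsKilling g Y) (x : M) :
    Coord.IsKillingOn (chartMetric g x) (chartField Y x) (extChartAt 𝓘(ℝ, E) x).target where
  smooth := fun z hz ↦ (smoothFieldAt_iff hz Y).1 (hY _)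
  killing := fun z hz u v ↦ by
    have h := hK ((extChartAt 𝓘(ℝ, E) x).symm z) (frame x z u) (frame x z v)
    rw [← metricAt_nabla hz (hY _), (isMetricOn_chartMetric g x).symm z hz u,
      ← metricAt_nabla hz (hY _)]
    rw [g.symm _ (frame x z u)] at h
    exact h

lemma smooth_metric_field (hY : ∀ y, SmoothFieldAt Y y)
    (hz : z ∈ (extChartAt 𝓘(ℝ, E) x).target) :
    ContDiffAt ℝ ∞ (fun z ↦ chartMetric g x z (chartField Y x z)) z :=
  (contDiffAt_chartMetric hz).clm_apply ((smoothFieldAt_iff hz Y).1 (hY _))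

lemma fderiv_metric_field (hY : ∀ y, SmoothFieldAt Y y)
    (hz : z ∈ (extChartAt 𝓘(ℝ, E) x).target) (u v : E) :
    fderiv ℝ (fun z ↦ chartMetric g x z (chartField Y x z)) z u v =
      chartMetric g x z (Coord.cov (chartMetric g x) (chartField Y x) z u) v
        + chartMetric g x z (chartField Y x z) (Coord.chr (chartMetric g x) z v u) := by
  have hYd := smooth_differentiableAt ((smoothFieldAt_iff hz Y).1 (hY _))
  have h := (isMetricOn_chartMetric g x).fderiv_metric hz hYd (differentiableAt_const v) u
  rw [Coord.cov_apply (fun _ ↦ v), fderiv_fun_const, Pi.zero_apply, zero_apply, zero_add] at h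
  rw [← h, fderiv_apply_const (smooth_differentiableAt (smooth_metric_field hY hz))]

/-- `d(Y^♭)` is the antisymmetrization of `∇Y`. -/
lemma emField_eq (hY : ∀ y, SmoothFieldAt Y y) (y : M) (u v : E) :
    emField g Y y u v = metricAt g y (nabla g Y y u) v - metricAt g y (nabla g Y y v) u := by
  have hz := mem_extChartAt_target (I := 𝓘(ℝ, E)) y
  have hd := smooth_differentiableAt (smooth_metric_field (g := g) hY hz)
  have h1 (u v : E) : dirDeriv (fun y' ↦ g.val y' (Y y') (ext (E := E) (x := y) v y')) y u =
      metricAt g y (nabla g Y y u) v + metricAt g y (Y y)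
        (Coord.chr (chartMetric g y) (extChartAt 𝓘(ℝ, E) y y) v u) := by
    refine (dirDeriv_eq (f' := fun z ↦ chartMetric g y z (chartField Y y z) v) ?_
      (hd.clm_apply (differentiableAt_const v)) u).trans ?_
    · filter_upwards [eventually_mem_target y] with z hz
      rw [chartMetric_apply, frame_chartField hz, frame_eq_ext hz]
      rfl
    · rw [fderiv_apply_const hd, fderiv_metric_field hY hz, chartField_self, chartMetric_self]
      exact congrArg (fun a : E ↦ metricAt g y a v + _) (nabla_eq_cov Y y u).symm
  have h2 : g.val y (Y y) (VectorField.mlieBracket 𝓘(ℝ, E) (ext (E := E) (x := y) u)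
      (ext (E := E) (x := y) v) y) = 0 :=
    (congrArg (fun a : E ↦ metricAt g y (Y y) a) (mlieBracket_ext y u v)).trans (map_zero _)
  have hsub {a a' b b' c : ℝ} (ha : a = a') (hb : b = b') (hc : c = 0) : a - b - c = a' - b' := by
    rw [ha, hb, hc, sub_zero]
  refine (hsub (h1 u v) (h1 v u) h2).trans ?_
  rw [(isMetricOn_chartMetric g y).chr_symm hz u v]
  ring

lemma emField_chart (hY : ∀ y, SmoothFieldAt Y y) (hz : z ∈ (extChartAt 𝓘(ℝ, E) x).target)
    (u v : E) :
    emField g Y ((extChartAt 𝓘(ℝ, E) x).symm z) (frame x z u) (frame x z v) =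
      chartMetric g x z (Coord.cov (chartMetric g x) (chartField Y x) z u) v
        - chartMetric g x z (Coord.cov (chartMetric g x) (chartField Y x) z v) u := by
  rw [← metricAt_nabla hz (hY _), ← metricAt_nabla hz (hY _)]
  exact emField_eq hY _ _ _

/-- For a Killing field, `d(Y^♭) = 2 ∇Y`. -/
lemma isChartTensor_emField_killing (hY : ∀ y, SmoothFieldAt Y y) (hK : IsKilling g Y) (x : M) :
    IsChartTensor (emField g Y) x fun z ↦
      (2 : ℝ) • (chartMetric g x z ∘L Coord.cov (chartMetric g x) (chartField Y x) z) := by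
  filter_upwards [eventually_mem_target x] with z hz v w
  rw [emField_chart hY hz]
  have h := (isKillingOn_chartField hY hK x).killing z hz v w
  rw [(isMetricOn_chartMetric g x).symm z hz v] at h
  simp only [smul_apply, ContinuousLinearMap.comp_apply, smul_eq_mul]
  linarith

lemma isChartTensor_emField (hY : ∀ y, SmoothFieldAt Y y) (x : M) :
    IsChartTensor (emField g Y) x fun z ↦
      fderiv ℝ (fun z ↦ chartMetric g x z (chartField Y x z)) z
        - (fderiv ℝ (fun z ↦ chartMetric g x z (chartField Y x z)) z).flip := by
  filter_upwards [eventually_mem_target x] with z hz v w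
  rw [emField_chart hY hz, sub_apply, sub_apply, ContinuousLinearMap.flip_apply,
    fderiv_metric_field hY hz, fderiv_metric_field hY hz,
    (isMetricOn_chartMetric g x).chr_symm hz v w]
  ring

/-- The form `d(Y^♭)` is closed. -/
lemma extDerivTwo_emField (hY : ∀ y, SmoothFieldAt Y y) (x : M) (u v w : E) :
    extDerivTwo (emField g Y) x u v w = 0 := by
  have hz := mem_extChartAt_target (I := 𝓘(ℝ, E)) x
  have hT := isChartTensor_emField (g := g) hY x
  have hθ := smooth_metric_field (g := g) hY hz
  set θ := fun z ↦ chartMetric g x z (chartField Y x z) with hθdef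
  have hd := smooth_differentiableAt (contDiffAt_fderiv hθ)
  have hdf : DifferentiableAt ℝ (fun z ↦ (fderiv ℝ θ z).flip) (extChartAt 𝓘(ℝ, E) x x) :=
    (ContinuousLinearMap.flipₗᵢ ℝ E E ℝ).differentiableAt.comp _ hd
  have hTd := hd.fun_sub hdf
  have h1 (u v w : E) : fderiv ℝ (fun z ↦ fderiv ℝ θ z - (fderiv ℝ θ z).flip)
      (extChartAt 𝓘(ℝ, E) x x) u v w = fderiv ℝ (fderiv ℝ θ) (extChartAt 𝓘(ℝ, E) x x) u v w
        - fderiv ℝ (fderiv ℝ θ) (extChartAt 𝓘(ℝ, E) x x) u w v := by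
    rw [← fderiv_apply_const₂ hTd]
    have h2 : (fun z ↦ (fderiv ℝ θ z - (fderiv ℝ θ z).flip) v w) =
        fun z ↦ fderiv ℝ θ z v w - fderiv ℝ θ z w v := rfl
    have hk (v w : E) : DifferentiableAt ℝ (fun z ↦ fderiv ℝ θ z v w) (extChartAt 𝓘(ℝ, E) x x) :=
      (hd.clm_apply (differentiableAt_const v)).clm_apply (differentiableAt_const w)
    rw [h2, fderiv_fun_sub (hk v w) (hk w v), sub_apply, fderiv_apply_const₂ hd,
      fderiv_apply_const₂ hd]
  have hb (u v w : E) : emField g Y x (VectorField.mlieBracket 𝓘(ℝ, E) (ext (E := E) (x := x) u)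
      (ext (E := E) (x := x) v) x) w = 0 := by
    refine (congrArg (fun a : E ↦ emField g Y x a w) (mlieBracket_ext x u v)).trans ?_
    refine (hT.self 0 w).trans ?_
    rw [map_zero]
    rfl
  have hsum {a a' b b' c c' p q r : ℝ} (ha : a = a') (hb : b = b') (hc : c = c') (hp : p = 0)
      (hq : q = 0) (hr : r = 0) : a - b + c - p + q - r = a' - b' + c' := by
    rw [ha, hb, hc, hp, hq, hr, sub_zero, add_zero, sub_zero]
  refine (hsum (hT.dirDeriv_ext hTd u v w) (hT.dirDeriv_ext hTd v u w) (hT.dirDeriv_ext hTd w u v)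
    (hb u v w) (hb u w v) (hb v w u)).trans ?_
  rw [h1, h1, h1, fderiv_fderiv_symm hθ u v, fderiv_fderiv_symm hθ u w,
    fderiv_fderiv_symm hθ v w]
  ring

/-- The square `F_{ij} F^{ij} = 4 |∇Y|²` of the electromagnetic field. -/
lemma contraction_emField (hY : ∀ y, SmoothFieldAt Y y) (hK : IsKilling g Y) (x : M) :
    contraction g x (emField g Y x) = 4 * ∑ i, metricAt g x
      (Coord.cov (chartMetric g x) (chartField Y x) (extChartAt 𝓘(ℝ, E) x x)
        (Coord.recipBasis (metricAt g x) i))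
      (Coord.cov (chartMetric g x) (chartField Y x) (extChartAt 𝓘(ℝ, E) x x)
        (Module.finBasis ℝ E i)) := by
  have hz := mem_extChartAt_target (I := 𝓘(ℝ, E)) x
  have hT (u v : E) := (isChartTensor_emField_killing hY hK x).self u v
  have hsum := fun v w ↦ (isMetricOn_chartMetric g x).sum_mul_recipBasis hz v w
  rw [chartMetric_self] at hT hsum
  set A := Coord.cov (chartMetric g x) (chartField Y x) (extChartAt 𝓘(ℝ, E) x x)
  change ∑ i, ∑ j, emField g Y x (Module.finBasis ℝ E i) (Module.finBasis ℝ E j) *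
    emField g Y x (recip g x i) (recip g x j) = _
  rw [Finset.mul_sum]
  refine Finset.sum_congr rfl fun i _ ↦ ?_
  rw [← hsum, Finset.mul_sum]
  refine Finset.sum_congr rfl fun j _ ↦ ?_
  refine (congrArg₂ _ (hT _ _) (hT (Coord.recipBasis (metricAt g x) i)
    (Coord.recipBasis (metricAt g x) j))).trans ?_
  simp only [smul_apply, ContinuousLinearMap.comp_apply, smul_eq_mul]
  ring

end ChartField

section FluidChart

variable {E : Type*} [NormedAddCommGroup E] [NormedSpace ℝ E] [FiniteDimensional ℝ E]
  {M : Type*} [TopologicalSpace M] [ChartedSpace E M] [IsManifold 𝓘(ℝ, E) ∞ M]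
  {x y : M} {z : E} {g : SemiRiemannianMetric E M} {V X₀ Y : ∀ x : M, TangentSpace 𝓘(ℝ, E) x}
  {μ : M → ℝ} {O : Set E}

/-! ### The equations of a fluid on a manifold -/

lemma metricAt_frame (hz : z ∈ (extChartAt 𝓘(ℝ, E) x).target)
    (V W : ∀ x : M, TangentSpace 𝓘(ℝ, E) x) :
    chartMetric g x z (chartField V x z) (chartField W x z) =
      g.val ((extChartAt 𝓘(ℝ, E) x).symm z) (V ((extChartAt 𝓘(ℝ, E) x).symm z))
        (W ((extChartAt 𝓘(ℝ, E) x).symm z)) := by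
  rw [chartMetric_apply, frame_chartField hz, frame_chartField hz]
  rfl

lemma einstein_frame (hz : z ∈ (extChartAt 𝓘(ℝ, E) x).target) (v w : E) :
    einstein g ((extChartAt 𝓘(ℝ, E) x).symm z) (frame x z v) (frame x z w) =
      Coord.ein (chartMetric g x) z v w := by
  have h := einstein_chart (g := g) (mem_source_of_mem_target hz) v w
  rwa [PartialEquiv.right_inv _ hz] at h

lemma einstein_field (hz : z ∈ (extChartAt 𝓘(ℝ, E) x).target)
    (V W : ∀ x : M, TangentSpace 𝓘(ℝ, E) x) :
    einstein g ((extChartAt 𝓘(ℝ, E) x).symm z) (V ((extChartAt 𝓘(ℝ, E) x).symm z))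
        (W ((extChartAt 𝓘(ℝ, E) x).symm z)) =
      Coord.ein (chartMetric g x) z (chartField V x z) (chartField W x z) := by
  rw [← einstein_frame hz, frame_chartField hz, frame_chartField hz]

/-- The vector fields `X₀` and `Y` and the function `μ` have, over the open set `O` of the chart at
`x`, the coordinates of a fluid. -/
structure IsChartFluid (g : SemiRiemannianMetric E M) (μ : M → ℝ)
    (X₀ Y : ∀ x : M, TangentSpace 𝓘(ℝ, E) x) (x : M) (O : Set E) : Prop where
  fluid : Coord.IsFluidOn (chartMetric g x) (chartField X₀ x) (chartField Y x) O
  subset : O ⊆ (extChartAt 𝓘(ℝ, E) x).target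
  mem : extChartAt 𝓘(ℝ, E) x x ∈ O
  energy : ∀ z ∈ O, μ ((extChartAt 𝓘(ℝ, E) x).symm z) =
    Coord.energy (chartMetric g x) (chartField X₀ x) z

namespace IsChartFluid

variable (h : IsChartFluid g μ X₀ Y x O)
include h

lemma eventually_mem : ∀ᶠ z in 𝓝 (extChartAt 𝓘(ℝ, E) x x), z ∈ O :=
  h.fluid.metric.isOpen.mem_nhds h.mem

lemma charge_eq (hz : z ∈ O) : chargeDensity g X₀ Y ((extChartAt 𝓘(ℝ, E) x).symm z) =
    Coord.charge (chartMetric g x) (chartField X₀ x) (chartField Y x) z :=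
  einstein_field (h.subset hz) X₀ Y

lemma ratio_eq (hz : z ∈ O) : chargeDensity g X₀ Y ((extChartAt 𝓘(ℝ, E) x).symm z)
    / μ ((extChartAt 𝓘(ℝ, E) x).symm z) =
      Coord.ratio (chartMetric g x) (chartField X₀ x) (chartField Y x) z := by
  rw [h.charge_eq hz, h.energy z hz, Coord.ratio]

lemma chartField_fluidField (hz : z ∈ O) : chartField (fluidField g μ X₀ Y) x z =
    Coord.fluid (chartMetric g x) (chartField X₀ x) (chartField Y x) z := by
  refine chartField_eq_of_frame (h.subset hz) ?_
  rw [Coord.fluid, map_add, map_smul, frame_chartField (h.subset hz),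
    frame_chartField (h.subset hz), ← h.ratio_eq hz]
  rfl

lemma frame_fluid (hz : z ∈ O) :
    frame x z (Coord.fluid (chartMetric g x) (chartField X₀ x) (chartField Y x) z) =
      fluidField g μ X₀ Y ((extChartAt 𝓘(ℝ, E) x).symm z) := by
  rw [← h.chartField_fluidField hz, frame_chartField (h.subset hz)]

lemma beta_eq (hz : z ∈ O) : betaCoeff g μ X₀ Y ((extChartAt 𝓘(ℝ, E) x).symm z) =
    Coord.beta (chartMetric g x) (chartField X₀ x) (chartField Y x) z := by
  rw [betaCoeff, h.charge_eq hz, h.energy z hz, Coord.beta, einstein_field (h.subset hz)]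

lemma pressure_eq (hz : z ∈ O) (v w : E) :
    pressure g μ X₀ Y ((extChartAt 𝓘(ℝ, E) x).symm z) (frame x z v) (frame x z w) =
      Coord.press (chartMetric g x) (chartField X₀ x) (chartField Y x) z v w := by
  have hX (v : E) : g.val ((extChartAt 𝓘(ℝ, E) x).symm z)
      (fluidField g μ X₀ Y ((extChartAt 𝓘(ℝ, E) x).symm z)) (frame x z v) =
      chartMetric g x z (Coord.fluid (chartMetric g x) (chartField X₀ x) (chartField Y x) z) v := by
    rw [chartMetric_apply, h.frame_fluid hz]
    rfl
  have hY (v : E) : g.val ((extChartAt 𝓘(ℝ, E) x).symm z)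
      (Y ((extChartAt 𝓘(ℝ, E) x).symm z)) (frame x z v) =
      chartMetric g x z (chartField Y x z) v := by
    rw [chartMetric_apply, frame_chartField (h.subset hz)]
    rfl
  unfold pressure
  rw [einstein_frame (h.subset hz), h.energy z hz, h.beta_eq hz, hX, hX, hY, hY,
    Coord.press, sub_apply, sub_apply, sub_apply, sub_apply, Coord.outer_apply, Coord.outer_apply]
  ring

lemma isChartTensor_pressure : IsChartTensor (pressure g μ X₀ Y) x
    (Coord.press (chartMetric g x) (chartField X₀ x) (chartField Y x)) := by
  filter_upwards [h.eventually_mem] with z hz v w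
  exact h.pressure_eq hz v w

lemma metricAt_divTensor (w : E) : metricAt g x (divTensor g (pressure g μ X₀ Y) x) w =
    Coord.divT (chartMetric g x) (Coord.press (chartMetric g x) (chartField X₀ x) (chartField Y x))
      (extChartAt 𝓘(ℝ, E) x x) w :=
  h.isChartTensor_pressure.metricAt_divTensor
    (smooth_differentiableAt (h.fluid.contDiffAt_press h.mem)) w

/-- The component of `∇·P` along a vector field. -/
lemma divT_field (V : ∀ x : M, TangentSpace 𝓘(ℝ, E) x) :
    Coord.divT (chartMetric g x) (Coord.press (chartMetric g x) (chartField X₀ x) (chartField Y x))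
      (extChartAt 𝓘(ℝ, E) x x) (chartField V x (extChartAt 𝓘(ℝ, E) x x)) =
      g.val x (V x) (divTensor g (pressure g μ X₀ Y) x) := by
  rw [← h.metricAt_divTensor, chartField_self]
  exact metricAt_symm g x _ _

lemma divField_eq_of {V' : E → E}
    (hV : ∀ z ∈ O, chartField V x z = V' z) :
    divField g V x = Coord.traceL (Coord.cov (chartMetric g x) V' (extChartAt 𝓘(ℝ, E) x x)) := by
  rw [divField_eq, Coord.cov_congr (h.eventually_mem.mono hV)]

omit h in
lemma chartField_smul (hz : z ∈ (extChartAt 𝓘(ℝ, E) x).target) (c : M → ℝ)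
    (V : ∀ x : M, TangentSpace 𝓘(ℝ, E) x) :
    chartField (fun y ↦ c y • V y) x z =
      c ((extChartAt 𝓘(ℝ, E) x).symm z) • chartField V x z := by
  refine chartField_eq_of_frame hz ?_
  rw [map_smul, frame_chartField hz]
  rfl

/-- Energy conservation. -/
lemma divField_energy_fluidField :
    divField g (fun y ↦ μ y • fluidField g μ X₀ Y y) x =
      g.val x (X₀ x) (divTensor g (pressure g μ X₀ Y) x) := by
  rw [← h.divT_field, ← h.fluid.div_energy_fluid h.mem]
  refine h.divField_eq_of fun z hz ↦ ?_
  rw [chartField_smul (h.subset hz), h.energy z hz, h.chartField_fluidField hz]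

lemma divField_energy_apparentField :
    divField g (fun y ↦ μ y • X₀ y) x =
      g.val x (X₀ x) (divTensor g (pressure g μ X₀ Y) x) := by
  rw [← h.divT_field, ← h.fluid.div_energy_X₀ h.mem]
  refine h.divField_eq_of fun z hz ↦ ?_
  rw [chartField_smul (h.subset hz), h.energy z hz]

/-- Charge conservation. -/
lemma divField_charge_fluidField :
    divField g (fun y ↦ chargeDensity g X₀ Y y • fluidField g μ X₀ Y y) x =
      g.val x (Y x) (divTensor g (pressure g μ X₀ Y) x) := by
  rw [← h.divT_field, ← h.fluid.div_charge_fluid h.mem]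
  refine h.divField_eq_of fun z hz ↦ ?_
  rw [chartField_smul (h.subset hz), h.charge_eq hz, h.chartField_fluidField hz]

lemma divField_charge_apparentField :
    divField g (fun y ↦ chargeDensity g X₀ Y y • X₀ y) x =
      g.val x (Y x) (divTensor g (pressure g μ X₀ Y) x) := by
  rw [← h.divT_field, ← h.fluid.div_charge_X₀ h.mem]
  refine h.divField_eq_of fun z hz ↦ ?_
  rw [chartField_smul (h.subset hz), h.charge_eq hz]

/-- The coordinates of the vector field `ᵉP(Y)`. -/
lemma chartField_endo_pressure (hz : z ∈ O) :
    chartField (fun y ↦ endo g (pressure g μ X₀ Y) y (Y y)) x z =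
      (chartMetric g x z).inverse (Coord.press (chartMetric g x) (chartField X₀ x)
        (chartField Y x) z (chartField Y x z)) := by
  have hzt := h.subset hz
  refine (isMetricOn_chartMetric g x).ext_of_apply hzt fun w ↦ ?_
  rw [(isMetricOn_chartMetric g x).apply_inverse hzt, chartMetric_apply, frame_chartField hzt]
  have hP (u : E) : pressure g μ X₀ Y ((extChartAt 𝓘(ℝ, E) x).symm z) u
      (Y ((extChartAt 𝓘(ℝ, E) x).symm z)) = (Coord.press (chartMetric g x) (chartField X₀ x)
        (chartField Y x) z (chartField Y x z) ∘L (frame x z).inverse) u := by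
    obtain ⟨u, rfl⟩ := frame_surjective hzt u
    rw [ContinuousLinearMap.comp_apply, (frame_isInvertible hzt).inverse_apply_self,
      ← frame_chartField hzt Y, h.pressure_eq hz, h.fluid.press_symm hz]
  refine (metricAt_sharp g _ _ hP (frame x z w)).trans ((hP _).trans ?_)
  rw [ContinuousLinearMap.comp_apply, (frame_isInvertible hzt).inverse_apply_self]

lemma divField_endo_pressure :
    divField g (fun y ↦ endo g (pressure g μ X₀ Y) y (Y y)) x =
      g.val x (Y x) (divTensor g (pressure g μ X₀ Y) x) := by
  rw [← h.divT_field, ← h.fluid.div_press_killing h.mem]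
  exact h.divField_eq_of fun z hz ↦ h.chartField_endo_pressure hz

lemma energy_self : Coord.energy (chartMetric g x) (chartField X₀ x) (extChartAt 𝓘(ℝ, E) x x) =
    μ x := by
  rw [← h.energy _ h.mem, extChartAt_to_inv]

lemma charge_self : Coord.charge (chartMetric g x) (chartField X₀ x) (chartField Y x)
    (extChartAt 𝓘(ℝ, E) x x) = chargeDensity g X₀ Y x := by
  rw [← h.charge_eq h.mem, extChartAt_to_inv]

lemma fluid_self : Coord.fluid (chartMetric g x) (chartField X₀ x) (chartField Y x)
    (extChartAt 𝓘(ℝ, E) x x) = fluidField g μ X₀ Y x := by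
  rw [← h.chartField_fluidField h.mem, chartField_self]

/-- The variation of `e / μ` along the fluid. -/
lemma dirDeriv_ratio :
    μ x ^ 2 * dirDeriv (fun y ↦ chargeDensity g X₀ Y y / μ y) x (fluidField g μ X₀ Y x) =
      μ x * g.val x (Y x) (divTensor g (pressure g μ X₀ Y) x)
        - chargeDensity g X₀ Y x * g.val x (X₀ x) (divTensor g (pressure g μ X₀ Y) x) := by
  have h1 := h.fluid.energy_sq_mul_fderiv_ratio h.mem
  rw [h.energy_self, h.charge_self, h.divT_field, h.divT_field, h.fluid_self] at h1
  rw [← h1]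
  exact congrArg _ (dirDeriv_eq (h.eventually_mem.mono fun z hz ↦ h.ratio_eq hz)
    (smooth_differentiableAt (h.fluid.contDiffAt_ratio h.mem)) _)

omit h in
lemma metricAt_ext {v w : E} (hvw : ∀ a, metricAt g x v a = metricAt g x w a) : v = w :=
  sub_eq_zero.1 (metricAt_nondegenerate g x _ fun a ↦ by rw [map_sub, sub_apply, hvw, sub_self])

/-- The motion of the fluid. -/
lemma nabla_fluidField :
    μ x • nabla g (fluidField g μ X₀ Y) x (fluidField g μ X₀ Y x) =
      -divTensor g (pressure g μ X₀ Y) x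
        - g.val x (X₀ x) (divTensor g (pressure g μ X₀ Y) x) • fluidField g μ X₀ Y x := by
  refine metricAt_ext (g := g) (x := x) fun w ↦ ?_
  have h1 := h.fluid.motion_fluid h.mem w
  rw [h.energy_self, h.divT_field, h.fluid_self, ← h.metricAt_divTensor, chartMetric_self,
    ← Coord.cov_congr (h.eventually_mem.mono fun z hz ↦ h.chartField_fluidField hz),
    ← nabla_eq_cov (fluidField g μ X₀ Y) x (fluidField g μ X₀ Y x)] at h1
  have h2 (a : ℝ) (p q r : E) (c : ℝ) (hpqr : a * metricAt g x p w =
      -metricAt g x q w - c * metricAt g x r w) :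
      metricAt g x (a • p) w = metricAt g x (-q - c • r) w := by
    simpa using hpqr
  exact h2 _ _ _ _ _ h1

/-- `ᵉF(X₀) = -2 ∇_{X₀} Y`, since `F(u, v) = 2 g(∇_u Y, v)` is skew-symmetric. -/
lemma metricAt_endo_emField (hY : ∀ y, SmoothFieldAt Y y) (hK : IsKilling g Y) (w : E) :
    metricAt g x (endo g (emField g Y) x (X₀ x)) w =
      -2 * metricAt g x (Coord.cov (chartMetric g x) (chartField Y x) (extChartAt 𝓘(ℝ, E) x x)
        (X₀ x)) w := by
  have hT (u v : E) : emField g Y x u v = 2 * chartMetric g x (extChartAt 𝓘(ℝ, E) x x)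
      (Coord.cov (chartMetric g x) (chartField Y x) (extChartAt 𝓘(ℝ, E) x x) u) v :=
    (isChartTensor_emField_killing hY hK x).self u v
  have hK' := fun u v ↦ (isKillingOn_chartField hY hK x).killing _
    (mem_extChartAt_target (I := 𝓘(ℝ, E)) x) u v
  rw [chartMetric_self] at hK'
  simp only [chartMetric_self] at hT
  set A := Coord.cov (chartMetric g x) (chartField Y x) (extChartAt 𝓘(ℝ, E) x x)
  have h1 (u : E) : emField g Y x u (X₀ x) = ((-2 : ℝ) • metricAt g x (A (X₀ x))) u := by
    refine (hT u (X₀ x)).trans ?_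
    have h2 := hK' u (X₀ x)
    rw [metricAt_symm g x u] at h2
    rw [smul_apply, smul_eq_mul]
    linarith
  exact (metricAt_sharp g x _ h1 w).trans (h1 w)

/-- The motion of the apparent fluid. -/
lemma nabla_apparentField (hY : ∀ y, SmoothFieldAt Y y) (hK : IsKilling g Y) :
    ∃ p, IsOrthProj g x (perp g x (timePlane X₀ Y x)) (divTensor g (pressure g μ X₀ Y) x) p ∧
      μ x • nabla g X₀ x (X₀ x) =
        chargeDensity g X₀ Y x • endo g (emField g Y) x (X₀ x) - p := by
  have hX1 := h.fluid.unit _ h.mem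
  have hY1 := h.fluid.unit_Y _ h.mem
  have hXY := h.fluid.orth _ h.mem
  rw [chartMetric_self, chartField_self] at hX1 hXY
  rw [chartMetric_self, chartField_self] at hY1
  rw [chartField_self] at hXY
  let d : E := divTensor g (pressure g μ X₀ Y) x
  let a : E := X₀ x
  let b : E := Y x
  -- `-q` is the projection of `d` on the time-plane, since `X₀`, `Y` are orthogonal of square `-1`
  let q : E := metricAt g x a d • a + metricAt g x b d • b
  have hpa : metricAt g x (d + q) a = 0 := by
    have h1 : metricAt g x a a = -1 := hX1
    have h2 : metricAt g x a b = 0 := hXY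
    simp only [q, map_add, map_smul, add_apply, smul_apply, smul_eq_mul, metricAt_symm g x d,
      metricAt_symm g x b a, h1, h2]
    ring
  have hpb : metricAt g x (d + q) b = 0 := by
    have h1 : metricAt g x b b = -1 := hY1
    have h2 : metricAt g x a b = 0 := hXY
    simp only [q, map_add, map_smul, add_apply, smul_apply, smul_eq_mul, metricAt_symm g x d,
      h1, h2]
    ring
  have hmem (w : TangentSpace 𝓘(ℝ, E) x) (hw : w ∈ timePlane X₀ Y x) :
      ∃ s t : ℝ, (w : E) = s • a + t • b := by
    obtain ⟨s, t, hst⟩ := Submodule.mem_span_pair.1 hw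
    exact ⟨s, t, hst.symm⟩
  have hperp (w : E) (ha : metricAt g x w a = 0) (hb : metricAt g x w b = 0) :
      metricAt g x (d - (d + q)) w = 0 := by
    simp only [q, map_add, map_sub, map_smul, add_apply, sub_apply, smul_apply, smul_eq_mul,
      metricAt_symm g x a w, metricAt_symm g x b w, ha, hb]
    ring
  refine ⟨(d + q : E), ⟨?_, ?_⟩, ?_⟩
  · intro w hw
    obtain ⟨s, t, hst⟩ := hmem w hw
    refine (congrArg (metricAt g x (d + q)) hst).trans ?_
    rw [map_add, map_smul, map_smul, hpa, hpb, smul_zero, smul_zero, add_zero]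
  · intro w hw
    have ha : metricAt g x w a = 0 := hw _ (Submodule.subset_span (by simp [a]))
    have hb : metricAt g x w b = 0 := hw _ (Submodule.subset_span (by simp [b]))
    exact hperp w ha hb
  · refine metricAt_ext (g := g) (x := x) fun w ↦ ?_
    have h1 := h.fluid.motion_X₀ h.mem w
    rw [h.energy_self, h.charge_self, h.divT_field, h.divT_field, ← h.metricAt_divTensor,
      chartMetric_self, chartField_self, chartField_self, ← h.metricAt_endo_emField hY hK,
      ← nabla_eq_cov X₀ x (X₀ x)] at h1
    have h2 (c e : ℝ) (p r : E) (hpr : c * metricAt g x p w =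
        e * metricAt g x r w - (metricAt g x d w + metricAt g x a d * metricAt g x a w
          + metricAt g x b d * metricAt g x b w)) :
        metricAt g x (c • p) w = metricAt g x (e • r - (d + q)) w := by
      simp only [q, map_add, map_sub, map_smul, add_apply, sub_apply, smul_apply, smul_eq_mul]
      linarith
    exact h2 _ _ _ _ h1

/-- The inhomogeneous Maxwell equation. -/
lemma divTensor_emField (hY : ∀ y, SmoothFieldAt Y y) (hK : IsKilling g Y) :
    divTensor g (emField g Y) x = chargeDensity g X₀ Y x • X₀ x
      + (1 / 2 * contraction g x (emField g Y x)) • Y x - endo g (pressure g μ X₀ Y) x (Y x) := by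
  refine metricAt_ext (g := g) (x := x) fun w ↦ ?_
  have hz := mem_extChartAt_target (I := 𝓘(ℝ, E)) x
  have hg := isMetricOn_chartMetric g x
  have hd : DifferentiableAt ℝ (fun z ↦ (2 : ℝ) • (chartMetric g x z ∘L
      Coord.cov (chartMetric g x) (chartField Y x) z)) (extChartAt 𝓘(ℝ, E) x x) :=
    smooth_differentiableAt (((hg.smooth _ hz).clm_comp
      (hg.contDiffAt_cov hz ((isKillingOn_chartField hY hK x).smooth _ hz))).const_smul _)
  have h1 := (isChartTensor_emField_killing hY hK x).metricAt_divTensor (g := g) hd w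
  rw [h.fluid.maxwell h.mem w, h.charge_self, chartMetric_self, chartField_self,
    chartField_self] at h1
  have h2 := contraction_emField hY hK x
  have h3 : metricAt g x (endo g (pressure g μ X₀ Y) x (Y x)) w =
      Coord.press (chartMetric g x) (chartField X₀ x) (chartField Y x) (extChartAt 𝓘(ℝ, E) x x)
        (Y x) w := by
    have h4 := h.chartField_endo_pressure h.mem
    rw [chartField_self, chartField_self] at h4
    have h5 := (isMetricOn_chartMetric g x).apply_inverse hz (Coord.press (chartMetric g x)
      (chartField X₀ x) (chartField Y x) (extChartAt 𝓘(ℝ, E) x x) (Y x)) w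
    rw [← h4, chartMetric_self] at h5
    exact h5
  have h6 (e c S : ℝ) (q a b r : E) (hS : c = 4 * S) (hq : metricAt g x q w =
      e * metricAt g x a w + 2 * S * metricAt g x b w - metricAt g x r w) :
      metricAt g x q w = metricAt g x (e • a + (1 / 2 * c) • b - r) w := by
    simp only [map_add, map_sub, map_smul, add_apply, sub_apply, smul_apply, smul_eq_mul]
    rw [hq, hS]
    ring
  rw [← h3] at h1
  exact h6 _ _ _ _ _ _ _ h2 h1

/-- The pressure vanishes on the time-plane. -/
lemma pressure_timePlane (v w : TangentSpace 𝓘(ℝ, E) x) (hv : v ∈ timePlane X₀ Y x)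
    (hw : w ∈ timePlane X₀ Y x) : pressure g μ X₀ Y x v w = 0 := by
  refine (h.isChartTensor_pressure.self v w).trans (h.fluid.press_timePlane h.mem ?_ ?_)
  · rw [chartField_self, chartField_self]
    exact hv
  · rw [chartField_self, chartField_self]
    exact hw

end IsChartFluid

end FluidChart

section Submersion

variable {E : Type*} [NormedAddCommGroup E] [NormedSpace ℝ E] [FiniteDimensional ℝ E]
  {M : Type*} [TopologicalSpace M] [ChartedSpace E M] [IsManifold 𝓘(ℝ, E) ∞ M]
  {F : Type*} [NormedAddCommGroup F] [NormedSpace ℝ F] [FiniteDimensional ℝ F]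
  {B : Type*} [TopologicalSpace B] [ChartedSpace F B] [IsManifold 𝓘(ℝ, F) ∞ B]
  {p : M → B} {x : M} {z : E}

/-! ### Submersions in charts -/

/-- The coordinate expression of a map `p : M → B` in the charts at `x` and `p x`. -/
def projChart (p : M → B) (x : M) (z : E) : F :=
  extChartAt 𝓘(ℝ, F) (p x) (p ((extChartAt 𝓘(ℝ, E) x).symm z))

/-- The derivative at `y` of a map between manifolds, as a map between the model spaces. -/
def derivAt (p : M → B) (y : M) : E →L[ℝ] F := mfderiv 𝓘(ℝ, E) 𝓘(ℝ, F) p y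

variable (hp : ContMDiff 𝓘(ℝ, E) 𝓘(ℝ, F) ∞ p) (hz : z ∈ (extChartAt 𝓘(ℝ, E) x).target)
  (hzB : p ((extChartAt 𝓘(ℝ, E) x).symm z) ∈ (chartAt F (p x)).source)
include hp hz hzB

lemma contDiffAt_projChart : ContDiffAt ℝ ∞ (projChart p x : E → F) z := by
  have h1 := (contMDiffAt_extChartAt' (I := 𝓘(ℝ, F)) (n := ∞) hzB).comp z
    (hp.contMDiffAt.comp z (contMDiffAt_extChartAt_symm hz))
  exact h1.contDiffAt

/-- The derivative of the coordinate expression, up to an invertible factor. -/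
lemma exists_fderiv_projChart : ∃ C : F →L[ℝ] F, C.IsInvertible ∧
    ∀ v, fderiv ℝ (projChart p x : E → F) z v =
      C ((derivAt p ((extChartAt 𝓘(ℝ, E) x).symm z) : E →L[ℝ] F) (frame x z v)) := by
  have h1 := (contMDiffAt_extChartAt' (I := 𝓘(ℝ, F)) (n := ∞) hzB).mdifferentiableAt (by simp)
    |>.hasMFDerivAt
  have h2 := (hp.contMDiffAt (x := (extChartAt 𝓘(ℝ, E) x).symm z)).mdifferentiableAt (by simp)
    |>.hasMFDerivAt
  have h3 := (contMDiffAt_extChartAt_symm hz).mdifferentiableAt (by simp) |>.hasMFDerivAt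
  have h4 := (h1.comp z (h2.comp z h3)).hasFDerivAt
  let C : F →L[ℝ] F := mfderiv 𝓘(ℝ, F) 𝓘(ℝ, F) (extChartAt 𝓘(ℝ, F) (p x))
    (p ((extChartAt 𝓘(ℝ, E) x).symm z))
  have h5 : HasFDerivAt (projChart p x : E → F)
    (C ∘L (derivAt p ((extChartAt 𝓘(ℝ, E) x).symm z) : E →L[ℝ] F) ∘L frame x z) z := h4
  refine ⟨C, isInvertible_mfderiv_extChartAt (by rwa [extChartAt_source]), fun v ↦ ?_⟩
  rw [h5.fderiv]
  rfl

lemma fderiv_projChart_eq_zero_iff (v : E) : fderiv ℝ (projChart p x : E → F) z v = 0 ↔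
    (derivAt p ((extChartAt 𝓘(ℝ, E) x).symm z) : E →L[ℝ] F) (frame x z v) = 0 := by
  obtain ⟨C, ⟨C, rfl⟩, h⟩ := exists_fderiv_projChart hp hz hzB
  rw [h]
  exact C.map_eq_zero_iff

lemma exists_rightInverse_fderiv_projChart
    (hs : Function.Surjective (derivAt p ((extChartAt 𝓘(ℝ, E) x).symm z) : E → F)) :
    ∃ s : F →L[ℝ] E, ∀ q, fderiv ℝ (projChart p x : E → F) z (s q) = q := by
  obtain ⟨C, ⟨C, rfl⟩, h⟩ := exists_fderiv_projChart hp hz hzB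
  have hsurj : Function.Surjective (fderiv ℝ (projChart p x : E → F) z) := fun q ↦ by
    obtain ⟨w, hw⟩ := hs (C.symm q)
    obtain ⟨v, rfl⟩ := frame_surjective hz w
    exact ⟨v, by rw [h, hw]; exact C.apply_symm_apply q⟩
  obtain ⟨s, hs⟩ := LinearMap.exists_rightInverse_of_surjective
    (fderiv ℝ (projChart p x : E → F) z).toLinearMap
    (LinearMap.range_eq_top.2 hsurj)
  exact ⟨LinearMap.toContinuousLinearMap s, fun q ↦ LinearMap.congr_fun hs q⟩

end Submersion

namespace MultiFiberBundle

variable {m : ℕ}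
  {M : Type*} [TopologicalSpace M] [ChartedSpace (EuclideanSpace ℝ (Fin (5 + m))) M]
  [IsManifold (𝓡 (5 + m)) ∞ M]
  {B : Type*} [TopologicalSpace B] [ChartedSpace (EuclideanSpace ℝ (Fin 4)) B]
  {W : Type*} [TopologicalSpace W] [ChartedSpace (EuclideanSpace ℝ (Fin m)) W]
  (b : MultiFiberBundle m M B W)

/-! ### The horizontal eigenspaces in a chart -/

/-- The projection of a fiber bundle is a submersion: local trivializations give local sections. -/
lemma derivAt_proj_surjective (y : M) :
    Function.Surjective (derivAt b.proj y :
      EuclideanSpace ℝ (Fin (5 + m)) → EuclideanSpace ℝ (Fin 4)) := by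
  obtain ⟨U, τ, hU, hyU, hsource, htarget, hτ, -, hτs⟩ := b.locally_trivial (b.proj y)
  have hy : y ∈ τ.source := by rw [hsource]; exact hyU
  have hmem (q : B) (hq : q ∈ U) : (q, (τ y).2) ∈ τ.target := by
    rw [htarget]; exact ⟨hq, trivial⟩
  have hσy : τ.symm (b.proj y, (τ y).2) = y := by
    rw [← hτ y hy]; exact τ.left_inv hy
  have hσ : ContMDiffAt (𝓡 4) (𝓡 (5 + m)) ∞ (fun q ↦ τ.symm (q, (τ y).2)) (b.proj y) :=
    (hτs.contMDiffAt (τ.open_target.mem_nhds (hmem _ hyU))).comp (b.proj y)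
      (contMDiffAt_id.prodMk contMDiffAt_const)
  have h1 := (hσ.mdifferentiableAt (by simp)).hasMFDerivAt
  have h2 : HasMFDerivAt (𝓡 (5 + m)) (𝓡 4) b.proj (τ.symm (b.proj y, (τ y).2))
      (derivAt b.proj y : EuclideanSpace ℝ (Fin (5 + m)) →L[ℝ] EuclideanSpace ℝ (Fin 4)) := by
    rw [hσy]
    exact (b.contMDiff_proj.contMDiffAt.mdifferentiableAt (by simp)).hasMFDerivAt
  have h3 := h2.comp (b.proj y) h1
  have h4 : b.proj ∘ (fun q ↦ τ.symm (q, (τ y).2)) =ᶠ[𝓝 (b.proj y)] id := by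
    filter_upwards [hU.mem_nhds hyU] with q hq
    have h5 := hτ _ (τ.map_target (hmem q hq))
    rw [τ.right_inv (hmem q hq)] at h5
    exact h5.symm
  have h5 := hasMFDerivAt_unique (hasMFDerivAt_id (b.proj y))
    (h3.congr_of_eventuallyEq h4.symm)
  intro q
  exact ⟨_, (DFunLike.congr_fun h5 q).symm⟩

variable {b} {g : SemiRiemannianMetric (EuclideanSpace ℝ (Fin (5 + m))) M}
  {D : Set M} {μ : M → ℝ} {X₀ Y : ∀ x : M, TangentSpace (𝓡 (5 + m)) x} {x : M}
  {z : EuclideanSpace ℝ (Fin (5 + m))}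

lemma metricAt_endo_einstein (x : M) (u v : EuclideanSpace ℝ (Fin (5 + m))) :
    metricAt g x (endo g (einstein g) x v) u = einstein g x u v := by
  have h (u v : EuclideanSpace ℝ (Fin (5 + m))) : einstein g x u v =
      Coord.ein (chartMetric g x) (extChartAt (𝓡 (5 + m)) x x) u v := by
    have h1 := einstein_chart (g := g) (mem_chart_source _ x) u v
    rw [frame_self] at h1
    exact h1
  exact metricAt_sharp g x
    ((Coord.ein (chartMetric g x) (extChartAt (𝓡 (5 + m)) x x)).flip v) (fun u ↦ h u v) u

/-- A horizontal vector `v` lies in the eigenspace for `c` if and only if `G(u, v) = c g(u, v)` for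
all horizontal vectors `u`. -/
lemma mem_horizontalEigenspace_iff {c : ℝ} {v : TangentSpace (𝓡 (5 + m)) x} :
    v ∈ b.horizontalEigenspace g x c ↔ v ∈ b.horizontal g x ∧
      ∀ u ∈ b.horizontal g x, einstein g x u v = c * g.val x v u := by
  have key (u : TangentSpace (𝓡 (5 + m)) x) :
      g.val x (endo g (einstein g) x v - c • v) u = einstein g x u v - c * g.val x v u := by
    have h1 (p q w : EuclideanSpace ℝ (Fin (5 + m))) :
        metricAt g x (p - c • q) w = metricAt g x p w - c * metricAt g x q w := by
      simp
    exact (h1 _ _ _).trans (congrArg (· - _) (metricAt_endo_einstein x u v))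
  refine ⟨fun h ↦ ⟨h.1, fun u hu ↦ ?_⟩, fun h ↦ ⟨h.1, (b.horizontal g x).smul_mem c h.1,
    fun u hu ↦ ?_⟩⟩
  · exact sub_eq_zero.1 ((key u).symm.trans (h.2.2 u hu))
  · exact (key u).trans (sub_eq_zero.2 (h.2 u hu))

section Chart

variable [IsManifold (𝓡 4) ∞ B]

/-- The part of the chart at `x` over `D` on which the projection is expressed in the chart at its
image. -/
def fluidChart (b : MultiFiberBundle m M B W) (D : Set M) (x : M) :
    Set (EuclideanSpace ℝ (Fin (5 + m))) :=
  (extChartAt (𝓡 (5 + m)) x).target ∩ (extChartAt (𝓡 (5 + m)) x).symm ⁻¹'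
    (D ∩ b.proj ⁻¹' (chartAt (EuclideanSpace ℝ (Fin 4)) (b.proj x)).source)

lemma isOpen_fluidChart (hD : IsOpen D) : IsOpen (b.fluidChart D x) :=
  (continuousOn_extChartAt_symm x).isOpen_inter_preimage (isOpen_extChartAt_target x)
    (hD.inter ((chartAt _ (b.proj x)).open_source.preimage b.contMDiff_proj.continuous))

/-- In the chart, the kernel of the derivative of the projection is the tangent space of the
fiber. -/
lemma fderiv_proj_eq_zero_iff (hz : z ∈ b.fluidChart D x) (v : EuclideanSpace ℝ (Fin (5 + m))) :
    fderiv ℝ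
        (projChart b.proj x : EuclideanSpace ℝ (Fin (5 + m)) → EuclideanSpace ℝ (Fin 4)) z v = 0
      ↔ (frame x z v : TangentSpace (𝓡 (5 + m)) ((extChartAt (𝓡 (5 + m)) x).symm z)) ∈
        b.tangentF ((extChartAt (𝓡 (5 + m)) x).symm z) :=
  (fderiv_projChart_eq_zero_iff b.contMDiff_proj hz.1 hz.2.2 v).trans Iff.rfl

lemma isHorizontal_iff (hz : z ∈ b.fluidChart D x) (u : EuclideanSpace ℝ (Fin (5 + m))) :
    Coord.IsHorizontal (chartMetric g x)
      (projChart b.proj x : EuclideanSpace ℝ (Fin (5 + m)) → EuclideanSpace ℝ (Fin 4)) z u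
      ↔ (frame x z u : TangentSpace (𝓡 (5 + m)) ((extChartAt (𝓡 (5 + m)) x).symm z)) ∈
        b.horizontal g ((extChartAt (𝓡 (5 + m)) x).symm z) := by
  constructor
  · intro h w hw
    obtain ⟨w, rfl⟩ := frame_surjective hz.1 w
    exact h w ((fderiv_proj_eq_zero_iff hz w).2 hw)
  · intro h w hw
    exact h _ ((fderiv_proj_eq_zero_iff hz w).1 hw)

lemma IsFluidDomain.mem_eigenspace (hD : b.IsFluidDomain g D μ X₀) (hx : x ∈ D) :
    X₀ x ∈ b.horizontalEigenspace g x (-μ x) := by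
  rw [hD.eigenspace x hx]
  exact Submodule.mem_span_singleton_self _

lemma IsFluidDomain.einstein_eq (hD : b.IsFluidDomain g D μ X₀) (hx : x ∈ D)
    {u : TangentSpace (𝓡 (5 + m)) x} (hu : u ∈ b.horizontal g x) :
    einstein g x u (X₀ x) = -μ x * g.val x (X₀ x) u :=
  (mem_horizontalEigenspace_iff.1 (hD.mem_eigenspace hx)).2 u hu

lemma IsFluidDomain.horizontal (hD : b.IsFluidDomain g D μ X₀) (hx : x ∈ D) :
    X₀ x ∈ b.horizontal g x := (hD.mem_eigenspace hx).1

lemma IsFluidDomain.einstein_self (hD : b.IsFluidDomain g D μ X₀) (hx : x ∈ D) :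
    einstein g x (X₀ x) (X₀ x) = μ x := by
  rw [hD.einstein_eq hx (hD.horizontal hx), hD.unit x hx]
  ring

lemma IsPotential.smoothFieldAt (hY : b.IsPotential g Y) (y : M) : SmoothFieldAt Y y :=
  ContMDiffOn.contMDiffAt hY.smooth Filter.univ_mem

/-- A fluid domain and its potential have the coordinates of a fluid. -/
theorem IsFluidDomain.isChartFluid (hD : b.IsFluidDomain g D μ X₀) (hY : b.IsPotential g Y)
    (hx : x ∈ D) : IsChartFluid g μ X₀ Y x (b.fluidChart D x) := by
  have hm := (isMetricOn_chartMetric g x).mono (isOpen_fluidChart (b := b) (x := x) hD.isOpen)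
    fun _ hz ↦ hz.1
  have hk := (isKillingOn_chartField (g := g) hY.smoothFieldAt hY.killing x).mono
    (V := b.fluidChart D x) fun _ hz ↦ hz.1
  have hX₀ : ∀ z ∈ b.fluidChart D x, ContDiffAt ℝ ∞ (chartField X₀ x) z := fun z hz ↦
    (smoothFieldAt_iff hz.1 X₀).1 (ContMDiffOn.contMDiffAt hD.smooth (hD.isOpen.mem_nhds hz.2.1))
  have hunit : ∀ z ∈ b.fluidChart D x,
      chartMetric g x z (chartField X₀ x z) (chartField X₀ x z) = -1 := fun z hz ↦ by
    rw [metricAt_frame hz.1]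
    exact hD.unit _ hz.2.1
  have henergy : ∀ z ∈ b.fluidChart D x, μ ((extChartAt (𝓡 (5 + m)) x).symm z) =
      Coord.energy (chartMetric g x) (chartField X₀ x) z := fun z hz ↦ by
    rw [Coord.energy, ← einstein_field hz.1]
    exact (hD.einstein_self hz.2.1).symm
  have hhor : ∀ z ∈ b.fluidChart D x, Coord.IsHorizontal (chartMetric g x)
      (projChart b.proj x : EuclideanSpace ℝ (Fin (5 + m)) → EuclideanSpace ℝ (Fin 4)) z
        (chartField X₀ x z) := fun z hz ↦ by
    rw [isHorizontal_iff hz, frame_chartField hz.1]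
    exact hD.horizontal hz.2.1
  have hYv : ∀ z ∈ b.fluidChart D x, fderiv ℝ
      (projChart b.proj x : EuclideanSpace ℝ (Fin (5 + m)) → EuclideanSpace ℝ (Fin 4)) z
        (chartField Y x z) = 0 := fun z hz ↦ by
    rw [fderiv_proj_eq_zero_iff hz, frame_chartField hz.1]
    exact (hY.tangent _).1
  have hein (z : EuclideanSpace ℝ (Fin (5 + m))) (hz : z ∈ b.fluidChart D x)
      (v u : EuclideanSpace ℝ (Fin (5 + m))) :
      einstein g ((extChartAt (𝓡 (5 + m)) x).symm z) (frame x z u) (frame x z v) =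
          -μ ((extChartAt (𝓡 (5 + m)) x).symm z) *
            g.val ((extChartAt (𝓡 (5 + m)) x).symm z) (frame x z v) (frame x z u) ↔
        Coord.ein (chartMetric g x) z u v =
          -Coord.energy (chartMetric g x) (chartField X₀ x) z * chartMetric g x z u v := by
    rw [einstein_frame hz.1, ← henergy z hz, hm.symm z hz u]
    exact Iff.rfl
  refine ⟨⟨hm, hk, fun z hz ↦ ?_, hX₀, hunit, fun z hz ↦ ?_, fun z hz ↦ ?_, fun z hz ↦ ?_⟩,
    fun z hz ↦ hz.1, ⟨mem_extChartAt_target x, ?_⟩, henergy⟩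
  · rw [metricAt_frame hz.1]
    exact hY.unit _
  · exact hhor z hz _ (hYv z hz)
  · rw [← henergy z hz]
    exact (hD.pos _ hz.2.1).ne'
  · obtain ⟨s, hs⟩ := exists_rightInverse_fderiv_projChart b.contMDiff_proj hz.1 hz.2.2
      (b.derivAt_proj_surjective _)
    refine Coord.bracket_eq_of_eigenspace hm hk hz
      (fun z hz ↦ contDiffAt_projChart b.contMDiff_proj hz.1 hz.2.2) hs hYv
      (smooth_differentiableAt (hX₀ z hz)) hhor hunit (fun z hz u hu ↦ ?_) fun Z hZ hGZ ↦ ?_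
    · rw [← hein z hz, frame_chartField hz.1]
      exact hD.einstein_eq hz.2.1 ((isHorizontal_iff hz u).1 hu)
    · have h1 : (frame x z Z : TangentSpace (𝓡 (5 + m)) ((extChartAt (𝓡 (5 + m)) x).symm z)) ∈
          b.horizontalEigenspace g ((extChartAt (𝓡 (5 + m)) x).symm z)
            (-μ ((extChartAt (𝓡 (5 + m)) x).symm z)) := by
        refine mem_horizontalEigenspace_iff.2 ⟨(isHorizontal_iff hz Z).1 hZ, fun w hw ↦ ?_⟩
        obtain ⟨u, rfl⟩ := frame_surjective hz.1 w
        exact (hein z hz Z u).2 (hGZ u ((isHorizontal_iff hz u).2 hw))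
      rw [hD.eigenspace _ hz.2.1] at h1
      obtain ⟨c, hc⟩ := Submodule.mem_span_singleton.1 h1
      refine ⟨c, frame_injective hz.1 ?_⟩
      rw [map_smul, frame_chartField hz.1]
      exact hc.symm
  · rw [Set.mem_preimage, extChartAt_to_inv]
    exact ⟨hx, mem_chart_source _ _⟩

end Chart

end MultiFiberBundle

end

end KaluzaKlein

theorem mainTheorem2 (m : ℕ)
    {B : Type*} [TopologicalSpace B] [T2Space B] [SecondCountableTopology B]
    [ChartedSpace (EuclideanSpace ℝ (Fin 4)) B] [IsManifold (𝓡 4) ∞ B]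
    {W : Type*} [TopologicalSpace W] [T2Space W] [CompactSpace W]
    [ChartedSpace (EuclideanSpace ℝ (Fin m)) W] [IsManifold (𝓡 m) ∞ W]
    {M : Type*} [TopologicalSpace M] [T2Space M] [SecondCountableTopology M]
    [ChartedSpace (EuclideanSpace ℝ (Fin (5 + m))) M] [IsManifold (𝓡 (5 + m)) ∞ M]
    (b : MultiFiberBundle m M B W)
    (g : SemiRiemannianMetric (EuclideanSpace ℝ (Fin (5 + m))) M) (hg : b.IsCompatible g)
    (Y : ∀ x : M, TangentSpace (𝓡 (5 + m)) x) (hY : b.IsPotential g Y)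
    (D : Set M) (μ : M → ℝ) (X₀ : ∀ x : M, TangentSpace (𝓡 (5 + m)) x)
    (hD : b.IsFluidDomain g D μ X₀)
    (e : M → ℝ) (he : e = chargeDensity g X₀ Y)
    (X : ∀ x : M, TangentSpace (𝓡 (5 + m)) x) (hX : X = fluidField g μ X₀ Y)
    (P : TwoTensor (EuclideanSpace ℝ (Fin (5 + m))) M) (hP : P = pressure g μ X₀ Y)
    (F : TwoTensor (EuclideanSpace ℝ (Fin (5 + m))) M) (hF : F = emField g Y) :
    ∀ x ∈ D,
      -- `P` vanishes on the time-plane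
      (∀ v ∈ timePlane X₀ Y x, ∀ w ∈ timePlane X₀ Y x, P x v w = 0) ∧
      -- energy conservation
      divField g (fun y ↦ μ y • X y) x = g.val x (X₀ x) (divTensor g P x) ∧
      divField g (fun y ↦ μ y • X₀ y) x = g.val x (X₀ x) (divTensor g P x) ∧
      -- charge conservation
      divField g (fun y ↦ e y • X y) x = g.val x (Y x) (divTensor g P x) ∧
      divField g (fun y ↦ e y • X₀ y) x = g.val x (Y x) (divTensor g P x) ∧
      divField g (fun y ↦ endo g P y (Y y)) x = g.val x (Y x) (divTensor g P x) ∧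
      -- variation of `e / μ` along the fluid
      μ x ^ 2 * dirDeriv (fun y ↦ e y / μ y) x (X x) =
        μ x * g.val x (Y x) (divTensor g P x) - e x * g.val x (X₀ x) (divTensor g P x) ∧
      -- motion of the fluid
      μ x • nabla g X x (X x) = -divTensor g P x - g.val x (X₀ x) (divTensor g P x) • X x ∧
      -- motion of the apparent fluid
      (∃ p, IsOrthProj g x (perp g x (timePlane X₀ Y x)) (divTensor g P x) p ∧
        μ x • nabla g X₀ x (X₀ x) = e x • endo g F x (X₀ x) - p) ∧
      -- Maxwell equations
      (∀ u v w, extDerivTwo F x u v w = 0) ∧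
      divTensor g F x =
        e x • X₀ x + (1 / 2 * contraction g x (F x)) • Y x - endo g P x (Y x) := by
  subst he hX hP hF
  intro x hx
  have h := hD.isChartFluid hY hx
  exact ⟨fun v hv w hw ↦ h.pressure_timePlane v w hv hw, h.divField_energy_fluidField,
    h.divField_energy_apparentField,
    h.divField_charge_fluidField, h.divField_charge_apparentField, h.divField_endo_pressure,
    h.dirDeriv_ratio, h.nabla_fluidField, h.nabla_apparentField hY.smoothFieldAt hY.killing,
    extDerivTwo_emField hY.smoothFieldAt x, h.divTensor_emField hY.smoothFieldAt hY.killing⟩
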